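/- Let $\Bbbk$ be a field of characteristic $0$. All vector spaces are $\mathbb Z$-graded over $\Bbbk$, differentials have degree $+1$, $|v|$ is the degree of $v$, $\tau(x\otimes y)=(-1)^{|x||y|}y\otimes x$, and the Koszul sign rule is used when (tensor products of) maps are evaluated on elements. **Operads.** A stable corolla is a pair $(C,G)$ of a finite set $C$ and $G\in\frac12\mathbb Z_{\ge 0}$ with $2(G-1)+\operatorname{card}C>0$; morphisms $(C,G)\to(D,G')$ exist only for $G=G'$ and are then the bijections $C\to D$. A *modular operad* $P$ is a functor from stable corollas to dg vector spaces, with degree-$0$ chain maps $${}_a\circ_b: P(C_1\sqcup\{a\},G_1)\otimes P(C_2\sqcup\{b\},G_2)\to P(C_1\sqcup C_2,G_1+G_2),\qquad \circ_{ab}=\circ_{ba}: P(C\sqcup\{a,b\},G)\to P(C,G+1)$$ (defined whenever the sources are stable) that are equivariant under bijections and satisfy, whenever the expressions make sense, ${}_a\circ_b(x\otimes y)=(-1)^{|x||y|}{}_b\circ_a(y\otimes x)$ and $$\circ_{ab}\circ_{cd}=\circ_{cd}\circ_{ab},\quad \circ_{ab}\,{}_c\circ_d=\circ_{cd}\,{}_a\circ_b,\quad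 {}_a\circ_b(\circ_{cd}\otimes1)=\circ_{cd}\,{}_a\circ_b,\quad {}_a\circ_b(1\otimes{}_c\circ_d)={}_c\circ_d({}_a\circ_b\otimes1).$$ An *odd modular operad* $Q$ is defined in the same way, except that its compositions, written ${}_a\bullet_b$ and $\bullet_{ab}$, are chain maps of degree $1$ (so $d\bullet=-\bullet d$) and that the last four equations get an extra minus sign. A *connected sum* on a (possibly odd) modular operad $P$ consists of degree-$0$ chain maps $\#_2:P(C,G)\otimes P(C',G')\to P(C\sqcup C',G+G'+1)$ and $\#_1:P(C,G)\to P(C,G+2)$ that are equivariant under bijections, such that $\#_2\tau=\#_2$, $\#_2(1\otimes\#_2)=\#_2(\#_2\otimes1)$, $\#_2(\#_1\otimes1)=\#_1\#_2$, $\circ_{ab}\#_1=\#_1\circ_{ab}$, ${}_a\circ_b(\#_1\otimes1)=\#_1\,{}_a\circ_b$; such that on $P(C,G)\otimes P(C',G')$ the map $\circ_{ab}\#_2$ equals $\#_2(\circ_{ab}\otimes1)$ if $a,b\in C$, $\#_2(1\otimes\circ_{ab})$ if $a,b\in C'$, $\#_1\,{}_a\circ_b$ if $a\in C,b\in C'$,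 and $\#_1\,{}_b\circ_a$ if $b\in C,a\in C'$; and such that on $P(C\sqcup\{a\},G)\otimes P(C',G')\otimes P(C'',G'')$ the map ${}_a\circ_b(1\otimes\#_2)$ equals $\#_2({}_a\circ_b\otimes1)$ if $b\in C'$ and $\#_2(1\otimes{}_a\circ_b)(\tau\otimes1)$ if $b\in C''$ (with $\bullet$ in place of $\circ$ in the odd case). **Formal functions.** Let $P$ be a modular operad with a connected sum and $Q$ an odd modular operad with a connected sum. Write $[n]=\{1,\dots,n\}$ and $$\mathrm{Fun}(P,Q)(n,G)=\bigl(P([n],G)\otimes Q([n],G)\bigr)^{\Sigma_n},\qquad \mathrm{Fun}(P,Q)=\prod_{n,G}\mathrm{Fun}(P,Q)(n,G),$$ over all $n$ and $G$ for which $([n],G)$ is stable. On it there are the operators $d=d_P\otimes1-1\otimes d_Q$; $$\Delta=(\circ_{ab}\otimes\bullet_{ab})(\theta\otimes\theta):\mathrm{Fun}(P,Q)(n+2,G)\to\mathrm{Fun}(P,Q)(n,G+1)$$ for any bijection $\theta:[n+2]\to[n]\sqcup\{a,b\}$; the bracket $\mathrm{Fun}(P,Q)(n_1+1,G_1)\otimes\mathrm{Fun}(P,Q)(n_2+1,G_2)\to\mathrm{Fun}(P,Q)(n_1+n_2,G_1+G_2)$,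 $$\{X,Y\}=(-1)^{|X|}\,2\sum_{C_1,C_2}({}_a\circ_b\otimes{}_a\bullet_b)(\theta_1\otimes\theta_2\otimes\theta_1\otimes\theta_2)(1\otimes\tau\otimes1)(X\otimes Y),$$ with the sum over the decompositions $C_1\sqcup C_2=[n_1+n_2]$ with $\operatorname{card}C_i=n_i$, for arbitrary bijections $\theta_1:[n_1+1]\to C_1\sqcup\{a\}$, $\theta_2:[n_2+1]\to C_2\sqcup\{b\}$; the product $\star:\mathrm{Fun}(P,Q)(n_1,G_1)\otimes\mathrm{Fun}(P,Q)(n_2,G_2)\to\mathrm{Fun}(P,Q)(n_1+n_2,G_1+G_2+1)$, $$\star=\sum_{C_1,C_2}(\#_2\otimes\#_2)(\theta_1\otimes\theta_2\otimes\theta_1\otimes\theta_2)(1\otimes\tau\otimes1),$$ with the sum over the same decompositions and arbitrary bijections $\theta_i:[n_i]\to C_i$; and $\sharp=\#_1\otimes\#_1:\mathrm{Fun}(P,Q)(n,G)\to\mathrm{Fun}(P,Q)(n,G+2)$. The operations $d,\Delta,\{-,-\}$ are extended to all of $\mathrm{Fun}(P,Q)$ componentwise. **Completion.** For $w\in\frac12\mathbb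 Z$ put $$\tilde{\mathrm F}_w=\bigoplus_{n/2+G+2q+1=w,\ q\in\mathbb Z}\mathrm{Fun}(P,Q)(n,G)\otimes\Bbbk\varkappa^q,\qquad \tilde{\mathrm F}_{\ge w}=\prod_{\tilde w\ge w}\tilde{\mathrm F}_{\tilde w},$$ with $d,\Delta,\sharp$ extended $\varkappa$-linearly, $\star$ extended by $\varkappa^{q_1}\star\varkappa^{q_2}=\varkappa^{q_1+q_2}$, and $\varkappa$ acting by $\varkappa^q\mapsto\varkappa^{q+1}$, and let $$\mathrm{Fun}_{\mathrm{Exp}}(P,Q)=\tilde{\mathrm F}_{\ge 1/2}\,/\,\{\sharp X-\varkappa X\mid X\in\tilde{\mathrm F}_{\ge-3/2}\},$$ with the induced operations $d$, $\Delta$, $\star$ and $\varkappa$. Let $\iota:\mathrm{Fun}(P,Q)\to\mathrm{Fun}_{\mathrm{Exp}}(P,Q)$ be the map induced by $S\mapsto S\otimes\varkappa^0$, and let $\iota(S)/\varkappa$ be the class of $S\otimes\varkappa^{-1}$, which lies in $\tilde{\mathrm F}_{\ge1/2}$ by stability; it is the only $y$ with $\varkappa y=\iota(S)$. For $X\in\mathrm{Fun}_{\mathrm{Exp}}(P,Q)$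 let $e^X=1+X+X^2/2!+X^3/3!+\cdots\in\Bbbk\oplus\mathrm{Fun}_{\mathrm{Exp}}(P,Q)$, with the powers taken with respect to $\star$, and extend $d+\Delta$ by $(d+\Delta)(1)=0$. **Statement.** Assume that $\sharp:\mathrm{Fun}(P,Q)(n,G)\to\mathrm{Fun}(P,Q)(n,G+2)$ is injective for all $n,G$. Then a degree-$0$ element $S\in\mathrm{Fun}(P,Q)$ satisfies the quantum master equation $$(d+\Delta)S+\tfrac12\{S,S\}=0$$ if and only if $$(d+\Delta)\,e^{\iota(S)/\varkappa}=0\quad\text{in }\mathrm{Fun}_{\mathrm{Exp}}(P,Q).$$ -/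

import Mathlib

open scoped TensorProduct DirectSum

universe u v w

noncomputable section

namespace BDOperad

/-! ### Differential graded vector spaces -/

/-- A `ℤ`-graded vector space with a differential of degree `+1`. -/
structure DGSpace (k : Type u) [Field k] where
  carrier : Type v
  [acg : AddCommGroup carrier]
  [mod : Module k carrier]
  deg : ℤ → Submodule k carrier
  [dec : DirectSum.Decomposition deg]
  d : carrier →ₗ[k] carrier
  d_mem : ∀ {i : ℤ} {x : carrier}, x ∈ deg i → d x ∈ deg (i + 1)
  d_d : ∀ x, d (d x) = 0

instance instCoeSortDGSpace {k : Type u} [Field k] :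
    CoeSort (DGSpace.{u, v} k) (Type v) := ⟨DGSpace.carrier⟩

instance instACGDGSpace {k : Type u} [Field k] (V : DGSpace.{u, v} k) :
    AddCommGroup V.carrier := V.acg

instance instModDGSpace {k : Type u} [Field k] (V : DGSpace.{u, v} k) :
    Module k V.carrier := V.mod

instance instDecDGSpace {k : Type u} [Field k] (V : DGSpace.{u, v} k) :
    DirectSum.Decomposition V.deg := V.dec

namespace DGSpace

variable {k : Type u} [Field k]

/-- Multiplication by `(-1) ^ (i * j)` on the part of degree `j`. -/
def twist (V : DGSpace.{u, v} k) (i : ℤ) : V →ₗ[k] V :=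
  DirectSum.toModule k ℤ V (fun j => ((-1 : k) ^ (i * j)) • (V.deg j).subtype) ∘ₗ
    (DirectSum.decomposeLinearEquiv V.deg).toLinearMap

/-- The parity operator `x ↦ (-1)^|x| x`. -/
def sgn (V : DGSpace.{u, v} k) : V →ₗ[k] V := V.twist 1

/-- The monoidal symmetry `τ (x ⊗ y) = (-1)^(|x| |y|) y ⊗ x` of graded vector spaces. -/
def koszulSwap (V : DGSpace.{u, v} k) (W : DGSpace.{u, w} k) : V ⊗[k] W →ₗ[k] W ⊗[k] V :=
  TensorProduct.lift
    (DirectSum.toModule k ℤ (W →ₗ[k] W ⊗[k] V)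
        (fun i => ((TensorProduct.mk k W V) ∘ₗ W.twist i).flip ∘ₗ (V.deg i).subtype) ∘ₗ
      (DirectSum.decomposeLinearEquiv V.deg).toLinearMap)

/-- The map `1 ⊗ τ ⊗ 1 : (V ⊗ W) ⊗ (V' ⊗ W') → (V ⊗ V') ⊗ (W ⊗ W')`. -/
def middleSwap (V : DGSpace.{u, v} k) (W : DGSpace.{u, w} k) (V' : DGSpace.{u, v} k)
    (W' : DGSpace.{u, w} k) :
    (V ⊗[k] W) ⊗[k] (V' ⊗[k] W') →ₗ[k] (V ⊗[k] V') ⊗[k] (W ⊗[k] W') :=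
  (TensorProduct.assoc k V V' (W ⊗[k] W')).symm.toLinearMap ∘ₗ
    LinearMap.lTensor V
      ((TensorProduct.assoc k V' W W').toLinearMap ∘ₗ
        LinearMap.rTensor W' (koszulSwap W V') ∘ₗ
        (TensorProduct.assoc k W V' W').symm.toLinearMap) ∘ₗ
    (TensorProduct.assoc k V W (V' ⊗[k] W')).toLinearMap

/-- The part of degree `i` of the tensor product `V ⊗ W`. -/
def tensorDeg (V : DGSpace.{u, v} k) (W : DGSpace.{u, w} k) (i : ℤ) : Submodule k (V ⊗[k] W) :=
  ⨆ p : ℤ, Submodule.map₂ (TensorProduct.mk k V W) (V.deg p) (W.deg (i - p))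

/-! Basic facts about signs. -/

theorem twist_apply (V : DGSpace.{u, v} k) (i : ℤ) {j : ℤ} {x : V} (hx : x ∈ V.deg j) :
    V.twist i x = ((-1 : k) ^ (i * j)) • x := by
  obtain ⟨x, rfl⟩ : ∃ z : V.deg j, (z : V) = x := ⟨⟨x, hx⟩, rfl⟩
  simp [twist]

theorem sgn_apply (V : DGSpace.{u, v} k) {j : ℤ} {x : V} (hx : x ∈ V.deg j) :
    V.sgn x = ((-1 : k) ^ j) • x := by
  simp [sgn, twist_apply V 1 hx]

theorem koszulSwap_apply (V : DGSpace.{u, v} k) (W : DGSpace.{u, w} k) {i j : ℤ} {x : V} {y : W}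
    (hx : x ∈ V.deg i) (hy : y ∈ W.deg j) :
    koszulSwap V W (x ⊗ₜ y) = ((-1 : k) ^ (i * j)) • (y ⊗ₜ[k] x) := by
  obtain ⟨x, rfl⟩ : ∃ z : V.deg i, (z : V) = x := ⟨⟨x, hx⟩, rfl⟩
  simp [koszulSwap, twist_apply W i hy, TensorProduct.smul_tmul']

theorem middleSwap_apply (V : DGSpace.{u, v} k) (W : DGSpace.{u, w} k) (V' : DGSpace.{u, v} k)
    (W' : DGSpace.{u, w} k) {i j : ℤ} (x : V) {y : W} {x' : V'}
    (y' : W') (hy : y ∈ W.deg i) (hx' : x' ∈ V'.deg j) :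
    middleSwap V W V' W' ((x ⊗ₜ y) ⊗ₜ (x' ⊗ₜ y')) =
      ((-1 : k) ^ (i * j)) • ((x ⊗ₜ[k] x') ⊗ₜ[k] (y ⊗ₜ[k] y')) := by
  simp [middleSwap, koszulSwap_apply W V' hy hx', TensorProduct.smul_tmul', TensorProduct.tmul_smul]

theorem induction_deg (V : DGSpace.{u, v} k) {p : V → Prop} (x : V)
    (hz : p 0) (hom : ∀ i : ℤ, ∀ x ∈ V.deg i, p x) (add : ∀ x y, p x → p y → p (x + y)) : p x :=
  DirectSum.Decomposition.inductionOn V.deg hz (fun {i} m => hom i m.1 m.2) (fun x y => add x y) x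

/-- Induction on pure tensors of homogeneous elements. -/
theorem tensor_induction (V : DGSpace.{u, v} k) (W : DGSpace.{u, w} k) {p : V ⊗[k] W → Prop} (x : V ⊗[k] W)
    (hz : p 0) (add : ∀ x y, p x → p y → p (x + y))
    (tmul : ∀ (i j : ℤ) (x : V) (y : W), x ∈ V.deg i → y ∈ W.deg j → p (x ⊗ₜ y)) : p x := by
  induction x using TensorProduct.induction_on with
  | zero => exact hz
  | add x y hx hy => exact add x y hx hy
  | tmul x y =>
    refine V.induction_deg (p := fun x => p (x ⊗ₜ y)) x (by simpa using hz) (fun i x hx => ?_)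
      (fun a b ha hb => by rw [TensorProduct.add_tmul]; exact add _ _ ha hb)
    refine W.induction_deg (p := fun y => p (x ⊗ₜ y)) y (by simpa using hz)
      (fun j y hy => tmul i j x y hx hy)
      (fun a b ha hb => by rw [TensorProduct.tmul_add]; exact add _ _ ha hb)

end DGSpace

/-! ### Stable corollas -/

/-- A stable corolla `(C, G)`: `C` is a finite set of labels (taken from a fixed infinite set),
`G` is a non-negative half-integer, recorded through `twoG = 2 G`, and `2 (G - 1) + card C > 0`. -/
@[ext]
structure Cor where
  legs : Finset ℕ
  twoG : ℕ
  stable : 2 < twoG + legs.card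

/-- Morphisms `(C, G) → (D, G')` of corollas: bijections `C ≃ D`, only if `G = G'`. -/
structure Cor.Hom (c d : Cor) where
  equiv : c.legs ≃ d.legs
  twoG_eq : d.twoG = c.twoG

/-- `ρ.Maps x y` says that `x` is a label of the source and `ρ x = y`. -/
def Cor.Hom.Maps {c d : Cor} (ρ : Cor.Hom c d) (x y : ℕ) : Prop :=
  ∃ hx : x ∈ c.legs, (ρ.equiv ⟨x, hx⟩ : ℕ) = y

def Cor.Hom.id (c : Cor) : Cor.Hom c c := ⟨Equiv.refl _, rfl⟩

def Cor.Hom.comp {c d e : Cor} (ρ : Cor.Hom c d) (σ : Cor.Hom d e) : Cor.Hom c e :=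
  ⟨ρ.equiv.trans σ.equiv, σ.twoG_eq.trans ρ.twoG_eq⟩

/-- `c = (C₁ ⊔ {a}, G₁)`, `c' = (C₂ ⊔ {b}, G₂)` and `e = (C₁ ⊔ C₂, G₁ + G₂)`. -/
structure Glue (a b : ℕ) (c c' e : Cor) : Prop where
  left : a ∈ c.legs
  right : b ∈ c'.legs
  disj : Disjoint c.legs c'.legs
  legs_eq : e.legs = c.legs.erase a ∪ c'.legs.erase b
  twoG_eq : e.twoG = c.twoG + c'.twoG

/-- `c = (C ⊔ {a, b}, G)` and `e = (C, G + 1)`. -/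
structure SelfGlue (a b : ℕ) (c e : Cor) : Prop where
  ne : a ≠ b
  left : a ∈ c.legs
  right : b ∈ c.legs
  legs_eq : e.legs = (c.legs.erase a).erase b
  twoG_eq : e.twoG = c.twoG + 2

/-- `c = (C, G)`, `c' = (C', G')` and `e = (C ⊔ C', G + G' + 1)`. -/
structure ConnSum (c c' e : Cor) : Prop where
  disj : Disjoint c.legs c'.legs
  legs_eq : e.legs = c.legs ∪ c'.legs
  twoG_eq : e.twoG = c.twoG + c'.twoG + 2

/-- `c = (C, G)` and `e = (C, G + 2)`. -/
structure Handle (c e : Cor) : Prop where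
  legs_eq : e.legs = c.legs
  twoG_eq : e.twoG = c.twoG + 4

/-! ### Modular operads and connected sums -/

/-- A functor from stable corollas to dg vector spaces, with operadic compositions `a∘b` and
self-compositions `∘ab` that are chain maps of degree `δ` and satisfy the axioms of a modular
operad, with Koszul signs, and with an extra sign `(-1)^δ` in the axioms
on two successive compositions.
For `δ = 0` this is a modular operad, for `δ = 1` an odd modular operad. -/
structure TwistedModularOperad (k : Type u) [Field k] (δ : ℤ) where
  obj : Cor → DGSpace.{u, v} k
  map : ∀ {c d : Cor}, Cor.Hom c d → (obj c →ₗ[k] obj d)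
  map_mem : ∀ {c d : Cor} (ρ : Cor.Hom c d) {i : ℤ} {x : obj c},
    x ∈ (obj c).deg i → map ρ x ∈ (obj d).deg i
  map_d : ∀ {c d : Cor} (ρ : Cor.Hom c d) (x : obj c), map ρ ((obj c).d x) = (obj d).d (map ρ x)
  map_id : ∀ (c : Cor) (x : obj c), map (Cor.Hom.id c) x = x
  map_comp : ∀ {c d e : Cor} (ρ : Cor.Hom c d) (σ : Cor.Hom d e) (x : obj c),
    map (ρ.comp σ) x = map σ (map ρ x)
  comp : ∀ {c c' e : Cor} (a b : ℕ), Glue a b c c' e → (obj c →ₗ[k] obj c' →ₗ[k] obj e)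
  self : ∀ {c e : Cor} (a b : ℕ), SelfGlue a b c e → (obj c →ₗ[k] obj e)
  comp_mem : ∀ {c c' e : Cor} {a b : ℕ} (h : Glue a b c c' e) {i j : ℤ} {x : obj c} {y : obj c'},
    x ∈ (obj c).deg i → y ∈ (obj c').deg j → comp a b h x y ∈ (obj e).deg (i + j + δ)
  self_mem : ∀ {c e : Cor} {a b : ℕ} (h : SelfGlue a b c e) {i : ℤ} {x : obj c},
    x ∈ (obj c).deg i → self a b h x ∈ (obj e).deg (i + δ)
  comp_d : ∀ {c c' e : Cor} {a b : ℕ} (h : Glue a b c c' e) {i : ℤ} {x : obj c} (y : obj c'),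
    x ∈ (obj c).deg i →
      (obj e).d (comp a b h x y) =
        ((-1 : k) ^ δ) • (comp a b h ((obj c).d x) y +
          ((-1 : k) ^ i) • comp a b h x ((obj c').d y))
  self_d : ∀ {c e : Cor} {a b : ℕ} (h : SelfGlue a b c e) (x : obj c),
    (obj e).d (self a b h x) = ((-1 : k) ^ δ) • self a b h ((obj c).d x)
  self_symm : ∀ {c e : Cor} {a b : ℕ} (h : SelfGlue a b c e) (h' : SelfGlue b a c e) (x : obj c),
    self a b h x = self b a h' x
  /-- Equivariance of `a∘b`. -/
  map_comp_op : ∀ {c c' e d d' f : Cor} {a b a' b' : ℕ} (h : Glue a b c c' e)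
    (h' : Glue a' b' d d' f) (ρ : Cor.Hom c d) (σ : Cor.Hom c' d') (τ : Cor.Hom e f),
    ρ.Maps a a' → σ.Maps b b' →
    (∀ x y, x ≠ a → ρ.Maps x y → τ.Maps x y) →
    (∀ x y, x ≠ b → σ.Maps x y → τ.Maps x y) →
    ∀ (x : obj c) (y : obj c'), map τ (comp a b h x y) = comp a' b' h' (map ρ x) (map σ y)
  /-- Equivariance of `∘ab`. -/
  map_self : ∀ {c e d f : Cor} {a b a' b' : ℕ} (h : SelfGlue a b c e)
    (h' : SelfGlue a' b' d f) (ρ : Cor.Hom c d) (τ : Cor.Hom e f),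
    ρ.Maps a a' → ρ.Maps b b' →
    (∀ x y, x ≠ a → x ≠ b → ρ.Maps x y → τ.Maps x y) →
    ∀ x : obj c, map τ (self a b h x) = self a' b' h' (map ρ x)
  /-- Symmetry of `a∘b`. -/
  comp_symm : ∀ {c c' e : Cor} {a b : ℕ} (h : Glue a b c c' e) (h' : Glue b a c' c e) {i j : ℤ}
    {x : obj c} {y : obj c'}, x ∈ (obj c).deg i → y ∈ (obj c').deg j →
      comp a b h x y = ((-1 : k) ^ (i * j)) • comp b a h' y x
  /-- `∘ab ∘cd = (-1)^δ ∘cd ∘ab`. -/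
  self_self : ∀ {x₀ e₁ e₂ f : Cor} {a b c d : ℕ} (h₁ : SelfGlue c d x₀ e₁)
    (h₁' : SelfGlue a b e₁ f) (h₂ : SelfGlue a b x₀ e₂) (h₂' : SelfGlue c d e₂ f) (x : obj x₀),
      self a b h₁' (self c d h₁ x) = ((-1 : k) ^ δ) • self c d h₂' (self a b h₂ x)
  /-- `∘ab (c∘d) = (-1)^δ ∘cd (a∘b)`. -/
  self_comp : ∀ {x₀ y₀ e₁ e₂ f : Cor} {a b c d : ℕ} (h₁ : Glue c d x₀ y₀ e₁)
    (h₁' : SelfGlue a b e₁ f) (h₂ : Glue a b x₀ y₀ e₂) (h₂' : SelfGlue c d e₂ f)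
    (x : obj x₀) (y : obj y₀),
      self a b h₁' (comp c d h₁ x y) = ((-1 : k) ^ δ) • self c d h₂' (comp a b h₂ x y)
  /-- `a∘b (∘cd ⊗ 1) = (-1)^δ ∘cd (a∘b)`. -/
  comp_self : ∀ {x₀ y₀ e₁ e₂ f : Cor} {a b c d : ℕ} (h₁ : SelfGlue c d x₀ e₁)
    (h₁' : Glue a b e₁ y₀ f) (h₂ : Glue a b x₀ y₀ e₂) (h₂' : SelfGlue c d e₂ f)
    (x : obj x₀) (y : obj y₀),
      comp a b h₁' (self c d h₁ x) y = ((-1 : k) ^ δ) • self c d h₂' (comp a b h₂ x y)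
  /-- `a∘b (1 ⊗ c∘d) = (-1)^δ c∘d (a∘b ⊗ 1)`, on elements. -/
  comp_comp : ∀ {x₀ y₀ z₀ e₁ e₂ f : Cor} {a b c d : ℕ} (h₁ : Glue c d y₀ z₀ e₁)
    (h₁' : Glue a b x₀ e₁ f) (h₂ : Glue a b x₀ y₀ e₂) (h₂' : Glue c d e₂ z₀ f)
    {i : ℤ} {x : obj x₀} (y : obj y₀) (z : obj z₀), x ∈ (obj x₀).deg i →
      ((-1 : k) ^ (δ * i)) • comp a b h₁' x (comp c d h₁ y z) =
        ((-1 : k) ^ δ) • comp c d h₂' (comp a b h₂ x y) z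

/-- A (`δ = 0`: ordinary, `δ = 1`: odd) modular operad with a connected sum: degree `0` chain maps
`#₂` (`csum`) and `#₁` (`handle`) that are equivariant, symmetric, associative and compatible
with the operadic compositions; the axioms are evaluated on elements with the Koszul sign rule. -/
structure TwistedModularOperadCS (k : Type u) [Field k] (δ : ℤ)
    extends TwistedModularOperad.{u, v} k δ where
  csum : ∀ {c c' e : Cor}, ConnSum c c' e → (obj c →ₗ[k] obj c' →ₗ[k] obj e)
  handle : ∀ {c e : Cor}, Handle c e → (obj c →ₗ[k] obj e)
  csum_mem : ∀ {c c' e : Cor} (h : ConnSum c c' e) {i j : ℤ} {x : obj c} {y : obj c'},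
    x ∈ (obj c).deg i → y ∈ (obj c').deg j → csum h x y ∈ (obj e).deg (i + j)
  handle_mem : ∀ {c e : Cor} (h : Handle c e) {i : ℤ} {x : obj c},
    x ∈ (obj c).deg i → handle h x ∈ (obj e).deg i
  csum_d : ∀ {c c' e : Cor} (h : ConnSum c c' e) {i : ℤ} {x : obj c} (y : obj c'),
    x ∈ (obj c).deg i →
      (obj e).d (csum h x y) =
        csum h ((obj c).d x) y + ((-1 : k) ^ i) • csum h x ((obj c').d y)
  handle_d : ∀ {c e : Cor} (h : Handle c e) (x : obj c),
    (obj e).d (handle h x) = handle h ((obj c).d x)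
  /-- Equivariance of `#₂`. -/
  map_csum : ∀ {c c' e d d' f : Cor} (h : ConnSum c c' e) (h' : ConnSum d d' f)
    (ρ : Cor.Hom c d) (σ : Cor.Hom c' d') (τ : Cor.Hom e f),
    (∀ x y, ρ.Maps x y → τ.Maps x y) → (∀ x y, σ.Maps x y → τ.Maps x y) →
    ∀ (x : obj c) (y : obj c'), map τ (csum h x y) = csum h' (map ρ x) (map σ y)
  /-- Equivariance of `#₁`. -/
  map_handle : ∀ {c e d f : Cor} (h : Handle c e) (h' : Handle d f)
    (ρ : Cor.Hom c d) (τ : Cor.Hom e f), (∀ x y, ρ.Maps x y → τ.Maps x y) →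
    ∀ x : obj c, map τ (handle h x) = handle h' (map ρ x)
  /-- Symmetry, `#₂ τ = #₂`. -/
  csum_symm : ∀ {c c' e : Cor} (h : ConnSum c c' e) (h' : ConnSum c' c e) {i j : ℤ}
    {x : obj c} {y : obj c'}, x ∈ (obj c).deg i → y ∈ (obj c').deg j →
      ((-1 : k) ^ (i * j)) • csum h' y x = csum h x y
  /-- `#₂ (1 ⊗ #₂) = #₂ (#₂ ⊗ 1)`. -/
  csum_assoc : ∀ {x₀ y₀ z₀ e₁ e₂ f : Cor} (h₁ : ConnSum y₀ z₀ e₁) (h₁' : ConnSum x₀ e₁ f)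
    (h₂ : ConnSum x₀ y₀ e₂) (h₂' : ConnSum e₂ z₀ f) (x : obj x₀) (y : obj y₀) (z : obj z₀),
      csum h₁' x (csum h₁ y z) = csum h₂' (csum h₂ x y) z
  /-- `#₂ (#₁ ⊗ 1) = #₁ #₂`. -/
  csum_handle : ∀ {x₀ y₀ e₁ e₂ f : Cor} (h₁ : Handle x₀ e₁) (h₁' : ConnSum e₁ y₀ f)
    (h₂ : ConnSum x₀ y₀ e₂) (h₂' : Handle e₂ f) (x : obj x₀) (y : obj y₀),
      csum h₁' (handle h₁ x) y = handle h₂' (csum h₂ x y)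
  /-- `∘ab #₁ = #₁ ∘ab`. -/
  self_handle : ∀ {x₀ e₁ e₂ f : Cor} {a b : ℕ} (h₁ : Handle x₀ e₁) (h₁' : SelfGlue a b e₁ f)
    (h₂ : SelfGlue a b x₀ e₂) (h₂' : Handle e₂ f) (x : obj x₀),
      self a b h₁' (handle h₁ x) = handle h₂' (self a b h₂ x)
  /-- `∘ab #₂` with both labels on the first argument: `#₂ (∘ab ⊗ 1)`. -/
  self_csum_left : ∀ {x₀ y₀ e₁ e₂ f : Cor} {a b : ℕ} (h₁ : ConnSum x₀ y₀ e₁)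
    (h₁' : SelfGlue a b e₁ f) (h₂ : SelfGlue a b x₀ e₂) (h₂' : ConnSum e₂ y₀ f)
    (x : obj x₀) (y : obj y₀),
      self a b h₁' (csum h₁ x y) = csum h₂' (self a b h₂ x) y
  /-- `∘ab #₂` with both labels on the second argument: `#₂ (1 ⊗ ∘ab)`. -/
  self_csum_right : ∀ {x₀ y₀ e₁ e₂ f : Cor} {a b : ℕ} (h₁ : ConnSum x₀ y₀ e₁)
    (h₁' : SelfGlue a b e₁ f) (h₂ : SelfGlue a b y₀ e₂) (h₂' : ConnSum x₀ e₂ f)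
    {i : ℤ} {x : obj x₀} (y : obj y₀), x ∈ (obj x₀).deg i →
      self a b h₁' (csum h₁ x y) = ((-1 : k) ^ (δ * i)) • csum h₂' x (self a b h₂ y)
  /-- `∘ab #₂` with `a` on the first and `b` on the second argument: `#₁ (a∘b)`. -/
  self_csum_mid : ∀ {x₀ y₀ e₁ e₂ f : Cor} {a b : ℕ} (h₁ : ConnSum x₀ y₀ e₁)
    (h₁' : SelfGlue a b e₁ f) (h₂ : Glue a b x₀ y₀ e₂) (h₂' : Handle e₂ f)
    (x : obj x₀) (y : obj y₀),
      self a b h₁' (csum h₁ x y) = handle h₂' (comp a b h₂ x y)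
  /-- `∘ab #₂` with `b` on the first and `a` on the second argument: `#₁ (b∘a)`. -/
  self_csum_mid' : ∀ {x₀ y₀ e₁ e₂ f : Cor} {a b : ℕ} (h₁ : ConnSum x₀ y₀ e₁)
    (h₁' : SelfGlue a b e₁ f) (h₂ : Glue b a x₀ y₀ e₂) (h₂' : Handle e₂ f)
    (x : obj x₀) (y : obj y₀),
      self a b h₁' (csum h₁ x y) = handle h₂' (comp b a h₂ x y)
  /-- `a∘b (#₁ ⊗ 1) = #₁ (a∘b)`. -/
  comp_handle : ∀ {x₀ y₀ e₁ e₂ f : Cor} {a b : ℕ} (h₁ : Handle x₀ e₁) (h₁' : Glue a b e₁ y₀ f)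
    (h₂ : Glue a b x₀ y₀ e₂) (h₂' : Handle e₂ f) (x : obj x₀) (y : obj y₀),
      comp a b h₁' (handle h₁ x) y = handle h₂' (comp a b h₂ x y)
  /-- `a∘b (1 ⊗ #₂)` with `b` on the second argument: `#₂ (a∘b ⊗ 1)`. -/
  comp_csum_left : ∀ {x₀ y₀ z₀ e₁ e₂ f : Cor} {a b : ℕ} (h₁ : ConnSum y₀ z₀ e₁)
    (h₁' : Glue a b x₀ e₁ f) (h₂ : Glue a b x₀ y₀ e₂) (h₂' : ConnSum e₂ z₀ f)
    (x : obj x₀) (y : obj y₀) (z : obj z₀),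
      comp a b h₁' x (csum h₁ y z) = csum h₂' (comp a b h₂ x y) z
  /-- `a∘b (1 ⊗ #₂)` with `b` on the third argument: `#₂ (1 ⊗ a∘b)(τ ⊗ 1)`. -/
  comp_csum_right : ∀ {x₀ y₀ z₀ e₁ e₂ f : Cor} {a b : ℕ} (h₁ : ConnSum y₀ z₀ e₁)
    (h₁' : Glue a b x₀ e₁ f) (h₂ : Glue a b x₀ z₀ e₂) (h₂' : ConnSum y₀ e₂ f)
    {i j : ℤ} {x : obj x₀} {y : obj y₀} (z : obj z₀),
    x ∈ (obj x₀).deg i → y ∈ (obj y₀).deg j →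
      comp a b h₁' x (csum h₁ y z) =
        ((-1 : k) ^ (i * j + δ * j)) • csum h₂' y (comp a b h₂ x z)

/-- Modular operads with a connected sum. -/
abbrev ModularOperadCS (k : Type u) [Field k] := TwistedModularOperadCS.{u, v} k 0

/-- Odd modular operads with a connected sum. -/
abbrev OddModularOperadCS (k : Type u) [Field k] := TwistedModularOperadCS.{u, v} k 1

/-! ### Operations on the tensor products `P(C, G) ⊗ Q(C, G)` -/

section Raw

variable {k : Type u} [Field k] (P : ModularOperadCS.{u, v} k) (Q : OddModularOperadCS.{u, w} k)

/-- `P(C, G) ⊗ Q(C, G)`. -/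
abbrev TP (c : Cor) : Type (max v w) := P.obj c ⊗[k] Q.obj c

variable {P Q}

/-- The action `ρ ⊗ ρ` of a bijection of labels. -/
def relabel {c d : Cor} (ρ : Cor.Hom c d) : TP P Q c →ₗ[k] TP P Q d :=
  TensorProduct.map (P.map ρ) (Q.map ρ)

/-- The parity operator `X ↦ (-1)^|X| X`. -/
def sgnRaw {c : Cor} : TP P Q c →ₗ[k] TP P Q c :=
  TensorProduct.map (P.obj c).sgn (Q.obj c).sgn

/-- `d_P ⊗ 1 - 1 ⊗ d_Q`. -/
def dRaw {c : Cor} : TP P Q c →ₗ[k] TP P Q c :=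
  TensorProduct.map (P.obj c).d LinearMap.id - TensorProduct.map (P.obj c).sgn (Q.obj c).d

/-- `∘ab ⊗ •ab`; the parity operator is the Koszul sign of `•ab` moving past `P`. -/
def selfRaw {c e : Cor} {a b : ℕ} (h : SelfGlue a b c e) : TP P Q c →ₗ[k] TP P Q e :=
  TensorProduct.map (P.self a b h ∘ₗ (P.obj c).sgn) (Q.self a b h)

/-- `(a∘b ⊗ a•b)(1 ⊗ τ ⊗ 1)`; the parity operators are the Koszul sign of `a•b` moving past the
two factors from `P`. -/
def compRaw {c c₂ e : Cor} {a b : ℕ} (h : Glue a b c c₂ e) :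
    TP P Q c →ₗ[k] TP P Q c₂ →ₗ[k] TP P Q e :=
  TensorProduct.curry
    (TensorProduct.map
        (TensorProduct.lift (P.comp a b h) ∘ₗ TensorProduct.map (P.obj c).sgn (P.obj c₂).sgn)
        (TensorProduct.lift (Q.comp a b h)) ∘ₗ
      DGSpace.middleSwap (P.obj c) (Q.obj c) (P.obj c₂) (Q.obj c₂))

/-- `(#₂ ⊗ #₂)(1 ⊗ τ ⊗ 1)`. -/
def csumRaw {c c₂ e : Cor} (h : ConnSum c c₂ e) : TP P Q c →ₗ[k] TP P Q c₂ →ₗ[k] TP P Q e :=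
  TensorProduct.curry
    (TensorProduct.map (TensorProduct.lift (P.csum h)) (TensorProduct.lift (Q.csum h)) ∘ₗ
      DGSpace.middleSwap (P.obj c) (Q.obj c) (P.obj c₂) (Q.obj c₂))

/-- `#₁ ⊗ #₁`. -/
def handleRaw {c e : Cor} (h : Handle c e) : TP P Q c →ₗ[k] TP P Q e :=
  TensorProduct.map (P.handle h) (Q.handle h)

/-! Basic facts about these operations. -/

theorem csumRaw_tmul {c c' e : Cor} (h : ConnSum c c' e) {i j : ℤ} (x : P.obj c) {y : Q.obj c}
    {x' : P.obj c'} (y' : Q.obj c') (hy : y ∈ (Q.obj c).deg i) (hx' : x' ∈ (P.obj c').deg j) :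
    csumRaw (P := P) (Q := Q) h (x ⊗ₜ y) (x' ⊗ₜ y') =
      ((-1 : k) ^ (i * j)) • (P.csum h x x' ⊗ₜ Q.csum h y y') := by
  simp [csumRaw, DGSpace.middleSwap_apply _ _ _ _ x y' hy hx']

theorem compRaw_tmul {c c' e : Cor} {a b : ℕ} (h : Glue a b c c' e) {i j l : ℤ} {x : P.obj c}
    {y : Q.obj c} {x' : P.obj c'} (y' : Q.obj c') (hx : x ∈ (P.obj c).deg l)
    (hy : y ∈ (Q.obj c).deg i) (hx' : x' ∈ (P.obj c').deg j) :
    compRaw (P := P) (Q := Q) h (x ⊗ₜ y) (x' ⊗ₜ y') =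
      ((-1 : k) ^ (i * j) * (-1 : k) ^ l * (-1 : k) ^ j) •
        (P.comp a b h x x' ⊗ₜ Q.comp a b h y y') := by
  simp [compRaw, DGSpace.middleSwap_apply _ _ _ _ x y' hy hx', DGSpace.sgn_apply _ hx,
    DGSpace.sgn_apply _ hx', TensorProduct.smul_tmul', smul_smul, mul_comm]

theorem selfRaw_tmul {c e : Cor} {a b : ℕ} (h : SelfGlue a b c e) {i : ℤ} {x : P.obj c}
    (y : Q.obj c) (hx : x ∈ (P.obj c).deg i) :
    selfRaw (P := P) (Q := Q) h (x ⊗ₜ y) =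
      ((-1 : k) ^ i) • (P.self a b h x ⊗ₜ Q.self a b h y) := by
  simp [selfRaw, DGSpace.sgn_apply _ hx, TensorProduct.smul_tmul']

theorem dRaw_tmul {c : Cor} {i : ℤ} {x : P.obj c} (y : Q.obj c) (hx : x ∈ (P.obj c).deg i) :
    dRaw (P := P) (Q := Q) (x ⊗ₜ y) =
      (P.obj c).d x ⊗ₜ y - ((-1 : k) ^ i) • (x ⊗ₜ (Q.obj c).d y) := by
  simp [dRaw, DGSpace.sgn_apply _ hx, TensorProduct.smul_tmul']

theorem sgnRaw_tmul {c : Cor} {i j : ℤ} {x : P.obj c} {y : Q.obj c} (hx : x ∈ (P.obj c).deg i)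
    (hy : y ∈ (Q.obj c).deg j) :
    sgnRaw (P := P) (Q := Q) (x ⊗ₜ y) = ((-1 : k) ^ i * (-1 : k) ^ j) • (x ⊗ₜ y) := by
  simp [sgnRaw, DGSpace.sgn_apply _ hx, DGSpace.sgn_apply _ hy, TensorProduct.smul_tmul', smul_smul,
    mul_comm]

@[simp] theorem handleRaw_tmul {c e : Cor} (h : Handle c e) (x : P.obj c) (y : Q.obj c) :
    handleRaw (P := P) (Q := Q) h (x ⊗ₜ y) = P.handle h x ⊗ₜ Q.handle h y := rfl

@[simp] theorem relabel_tmul {c d : Cor} (ρ : Cor.Hom c d) (x : P.obj c) (y : Q.obj c) :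
    relabel (P := P) (Q := Q) ρ (x ⊗ₜ y) = P.map ρ x ⊗ₜ Q.map ρ y := rfl

theorem relabel_id (c : Cor) (x : TP P Q c) : relabel (Cor.Hom.id c) x = x := by
  induction x using TensorProduct.induction_on with
  | zero => simp
  | add x y hx hy => simp [hx, hy]
  | tmul x y => simp [P.map_id, Q.map_id]

theorem relabel_comp {c d e : Cor} (ρ : Cor.Hom c d) (σ : Cor.Hom d e) (x : TP P Q c) :
    relabel (ρ.comp σ) x = relabel σ (relabel ρ x) := by
  induction x using TensorProduct.induction_on with
  | zero => simp
  | add x y hx hy => simp [hx, hy]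
  | tmul x y => simp [P.map_comp, Q.map_comp]

theorem TP.induction {c : Cor} {p : TP P Q c → Prop} (x : TP P Q c)
    (hz : p 0) (add : ∀ x y, p x → p y → p (x + y))
    (tmul : ∀ (i j : ℤ) (x : P.obj c) (y : Q.obj c), x ∈ (P.obj c).deg i → y ∈ (Q.obj c).deg j →
      p (x ⊗ₜ y)) : p x :=
  DGSpace.tensor_induction _ _ x hz add tmul

theorem relabel_sgnRaw {c d : Cor} (ρ : Cor.Hom c d) (x : TP P Q c) :
    relabel ρ (sgnRaw x) = sgnRaw (relabel ρ x) := by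
  induction x using TP.induction with
  | hz => simp
  | add x y hx hy => simp [hx, hy]
  | tmul i j x y hx hy =>
    rw [sgnRaw_tmul hx hy, relabel_tmul, sgnRaw_tmul (P.map_mem ρ hx) (Q.map_mem ρ hy)]; simp

theorem relabel_dRaw {c d : Cor} (ρ : Cor.Hom c d) (x : TP P Q c) :
    relabel ρ (dRaw x) = dRaw (relabel ρ x) := by
  induction x using TP.induction with
  | hz => simp
  | add x y hx hy => simp [hx, hy]
  | tmul i j x y hx hy =>
    rw [dRaw_tmul y hx, relabel_tmul, dRaw_tmul _ (P.map_mem ρ hx)]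
    simp [P.map_d, Q.map_d]

theorem relabel_selfRaw {c e d f : Cor} {a b a' b' : ℕ} (h : SelfGlue a b c e)
    (h' : SelfGlue a' b' d f) (ρ : Cor.Hom c d) (τ : Cor.Hom e f)
    (ha : ρ.Maps a a') (hb : ρ.Maps b b')
    (hτ : ∀ x y, x ≠ a → x ≠ b → ρ.Maps x y → τ.Maps x y) (x : TP P Q c) :
    relabel τ (selfRaw h x) = selfRaw h' (relabel ρ x) := by
  induction x using TP.induction with
  | hz => simp
  | add x y hx hy => simp [hx, hy]
  | tmul i j x y hx hy =>
    rw [selfRaw_tmul h y hx, relabel_tmul, selfRaw_tmul h' _ (P.map_mem ρ hx)]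
    simp [P.map_self h h' ρ τ ha hb hτ, Q.map_self h h' ρ τ ha hb hτ]

theorem relabel_csumRaw {c c' e d d' f : Cor} (h : ConnSum c c' e) (h' : ConnSum d d' f)
    (ρ : Cor.Hom c d) (σ : Cor.Hom c' d') (τ : Cor.Hom e f)
    (h₁ : ∀ x y, ρ.Maps x y → τ.Maps x y) (h₂ : ∀ x y, σ.Maps x y → τ.Maps x y)
    (x : TP P Q c) (y : TP P Q c') :
    relabel τ (csumRaw h x y) = csumRaw h' (relabel ρ x) (relabel σ y) := by
  induction x using TP.induction with
  | hz => simp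
  | add x y hx hy => simp [hx, hy]
  | tmul i j x x' hx hx' =>
    induction y using TP.induction with
    | hz => simp
    | add x y hx hy => simp [hx, hy]
    | tmul i' j' y y' hy hy' =>
      rw [csumRaw_tmul h x y' hx' hy, relabel_tmul, relabel_tmul,
        csumRaw_tmul h' _ _ (Q.map_mem ρ hx') (P.map_mem σ hy)]
      simp [P.map_csum h h' ρ σ τ h₁ h₂, Q.map_csum h h' ρ σ τ h₁ h₂]

theorem relabel_compRaw {c c' e d d' f : Cor} {a b a' b' : ℕ} (h : Glue a b c c' e)
    (h' : Glue a' b' d d' f) (ρ : Cor.Hom c d) (σ : Cor.Hom c' d') (τ : Cor.Hom e f)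
    (ha : ρ.Maps a a') (hb : σ.Maps b b')
    (h₁ : ∀ x y, x ≠ a → ρ.Maps x y → τ.Maps x y) (h₂ : ∀ x y, x ≠ b → σ.Maps x y → τ.Maps x y)
    (x : TP P Q c) (y : TP P Q c') :
    relabel τ (compRaw h x y) = compRaw h' (relabel ρ x) (relabel σ y) := by
  induction x using TP.induction with
  | hz => simp
  | add x y hx hy => simp [hx, hy]
  | tmul i j x x' hx hx' =>
    induction y using TP.induction with
    | hz => simp
    | add x y hx hy => simp [hx, hy]
    | tmul i' j' y y' hy hy' =>
      rw [compRaw_tmul h y' hx hx' hy, relabel_tmul, relabel_tmul,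
        compRaw_tmul h' _ (P.map_mem ρ hx) (Q.map_mem ρ hx') (P.map_mem σ hy)]
      simp [P.map_comp_op h h' ρ σ τ ha hb h₁ h₂, Q.map_comp_op h h' ρ σ τ ha hb h₁ h₂]

theorem relabel_handleRaw {c e d f : Cor} (h : Handle c e) (h' : Handle d f)
    (ρ : Cor.Hom c d) (τ : Cor.Hom e f) (hτ : ∀ x y, ρ.Maps x y → τ.Maps x y) (x : TP P Q c) :
    relabel τ (handleRaw h x) = handleRaw h' (relabel ρ x) := by
  induction x using TensorProduct.induction_on with
  | zero => simp
  | add x y hx hy => simp [hx, hy]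
  | tmul x y => simp [P.map_handle h h' ρ τ hτ, Q.map_handle h h' ρ τ hτ]

theorem dRaw_handleRaw {c e : Cor} (h : Handle c e) (x : TP P Q c) :
    dRaw (handleRaw h x) = handleRaw h (dRaw x) := by
  induction x using TP.induction with
  | hz => simp
  | add x y hx hy => simp [hx, hy]
  | tmul i j x y hx hy =>
    rw [dRaw_tmul y hx, handleRaw_tmul, dRaw_tmul _ (P.handle_mem h hx)]
    simp [P.handle_d, Q.handle_d]

theorem selfRaw_handleRaw {x₀ e₁ e₂ f : Cor} {a b : ℕ} (h₁ : Handle x₀ e₁)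
    (h₁' : SelfGlue a b e₁ f) (h₂ : SelfGlue a b x₀ e₂) (h₂' : Handle e₂ f) (x : TP P Q x₀) :
    selfRaw h₁' (handleRaw h₁ x) = handleRaw h₂' (selfRaw h₂ x) := by
  induction x using TP.induction with
  | hz => simp
  | add x y hx hy => simp [hx, hy]
  | tmul i j x y hx hy =>
    rw [selfRaw_tmul h₂ y hx, handleRaw_tmul, selfRaw_tmul h₁' _ (P.handle_mem h₁ hx)]
    simp [P.self_handle h₁ h₁' h₂ h₂', Q.self_handle h₁ h₁' h₂ h₂']

theorem csumRaw_handleRaw {x₀ y₀ e₁ e₂ f : Cor} (h₁ : Handle x₀ e₁) (h₁' : ConnSum e₁ y₀ f)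
    (h₂ : ConnSum x₀ y₀ e₂) (h₂' : Handle e₂ f) (x : TP P Q x₀) (y : TP P Q y₀) :
    csumRaw h₁' (handleRaw h₁ x) y = handleRaw h₂' (csumRaw h₂ x y) := by
  induction x using TP.induction with
  | hz => simp
  | add x y hx hy => simp [hx, hy]
  | tmul i j x x' hx hx' =>
    induction y using TP.induction with
    | hz => simp
    | add x y hx hy => rw [map_add, map_add, map_add, hx, hy]
    | tmul i' j' y y' hy hy' =>
      rw [csumRaw_tmul h₂ x y' hx' hy, handleRaw_tmul,
        csumRaw_tmul h₁' _ _ (Q.handle_mem h₁ hx') hy]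
      simp [P.csum_handle h₁ h₁' h₂ h₂', Q.csum_handle h₁ h₁' h₂ h₂']

theorem TwistedModularOperadCS.csum_handle_right {δ : ℤ} (R : TwistedModularOperadCS.{u, v} k δ)
    {x₀ y₀ e₁ e₂ f : Cor} (h₁ : Handle y₀ e₁) (h₁' : ConnSum x₀ e₁ f)
    (h₂ : ConnSum x₀ y₀ e₂) (h₂' : Handle e₂ f) (x : R.obj x₀) (y : R.obj y₀) :
    R.csum h₁' x (R.handle h₁ y) = R.handle h₂' (R.csum h₂ x y) := by
  have s₁ : ConnSum e₁ x₀ f :=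
    ⟨h₁'.disj.symm, by rw [h₁'.legs_eq, Finset.union_comm], by rw [h₁'.twoG_eq]; omega⟩
  have s₂ : ConnSum y₀ x₀ e₂ :=
    ⟨h₂.disj.symm, by rw [h₂.legs_eq, Finset.union_comm], by rw [h₂.twoG_eq]; omega⟩
  refine (R.obj x₀).induction_deg
    (p := fun x => R.csum h₁' x (R.handle h₁ y) = R.handle h₂' (R.csum h₂ x y)) x (by simp)
    (fun i x hx => ?_) (fun a b ha hb => by simp [ha, hb])
  refine (R.obj y₀).induction_deg
    (p := fun y => R.csum h₁' x (R.handle h₁ y) = R.handle h₂' (R.csum h₂ x y)) y (by simp)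
    (fun j y hy => ?_) (fun a b ha hb => by simp [ha, hb])
  rw [← R.csum_symm h₁' s₁ hx (R.handle_mem h₁ hy), R.csum_handle h₁ s₁ s₂ h₂',
    ← R.csum_symm h₂ s₂ hx hy, map_smul]

theorem csumRaw_handleRaw_right {x₀ y₀ e₁ e₂ f : Cor} (h₁ : Handle y₀ e₁) (h₁' : ConnSum x₀ e₁ f)
    (h₂ : ConnSum x₀ y₀ e₂) (h₂' : Handle e₂ f) (x : TP P Q x₀) (y : TP P Q y₀) :
    csumRaw h₁' x (handleRaw h₁ y) = handleRaw h₂' (csumRaw h₂ x y) := by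
  induction x using TP.induction with
  | hz => simp
  | add x y hx hy => simp [hx, hy]
  | tmul i j x x' hx hx' =>
    induction y using TP.induction with
    | hz => simp
    | add x y hx hy => simp [hx, hy]
    | tmul i' j' y y' hy hy' =>
      rw [csumRaw_tmul h₂ x y' hx' hy, handleRaw_tmul,
        csumRaw_tmul h₁' _ _ hx' (P.handle_mem h₁ hy)]
      simp [P.csum_handle_right h₁ h₁' h₂ h₂', Q.csum_handle_right h₁ h₁' h₂ h₂']

end Raw

/-! ### Relabelings by permutations -/

/-- The morphism given by a permutation of the set of all labels. -/
def Cor.Hom.ofPerm (π : Equiv.Perm ℕ) {c d : Cor} (hl : ∀ x, x ∈ c.legs ↔ π x ∈ d.legs)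
    (hg : d.twoG = c.twoG) : Cor.Hom c d :=
  ⟨π.subtypeEquiv hl, hg⟩

theorem Cor.Hom.ofPerm_maps (π : Equiv.Perm ℕ) {c d : Cor} (hl : ∀ x, x ∈ c.legs ↔ π x ∈ d.legs)
    (hg : d.twoG = c.twoG) (x y : ℕ) :
    (Cor.Hom.ofPerm π hl hg).Maps x y ↔ x ∈ c.legs ∧ π x = y := by
  simp [Cor.Hom.ofPerm, Cor.Hom.Maps]

theorem Cor.Hom.exists_perm {c : Cor} (σ : Cor.Hom c c) :
    ∃ (π : Equiv.Perm ℕ) (hl : ∀ x, x ∈ c.legs ↔ π x ∈ c.legs),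
      (∀ x, x ∉ c.legs → π x = x) ∧ σ = Cor.Hom.ofPerm π hl rfl := by
  let e : Equiv.Perm {x // x ∈ c.legs} := σ.equiv
  have hmem : ∀ x (hx : x ∈ c.legs), Equiv.Perm.ofSubtype e x = e ⟨x, hx⟩ :=
    fun x hx => Equiv.Perm.ofSubtype_apply_of_mem e hx
  have hnot : ∀ x, x ∉ c.legs → Equiv.Perm.ofSubtype e x = x :=
    fun x hx => Equiv.Perm.ofSubtype_apply_of_not_mem e hx
  have hl : ∀ x, x ∈ c.legs ↔ Equiv.Perm.ofSubtype e x ∈ c.legs := by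
    intro x
    by_cases hx : x ∈ c.legs
    · rw [hmem x hx]; simp [hx]
    · rw [hnot x hx]
  refine ⟨Equiv.Perm.ofSubtype e, hl, hnot, ?_⟩
  obtain ⟨s, hs⟩ := σ
  unfold Cor.Hom.ofPerm
  congr 1
  ext x
  exact (hmem x x.2).symm

/-- An arbitrary morphism between corollas of the same size and genus. -/
def Cor.arb {c d : Cor} (h : d.legs.card = c.legs.card) (hg : d.twoG = c.twoG) : Cor.Hom c d :=
  ⟨Finset.equivOfCardEq h.symm, hg⟩

/-! ### The spaces `Fun(P, Q)(n, G)` and their operations -/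

/-- Pairs `(n, G)` for which the corolla `([n], G)` is stable; `g` stands for `2 G`. -/
@[ext]
structure Arity where
  n : ℕ
  g : ℕ
  stable : 2 < g + n

/-- The corolla `([n], G)`, where `[n] = {1, …, n}`. -/
abbrev Arity.cor (i : Arity) : Cor := ⟨Finset.Icc 1 i.n, i.g, by simpa using i.stable⟩

section Comp

variable {k : Type u} [Field k]

/-- `Fun(P, Q)(n, G) = (P([n], G) ⊗ Q([n], G))^{Σ_n}`. -/
def FunComp (P : ModularOperadCS.{u, v} k) (Q : OddModularOperadCS.{u, w} k) (i : Arity) :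
    Submodule k (TP P Q i.cor) where
  carrier := {x | ∀ σ : Cor.Hom i.cor i.cor, relabel σ x = x}
  zero_mem' := fun σ => map_zero _
  add_mem' := fun {x y} hx hy σ => by rw [map_add, hx σ, hy σ]
  smul_mem' := fun r x hx σ => by rw [map_smul, hx σ]

variable {P : ModularOperadCS.{u, v} k} {Q : OddModularOperadCS.{u, w} k}

/-- On invariants, relabelings do not depend on the bijection. -/
theorem relabel_eq {i : Arity} {c : Cor} (ρ ρ' : Cor.Hom i.cor c) {x : TP P Q i.cor}
    (hx : x ∈ FunComp P Q i) : relabel ρ x = relabel ρ' x := by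
  let τ : Cor.Hom c i.cor := ⟨ρ'.equiv.symm, ρ'.twoG_eq.symm⟩
  have h1 : relabel (ρ.comp τ) x = x := hx _
  have h2 : (ρ.comp τ).comp ρ' = ρ := by
    obtain ⟨r, hr⟩ := ρ
    simp only [Cor.Hom.comp, τ]
    congr 1
    ext x
    simp
  rw [← h2, relabel_comp, h1]

/-- The differential `d` on `Fun(P, Q)(n, G)`. -/
def dComp (i : Arity) : FunComp P Q i →ₗ[k] FunComp P Q i :=
  dRaw.restrict fun x hx σ => by rw [relabel_dRaw, hx σ]

/-- The operator `♯ : Fun(P, Q)(n, G) → Fun(P, Q)(n, G + 2)`. -/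
def sharpComp {i l : Arity} (hn : l.n = i.n) (hg : l.g = i.g + 4) :
    FunComp P Q i →ₗ[k] FunComp P Q l :=
  (handleRaw (P := P) (Q := Q) (c := i.cor) (e := l.cor)
      ⟨by simp [hn], hg⟩).restrict fun x hx σ => by
    let ρ : Cor.Hom i.cor i.cor :=
      ⟨(Equiv.subtypeEquivRight (by simp [hn])).trans
        (σ.equiv.trans (Equiv.subtypeEquivRight (by simp [hn]))), rfl⟩
    rw [relabel_handleRaw _ ⟨by simp [hn], hg⟩ ρ σ, hx ρ]
    rintro x y ⟨h, rfl⟩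
    exact ⟨by simpa [hn] using h, rfl⟩

/-- The operator `Δ : Fun(P, Q)(n + 2, G) → Fun(P, Q)(n, G + 1)`, where the bijection
`θ : [n + 2] ≅ [n] ⊔ {a, b}` is the identity, with `a = n + 1` and `b = n + 2`. -/
def deltaComp {i l : Arity} (hn : i.n = l.n + 2) (hg : l.g = i.g + 2) :
    FunComp P Q i →ₗ[k] FunComp P Q l :=
  have h : SelfGlue (l.n + 1) (l.n + 2) i.cor l.cor :=
    ⟨by omega, by simp [hn], by simp [hn],
      by ext x; simp [hn]; omega, hg⟩
  (selfRaw (P := P) (Q := Q) h).restrict fun x hx σ => by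
    obtain ⟨π, hl, hfix, rfl⟩ := σ.exists_perm
    have f1 : π (l.n + 1) = l.n + 1 := hfix _ (by simp)
    have f2 : π (l.n + 2) = l.n + 2 := hfix _ (by simp)
    have hl' : ∀ x, x ∈ i.cor.legs ↔ π x ∈ i.cor.legs := by
      have key : ∀ x, x ∈ i.cor.legs ↔ x ∈ l.cor.legs ∨ x = l.n + 1 ∨ x = l.n + 2 := by
        intro x; simp [hn]; omega
      intro x
      have g1 : π x = l.n + 1 ↔ x = l.n + 1 := by rw [← π.injective.eq_iff (a := x), f1]
      have g2 : π x = l.n + 2 ↔ x = l.n + 2 := by rw [← π.injective.eq_iff (a := x), f2]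
      rw [key, key, ← hl x, g1, g2]
    rw [relabel_selfRaw h h (Cor.Hom.ofPerm π hl' rfl), hx]
    · exact (Cor.Hom.ofPerm_maps _ _ _ _ _).2 ⟨h.left, f1⟩
    · exact (Cor.Hom.ofPerm_maps _ _ _ _ _).2 ⟨h.right, f2⟩
    · intro x y h1 h2 hxy
      rw [Cor.Hom.ofPerm_maps] at hxy ⊢
      refine ⟨?_, hxy.2⟩
      rw [h.legs_eq]
      simp [h1, h2, hxy.1]

/-- The first part `C₁` of a decomposition `C₁ ⊔ C₂ = [n]` with `card C₁ = m`. -/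
abbrev Decomp (m n : ℕ) := ↥(Finset.powersetCard m (Finset.Icc 1 n))

theorem Decomp.card {m n : ℕ} (C : Decomp m n) : C.1.card = m :=
  (Finset.mem_powersetCard.1 C.2).2

theorem Decomp.sub {m n : ℕ} (C : Decomp m n) : C.1 ⊆ Finset.Icc 1 n :=
  (Finset.mem_powersetCard.1 C.2).1

theorem Decomp.card_compl {m m' n : ℕ} (C : Decomp m n) (h : n = m + m') :
    (Finset.Icc 1 n \ C.1).card = m' := by
  rw [Finset.card_sdiff_of_subset C.sub, C.card]; simp [h]

/-- The action of a permutation of `[n]` on its decompositions. -/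
def Decomp.perm {m n : ℕ} (π : Equiv.Perm ℕ) (h : ∀ x, x ∈ Finset.Icc 1 n ↔ π x ∈ Finset.Icc 1 n) :
    Equiv.Perm (Decomp m n) where
  toFun C := ⟨C.1.map π.toEmbedding, by
    rw [Finset.mem_powersetCard]
    refine ⟨fun x hx => ?_, by simpa using C.card⟩
    obtain ⟨y, hy, rfl⟩ := Finset.mem_map.1 hx
    exact (h y).1 (C.sub hy)⟩
  invFun C := ⟨C.1.map π.symm.toEmbedding, by
    rw [Finset.mem_powersetCard]
    refine ⟨fun x hx => ?_, by simpa using C.card⟩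
    obtain ⟨y, hy, rfl⟩ := Finset.mem_map.1 hx
    refine (h _).2 ?_
    simpa using C.sub hy⟩
  left_inv C := by ext x; simp
  right_inv C := by ext x; simp

/-- For `C₁ ⊔ C₂ = [n₁ + n₂]`, the corolla `(C₁, G₁)`. -/
def Decomp.fst {i l : Arity} (C : Decomp i.n l.n) : Cor :=
  ⟨C.1, i.g, by rw [C.card]; exact i.stable⟩

/-- For `C₁ ⊔ C₂ = [n₁ + n₂]`, the corolla `(C₂, G₂)`. -/
def Decomp.snd {i j l : Arity} (C : Decomp i.n l.n) (hn : l.n = i.n + j.n) : Cor :=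
  ⟨Finset.Icc 1 l.n \ C.1, j.g, by rw [C.card_compl hn]; exact j.stable⟩

theorem Decomp.connSum {i j l : Arity} (C : Decomp i.n l.n) (hn : l.n = i.n + j.n)
    (hg : l.g = i.g + j.g + 2) : ConnSum C.fst (C.snd hn) l.cor :=
  ⟨Finset.disjoint_sdiff, (Finset.union_sdiff_of_subset C.sub).symm, hg⟩

/-- An arbitrary bijection `θ₁ : [n₁] ≅ C₁`. -/
def Decomp.θ₁ {i l : Arity} (C : Decomp i.n l.n) : Cor.Hom i.cor C.fst :=
  Cor.arb (by simp [Decomp.fst, C.card]) rfl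

/-- An arbitrary bijection `θ₂ : [n₂] ≅ C₂`. -/
def Decomp.θ₂ {i j l : Arity} (C : Decomp i.n l.n) (hn : l.n = i.n + j.n) :
    Cor.Hom j.cor (C.snd hn) :=
  Cor.arb (by simp [Decomp.snd, C.card_compl hn]) rfl

/-- The summand of `⋆` for a decomposition `C₁ ⊔ C₂ = [n₁ + n₂]`:
`(#₂ ⊗ #₂)(θ₁ ⊗ θ₂ ⊗ θ₁ ⊗ θ₂)(1 ⊗ τ ⊗ 1)`. -/
def starTerm {i j l : Arity} (hn : l.n = i.n + j.n) (hg : l.g = i.g + j.g + 2)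
    (C : Decomp i.n l.n) : TP P Q i.cor →ₗ[k] TP P Q j.cor →ₗ[k] TP P Q l.cor :=
  (csumRaw (C.connSum hn hg)).compl₁₂ (relabel C.θ₁) (relabel (C.θ₂ hn))

theorem relabel_starTerm {i j l : Arity} (hn : l.n = i.n + j.n) (hg : l.g = i.g + j.g + 2)
    (C : Decomp i.n l.n) {π : Equiv.Perm ℕ} (hl : ∀ x, x ∈ l.cor.legs ↔ π x ∈ l.cor.legs)
    {x : TP P Q i.cor} {y : TP P Q j.cor} (hx : x ∈ FunComp P Q i) (hy : y ∈ FunComp P Q j) :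
    relabel (Cor.Hom.ofPerm π hl rfl) (starTerm hn hg C x y) =
      starTerm hn hg (Decomp.perm π hl C) x y := by
  have e1 : ∀ z, z ∈ C.fst.legs ↔ π z ∈ (Decomp.fst (Decomp.perm π hl C)).legs := by
    intro z; simp [Decomp.perm, Decomp.fst]
  have e2 : ∀ z, z ∈ (C.snd hn).legs ↔ π z ∈ (Decomp.snd (Decomp.perm π hl C) hn).legs := by
    intro z
    simp only [Decomp.snd]
    rw [Finset.mem_sdiff, Finset.mem_sdiff]
    exact and_congr (hl z) (not_congr (e1 z))
  simp only [starTerm, LinearMap.compl₁₂_apply]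
  rw [relabel_csumRaw (C.connSum hn hg) (Decomp.connSum (Decomp.perm π hl C) hn hg)
    (Cor.Hom.ofPerm π e1 rfl) (Cor.Hom.ofPerm π e2 rfl),
    ← relabel_comp, ← relabel_comp, relabel_eq _ (Decomp.θ₁ (Decomp.perm π hl C)) hx,
    relabel_eq _ (Decomp.θ₂ (Decomp.perm π hl C) hn) hy]
  · intro z w hzw
    replace hzw := (Cor.Hom.ofPerm_maps _ _ _ _ _).1 hzw
    exact (Cor.Hom.ofPerm_maps _ _ _ _ _).2 ⟨C.sub hzw.1, hzw.2⟩
  · intro z w hzw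
    replace hzw := (Cor.Hom.ofPerm_maps _ _ _ _ _).1 hzw
    exact (Cor.Hom.ofPerm_maps _ _ _ _ _).2 ⟨(Finset.mem_sdiff.1 hzw.1).1, hzw.2⟩

/-- The product `⋆ : Fun(P, Q)(n₁, G₁) ⊗ Fun(P, Q)(n₂, G₂) → Fun(P, Q)(n₁ + n₂, G₁ + G₂ + 1)`. -/
def starComp {i j l : Arity} (hn : l.n = i.n + j.n) (hg : l.g = i.g + j.g + 2) :
    FunComp P Q i →ₗ[k] FunComp P Q j →ₗ[k] FunComp P Q l :=
  LinearMap.mk₂ k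
    (fun x y => ⟨∑ C : Decomp i.n l.n, starTerm hn hg C (x : TP P Q i.cor) (y : TP P Q j.cor),
      fun σ => by
        obtain ⟨π, hl, -, rfl⟩ := σ.exists_perm
        rw [map_sum]
        simp only [relabel_starTerm hn hg _ hl x.2 y.2]
        exact Equiv.sum_comp (Decomp.perm π hl)
          (fun C => starTerm hn hg C (x : TP P Q i.cor) (y : TP P Q j.cor))⟩)
    (fun x x' y => Subtype.ext (by simp [Finset.sum_add_distrib]))
    (fun r x y => Subtype.ext (by simp [Finset.smul_sum]))
    (fun x y y' => Subtype.ext (by simp [Finset.sum_add_distrib]))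
    (fun r x y => Subtype.ext (by simp [Finset.smul_sum]))

theorem Decomp.notMem {m n : ℕ} (C : Decomp m n) {x : ℕ} (hx : n < x) : x ∉ C.1 :=
  fun h => by have := (Finset.mem_Icc.1 (C.sub h)).2; omega

/-- For `C₁ ⊔ C₂ = [n₁ + n₂]`, the corolla `(C₁ ⊔ {a}, G₁)`, where `a = n₁ + n₂ + 1`. -/
def Decomp.fstPt {i l : Arity} {n₁ : ℕ} (C : Decomp n₁ l.n) (hi : i.n = n₁ + 1) : Cor :=
  ⟨insert (l.n + 1) C.1, i.g, by
    rw [Finset.card_insert_of_notMem (C.notMem (by omega)), C.card, ← hi]; exact i.stable⟩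

/-- For `C₁ ⊔ C₂ = [n₁ + n₂]`, the corolla `(C₂ ⊔ {b}, G₂)`, where `b = n₁ + n₂ + 2`. -/
def Decomp.sndPt {j l : Arity} {n₁ n₂ : ℕ} (C : Decomp n₁ l.n) (hj : j.n = n₂ + 1)
    (hn : l.n = n₁ + n₂) : Cor :=
  ⟨insert (l.n + 2) (Finset.Icc 1 l.n \ C.1), j.g, by
    rw [Finset.card_insert_of_notMem (by simp), C.card_compl hn, ← hj]; exact j.stable⟩

theorem Decomp.glue {i j l : Arity} {n₁ n₂ : ℕ} (C : Decomp n₁ l.n) (hi : i.n = n₁ + 1)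
    (hj : j.n = n₂ + 1) (hn : l.n = n₁ + n₂) (hg : l.g = i.g + j.g) :
    Glue (l.n + 1) (l.n + 2) (C.fstPt hi) (C.sndPt hj hn) l.cor where
  left := Finset.mem_insert_self _ _
  right := Finset.mem_insert_self _ _
  disj := by
    have h2 : l.n + 2 ∉ C.1 := C.notMem (by omega)
    simp [Decomp.fstPt, Decomp.sndPt, h2, Finset.disjoint_sdiff]
  legs_eq := by
    simp only [Decomp.fstPt, Decomp.sndPt]
    rw [Finset.erase_insert (C.notMem (by omega)), Finset.erase_insert (by simp)]
    exact (Finset.union_sdiff_of_subset C.sub).symm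
  twoG_eq := hg

/-- An arbitrary bijection `θ₁ : [n₁ + 1] ≅ C₁ ⊔ {a}`. -/
def Decomp.θPt₁ {i l : Arity} {n₁ : ℕ} (C : Decomp n₁ l.n) (hi : i.n = n₁ + 1) :
    Cor.Hom i.cor (C.fstPt hi) :=
  Cor.arb (by
    simp [Decomp.fstPt, Finset.card_insert_of_notMem (C.notMem (Nat.lt_succ_self l.n)),
      C.card, hi]) rfl

/-- An arbitrary bijection `θ₂ : [n₂ + 1] ≅ C₂ ⊔ {b}`. -/
def Decomp.θPt₂ {j l : Arity} {n₁ n₂ : ℕ} (C : Decomp n₁ l.n) (hj : j.n = n₂ + 1)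
    (hn : l.n = n₁ + n₂) : Cor.Hom j.cor (C.sndPt hj hn) :=
  Cor.arb (by
    simp only [Decomp.sndPt]
    rw [Finset.card_insert_of_notMem (by simp), C.card_compl hn, hj]; simp) rfl

/-- The summand of the bracket for a decomposition `C₁ ⊔ C₂ = [n₁ + n₂]`:
`(-1)^|X| (a∘b ⊗ a•b)(θ₁ ⊗ θ₂ ⊗ θ₁ ⊗ θ₂)(1 ⊗ τ ⊗ 1)(X ⊗ Y)`. -/
def brTerm {i j l : Arity} {n₁ n₂ : ℕ} (hi : i.n = n₁ + 1) (hj : j.n = n₂ + 1)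
    (hn : l.n = n₁ + n₂) (hg : l.g = i.g + j.g) (C : Decomp n₁ l.n) :
    TP P Q i.cor →ₗ[k] TP P Q j.cor →ₗ[k] TP P Q l.cor :=
  (compRaw (C.glue hi hj hn hg)).compl₁₂ (relabel (C.θPt₁ hi) ∘ₗ sgnRaw) (relabel (C.θPt₂ hj hn))

theorem relabel_brTerm {i j l : Arity} {n₁ n₂ : ℕ} (hi : i.n = n₁ + 1) (hj : j.n = n₂ + 1)
    (hn : l.n = n₁ + n₂) (hg : l.g = i.g + j.g) (C : Decomp n₁ l.n) {π : Equiv.Perm ℕ}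
    (hl : ∀ x, x ∈ l.cor.legs ↔ π x ∈ l.cor.legs) (hfix : ∀ x, x ∉ l.cor.legs → π x = x)
    {x : TP P Q i.cor} {y : TP P Q j.cor} (hx : x ∈ FunComp P Q i) (hy : y ∈ FunComp P Q j) :
    relabel (Cor.Hom.ofPerm π hl rfl) (brTerm hi hj hn hg C x y) =
      brTerm hi hj hn hg (Decomp.perm π hl C) x y := by
  have f1 : π (l.n + 1) = l.n + 1 := hfix _ (by simp)
  have f2 : π (l.n + 2) = l.n + 2 := hfix _ (by simp)
  have e0 : ∀ z, z ∈ C.1 ↔ π z ∈ (Decomp.perm π hl C).1 := by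
    intro z; simp [Decomp.perm]
  have e1 : ∀ z, z ∈ (C.fstPt hi).legs ↔ π z ∈ (Decomp.fstPt (Decomp.perm π hl C) hi).legs := by
    intro z
    simp only [Decomp.fstPt]
    rw [Finset.mem_insert, Finset.mem_insert, ← e0, ← π.injective.eq_iff (a := z), f1]
  have e2 : ∀ z, z ∈ (C.sndPt hj hn).legs ↔
      π z ∈ (Decomp.sndPt (Decomp.perm π hl C) hj hn).legs := by
    intro z
    simp only [Decomp.sndPt]
    rw [Finset.mem_insert, Finset.mem_insert, ← π.injective.eq_iff (a := z), f2,
      Finset.mem_sdiff, Finset.mem_sdiff, ← e0]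
    exact or_congr_right (and_congr_left' (hl z))
  have hsx : sgnRaw x ∈ FunComp P Q i := fun σ => by rw [relabel_sgnRaw, hx σ]
  simp only [brTerm, LinearMap.compl₁₂_apply, LinearMap.comp_apply]
  rw [relabel_compRaw (C.glue hi hj hn hg) (Decomp.glue (Decomp.perm π hl C) hi hj hn hg)
    (Cor.Hom.ofPerm π e1 rfl) (Cor.Hom.ofPerm π e2 rfl),
    ← relabel_comp, ← relabel_comp, relabel_eq _ (Decomp.θPt₁ (Decomp.perm π hl C) hi) hsx,
    relabel_eq _ (Decomp.θPt₂ (Decomp.perm π hl C) hj hn) hy]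
  · exact (Cor.Hom.ofPerm_maps _ _ _ _ _).2 ⟨Finset.mem_insert_self _ _, f1⟩
  · exact (Cor.Hom.ofPerm_maps _ _ _ _ _).2 ⟨Finset.mem_insert_self _ _, f2⟩
  · intro z w hz hzw
    replace hzw := (Cor.Hom.ofPerm_maps _ _ _ _ _).1 hzw
    exact (Cor.Hom.ofPerm_maps _ _ _ _ _).2 ⟨C.sub ((Finset.mem_insert.1 hzw.1).resolve_left hz), hzw.2⟩
  · intro z w hz hzw
    replace hzw := (Cor.Hom.ofPerm_maps _ _ _ _ _).1 hzw
    exact (Cor.Hom.ofPerm_maps _ _ _ _ _).2 ⟨(Finset.mem_sdiff.1 ((Finset.mem_insert.1 hzw.1).resolve_left hz)).1, hzw.2⟩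

/-- The bracket
`{-, -} : Fun(P, Q)(n₁ + 1, G₁) ⊗ Fun(P, Q)(n₂ + 1, G₂) → Fun(P, Q)(n₁ + n₂, G₁ + G₂)`. -/
def brComp {i j l : Arity} {n₁ n₂ : ℕ} (hi : i.n = n₁ + 1) (hj : j.n = n₂ + 1)
    (hn : l.n = n₁ + n₂) (hg : l.g = i.g + j.g) :
    FunComp P Q i →ₗ[k] FunComp P Q j →ₗ[k] FunComp P Q l :=
  (2 : k) • (LinearMap.mk₂ k
    (fun x y => ⟨∑ C : Decomp n₁ l.n,
        brTerm hi hj hn hg C (x : TP P Q i.cor) (y : TP P Q j.cor),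
      fun σ => by
        obtain ⟨π, hl, hfix, rfl⟩ := σ.exists_perm
        rw [map_sum]
        simp only [relabel_brTerm hi hj hn hg _ hl hfix x.2 y.2]
        exact Equiv.sum_comp (Decomp.perm π hl)
          (fun C => brTerm hi hj hn hg C (x : TP P Q i.cor) (y : TP P Q j.cor))⟩)
    (fun x x' y => Subtype.ext (by simp [Finset.sum_add_distrib]))
    (fun r x y => Subtype.ext (by simp [Finset.smul_sum]))
    (fun x y y' => Subtype.ext (by simp [Finset.sum_add_distrib]))
    (fun r x y => Subtype.ext (by simp [Finset.smul_sum])) :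
      FunComp P Q i →ₗ[k] FunComp P Q j →ₗ[k] FunComp P Q l)

end Comp

/-! ### Compatibility of `♯` with the other operations -/

section Compat

variable {k : Type u} [Field k] {P : ModularOperadCS.{u, v} k} {Q : OddModularOperadCS.{u, w} k}

theorem dComp_sharpComp {i l : Arity} (hn : l.n = i.n) (hg : l.g = i.g + 4)
    (x : FunComp P Q i) : dComp l (sharpComp hn hg x) = sharpComp hn hg (dComp i x) :=
  Subtype.ext (dRaw_handleRaw _ _)

theorem deltaComp_sharpComp {i l i' l' : Arity} (hn : i'.n = i.n) (hg : i'.g = i.g + 4)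
    (hn' : l'.n = l.n) (hg' : l'.g = l.g + 4) (hd : i.n = l.n + 2) (hd' : l.g = i.g + 2)
    (he : i'.n = l'.n + 2) (he' : l'.g = i'.g + 2) (x : FunComp P Q i) :
    deltaComp he he' (sharpComp hn hg x) = sharpComp hn' hg' (deltaComp hd hd' x) := by
  obtain ⟨n, g, s⟩ := l
  obtain ⟨n', g', s'⟩ := l'
  obtain rfl : n' = n := hn'
  exact Subtype.ext (selfRaw_handleRaw _ _ _ _ _)

theorem starComp_sharpComp_left {i j l i' l' : Arity} (hn : i'.n = i.n) (hg : i'.g = i.g + 4)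
    (hn' : l'.n = l.n) (hg' : l'.g = l.g + 4) (hl : l.n = i.n + j.n) (hl' : l.g = i.g + j.g + 2)
    (hm : l'.n = i'.n + j.n) (hm' : l'.g = i'.g + j.g + 2) (x : FunComp P Q i)
    (y : FunComp P Q j) :
    starComp hm hm' (sharpComp hn hg x) y = sharpComp hn' hg' (starComp hl hl' x y) := by
  obtain ⟨n, g, s⟩ := l
  obtain ⟨n', g', s'⟩ := l'
  obtain rfl : n' = n := hn'
  obtain ⟨m, h, t⟩ := i
  obtain ⟨m', h', t'⟩ := i'
  obtain rfl : m' = m := hn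
  apply Subtype.ext
  change ∑ C, starTerm hm hm' C (handleRaw _ x.1) y.1 =
    handleRaw _ (∑ C, starTerm hl hl' C x.1 y.1)
  rw [map_sum]
  refine Finset.sum_congr rfl fun C _ => ?_
  simp only [starTerm, LinearMap.compl₁₂_apply]
  have k₁ : Handle (Decomp.fst (i := ⟨m', h, t⟩) (l := ⟨n', g, s⟩) C)
      (Decomp.fst (i := ⟨m', h', t'⟩) (l := ⟨n', g', s'⟩) C) := ⟨rfl, hg⟩
  have k₂ : Handle (Arity.cor ⟨n', g, s⟩) (Arity.cor ⟨n', g', s'⟩) := ⟨rfl, hg'⟩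
  have k₃ : Handle (Arity.cor ⟨m', h, t⟩) (Arity.cor ⟨m', h', t'⟩) := ⟨rfl, hg⟩
  have e := relabel_handleRaw k₃ k₁ (Decomp.θ₁ (i := ⟨m', h, t⟩) (l := ⟨n', g, s⟩) C)
    (Decomp.θ₁ (i := ⟨m', h', t'⟩) (l := ⟨n', g', s'⟩) C) (fun _ _ hxy => hxy) x.1
  have e' := csumRaw_handleRaw k₁
    (Decomp.connSum (i := ⟨m', h', t'⟩) (j := j) (l := ⟨n', g', s'⟩) C hm hm')
    (Decomp.connSum (i := ⟨m', h, t⟩) (j := j) (l := ⟨n', g, s⟩) C hl hl') k₂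
    (relabel (Decomp.θ₁ (i := ⟨m', h, t⟩) (l := ⟨n', g, s⟩) C) x.1)
    (relabel (Decomp.θ₂ (i := ⟨m', h, t⟩) (j := j) (l := ⟨n', g, s⟩) C hl) y.1)
  exact (congrArg (fun z => csumRaw (Decomp.connSum (i := ⟨m', h', t'⟩) (j := j)
    (l := ⟨n', g', s'⟩) C hm hm') z (relabel (Decomp.θ₂ (i := ⟨m', h', t'⟩) (j := j)
    (l := ⟨n', g', s'⟩) C hm) y.1)) e).trans e'

theorem starComp_sharpComp_right {i j l j' l' : Arity} (hn : j'.n = j.n) (hg : j'.g = j.g + 4)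
    (hn' : l'.n = l.n) (hg' : l'.g = l.g + 4) (hl : l.n = i.n + j.n) (hl' : l.g = i.g + j.g + 2)
    (hm : l'.n = i.n + j'.n) (hm' : l'.g = i.g + j'.g + 2) (x : FunComp P Q i)
    (y : FunComp P Q j) :
    starComp hm hm' x (sharpComp hn hg y) = sharpComp hn' hg' (starComp hl hl' x y) := by
  obtain ⟨n, g, s⟩ := l
  obtain ⟨n', g', s'⟩ := l'
  obtain rfl : n' = n := hn'
  obtain ⟨m, h, t⟩ := j
  obtain ⟨m', h', t'⟩ := j'
  obtain rfl : m' = m := hn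
  apply Subtype.ext
  change ∑ C, starTerm hm hm' C x.1 (handleRaw _ y.1) =
    handleRaw _ (∑ C, starTerm hl hl' C x.1 y.1)
  rw [map_sum]
  refine Finset.sum_congr rfl fun C _ => ?_
  simp only [starTerm, LinearMap.compl₁₂_apply]
  have k₁ : Handle (Decomp.snd (i := i) (j := ⟨m', h, t⟩) (l := ⟨n', g, s⟩) C hl)
      (Decomp.snd (i := i) (j := ⟨m', h', t'⟩) (l := ⟨n', g', s'⟩) C hm) := ⟨rfl, hg⟩
  have k₂ : Handle (Arity.cor ⟨n', g, s⟩) (Arity.cor ⟨n', g', s'⟩) := ⟨rfl, hg'⟩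
  have k₃ : Handle (Arity.cor ⟨m', h, t⟩) (Arity.cor ⟨m', h', t'⟩) := ⟨rfl, hg⟩
  have e := relabel_handleRaw k₃ k₁
    (Decomp.θ₂ (i := i) (j := ⟨m', h, t⟩) (l := ⟨n', g, s⟩) C hl)
    (Decomp.θ₂ (i := i) (j := ⟨m', h', t'⟩) (l := ⟨n', g', s'⟩) C hm) (fun _ _ hxy => hxy) y.1
  have e' := csumRaw_handleRaw_right k₁
    (Decomp.connSum (i := i) (j := ⟨m', h', t'⟩) (l := ⟨n', g', s'⟩) C hm hm')
    (Decomp.connSum (i := i) (j := ⟨m', h, t⟩) (l := ⟨n', g, s⟩) C hl hl') k₂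
    (relabel (Decomp.θ₁ (i := i) (l := ⟨n', g, s⟩) C) x.1)
    (relabel (Decomp.θ₂ (i := i) (j := ⟨m', h, t⟩) (l := ⟨n', g, s⟩) C hl) y.1)
  exact (congrArg (fun z => csumRaw (Decomp.connSum (i := i) (j := ⟨m', h', t'⟩)
    (l := ⟨n', g', s'⟩) C hm hm') (relabel (Decomp.θ₁ (i := i) (l := ⟨n', g', s'⟩) C) x.1) z)
    e).trans e'

end Compat

/-! ### The space `Fun(P, Q)` -/

section Fun

variable {k : Type u} [Field k]

/-- `Fun(P, Q) = ∏_{n, G} Fun(P, Q)(n, G)`. -/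
abbrev Fun (P : ModularOperadCS.{u, v} k) (Q : OddModularOperadCS.{u, w} k) : Type (max v w) :=
  ∀ i : Arity, FunComp P Q i

variable {P : ModularOperadCS.{u, v} k} {Q : OddModularOperadCS.{u, w} k}

/-- Homogeneous elements of degree `0`. -/
def Fun.IsDegreeZero (S : Fun P Q) : Prop :=
  ∀ i : Arity, (S i : TP P Q i.cor) ∈ DGSpace.tensorDeg (P.obj i.cor) (Q.obj i.cor) 0

/-- The differential on `Fun(P, Q)`. -/
def Fun.d (S : Fun P Q) : Fun P Q := fun i => dComp i (S i)

/-- The operator `Δ` on `Fun(P, Q)`: the component in `(n, G)` comes from `(n + 2, G - 1)`. -/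
def Fun.delta (S : Fun P Q) : Fun P Q := fun l =>
  if h : 2 ≤ l.g then
    deltaComp (i := ⟨l.n + 2, l.g - 2, by have := l.stable; omega⟩) rfl (by simp only; omega) (S _)
  else 0

/-- The bracket on `Fun(P, Q)`: the component in `(n, G)` is the sum of the brackets of the
components in `(n₁ + 1, G₁)` and `(n₂ + 1, G₂)` with `n₁ + n₂ = n`, `G₁ + G₂ = G`. -/
def Fun.bracket (S T : Fun P Q) : Fun P Q := fun l =>
  ∑ p : ↥(Finset.HasAntidiagonal.antidiagonal l.n),
    ∑ q : ↥(Finset.HasAntidiagonal.antidiagonal l.g),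
      if h : 2 < q.1.1 + (p.1.1 + 1) ∧ 2 < q.1.2 + (p.1.2 + 1) then
        brComp (i := ⟨p.1.1 + 1, q.1.1, h.1⟩) (j := ⟨p.1.2 + 1, q.1.2, h.2⟩) rfl rfl
          (Finset.HasAntidiagonal.mem_antidiagonal.1 p.2).symm
          (Finset.HasAntidiagonal.mem_antidiagonal.1 q.2).symm (S _) (T _)
      else 0

end Fun

/-! ### The weight-completed space `Fun_Exp(P, Q)` -/

/-- Indices `(n, G, q)` of weight `n/2 + G + 2 q + 1 = w`, where `W = 2 w`. -/
@[ext]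
structure WIdx (W : ℤ) where
  arity : Arity
  q : ℤ
  weight : (arity.n : ℤ) + arity.g + 4 * q + 2 = W

instance instDecEqWIdx (W : ℤ) : DecidableEq (WIdx W) := Classical.decEq _

section Exp

variable {k : Type u} [Field k]

/-- The space of weight `w`, `⨁_{n/2 + G + 2q + 1 = w} Fun(P, Q)(n, G) ⊗ ϰ^q`, where `W = 2 w`. -/
def FW (P : ModularOperadCS.{u, v} k) (Q : OddModularOperadCS.{u, w} k) (W : ℤ) :
    Type (max v w) :=
  ⨁ i : WIdx W, FunComp P Q i.arity

instance instACGFW (P : ModularOperadCS.{u, v} k) (Q : OddModularOperadCS.{u, w} k) (W : ℤ) :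
    AddCommGroup (FW P Q W) :=
  inferInstanceAs (AddCommGroup (⨁ i : WIdx W, FunComp P Q i.arity))

instance instModFW (P : ModularOperadCS.{u, v} k) (Q : OddModularOperadCS.{u, w} k) (W : ℤ) :
    Module k (FW P Q W) :=
  inferInstanceAs (Module k (⨁ i : WIdx W, FunComp P Q i.arity))

/-- The product over all weights at least `w₀` of the spaces of fixed weight, where
`W₀ = 2 w₀`. -/
abbrev FGe (P : ModularOperadCS.{u, v} k) (Q : OddModularOperadCS.{u, w} k) (W₀ : ℤ) :
    Type (max v w) :=
  ∀ W : {W : ℤ // W₀ ≤ W}, FW P Q W.1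

variable {P : ModularOperadCS.{u, v} k} {Q : OddModularOperadCS.{u, w} k}

/-- The component of weight `w = W/2`. -/
def FGe.proj {W₀ W : ℤ} (h : W₀ ≤ W) : FGe P Q W₀ →ₗ[k] FW P Q W :=
  LinearMap.proj (φ := fun W : {W : ℤ // W₀ ≤ W} => FW P Q W.1) ⟨W, h⟩

theorem FGe.proj_apply {W₀ W : ℤ} (h : W₀ ≤ W) (X : FGe P Q W₀) : FGe.proj h X = X ⟨W, h⟩ := rfl

/-- The inclusion of the summand `Fun(P, Q)(n, G) ⊗ ϰ^q`. -/
def FW.of {W : ℤ} (i : WIdx W) : FunComp P Q i.arity →ₗ[k] FW P Q W :=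
  DirectSum.lof k (WIdx W) (fun i => FunComp P Q i.arity) i

/-- The linear map that is given by `f i` on the `i`-th summand. -/
def FW.lift {W : ℤ} {N : Type*} [AddCommGroup N] [Module k N]
    (f : ∀ i : WIdx W, FunComp P Q i.arity →ₗ[k] N) : FW P Q W →ₗ[k] N :=
  DirectSum.toModule k (WIdx W) N f

theorem FW.lift_of {W : ℤ} {N : Type*} [AddCommGroup N] [Module k N]
    (f : ∀ i : WIdx W, FunComp P Q i.arity →ₗ[k] N) (i : WIdx W) (x : FunComp P Q i.arity) :
    FW.lift f (FW.of i x) = f i x :=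
  DirectSum.toModule_lof (M := fun i : WIdx W => FunComp P Q i.arity) (φ := f) k i x

/-- `d`, extended `ϰ`-linearly. -/
def dW (W : ℤ) : FW P Q W →ₗ[k] FW P Q W :=
  FW.lift fun i => FW.of i ∘ₗ dComp i.arity

/-- The index of the target of `Δ`. -/
abbrev WIdx.delta {W : ℤ} (i : WIdx W) (h : 2 ≤ i.arity.n) : WIdx W :=
  ⟨⟨i.arity.n - 2, i.arity.g + 2, by have := i.arity.stable; omega⟩, i.q, by
    have := i.weight; simp only; omega⟩

/-- `Δ`, extended `ϰ`-linearly. -/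
def deltaW (W : ℤ) : FW P Q W →ₗ[k] FW P Q W :=
  FW.lift fun i =>
    if h : 2 ≤ i.arity.n then
      FW.of (i.delta h) ∘ₗ deltaComp (l := (i.delta h).arity) (by simp only; omega) rfl
    else 0

/-- The index of the target of `⋆`. -/
abbrev WIdx.star {W₁ W₂ W : ℤ} (hW : W₁ + W₂ = W) (i : WIdx W₁) (j : WIdx W₂) : WIdx W :=
  ⟨⟨i.arity.n + j.arity.n, i.arity.g + j.arity.g + 2, by
    have := i.arity.stable; omega⟩, i.q + j.q, by
    have := i.weight; have := j.weight; push_cast; omega⟩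

/-- `⋆`, extended by `ϰ^q₁ ⋆ ϰ^q₂ = ϰ^(q₁ + q₂)`. -/
def starW {W₁ W₂ W : ℤ} (hW : W₁ + W₂ = W) : FW P Q W₁ →ₗ[k] FW P Q W₂ →ₗ[k] FW P Q W :=
  FW.lift fun i =>
    (FW.lift fun j =>
      ((starComp (l := (WIdx.star hW i j).arity) rfl rfl).compr₂
        (FW.of (WIdx.star hW i j))).flip).flip

/-- The index of the target of `♯`. -/
abbrev WIdx.sharp {W W' : ℤ} (hW : W' = W + 4) (i : WIdx W) : WIdx W' :=
  ⟨⟨i.arity.n, i.arity.g + 4, by have := i.arity.stable; omega⟩, i.q, by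
    have := i.weight; push_cast; omega⟩

/-- `♯`, extended `ϰ`-linearly. -/
def sharpW {W W' : ℤ} (hW : W' = W + 4) : FW P Q W →ₗ[k] FW P Q W' :=
  FW.lift fun i =>
    FW.of (i.sharp hW) ∘ₗ sharpComp (l := (i.sharp hW).arity) rfl rfl

/-- The index of the target of multiplication by `ϰ`. -/
abbrev WIdx.kappa {W W' : ℤ} (hW : W' = W + 4) (i : WIdx W) : WIdx W' :=
  ⟨i.arity, i.q + 1, by have := i.weight; omega⟩

/-- Multiplication by `ϰ`, i.e. `ϰ^q ↦ ϰ^(q + 1)`. -/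
def kappaW {W W' : ℤ} (hW : W' = W + 4) : FW P Q W →ₗ[k] FW P Q W' :=
  FW.lift fun i => FW.of (i.kappa hW)

/-! Evaluation on summands, and compatibilities. -/

theorem dW_of {W : ℤ} (i : WIdx W) (x : FunComp P Q i.arity) :
    dW W (FW.of i x) = FW.of i (dComp i.arity x) := by
  simp [dW, FW.lift_of]

theorem deltaW_of {W : ℤ} (i : WIdx W) (h : 2 ≤ i.arity.n) (x : FunComp P Q i.arity) :
    deltaW W (FW.of i x) = FW.of (i.delta h)
      (deltaComp (l := (i.delta h).arity) (by simp only; omega) rfl x) := by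
  simp [deltaW, h, FW.lift_of]

theorem deltaW_of_not {W : ℤ} (i : WIdx W) (h : ¬ 2 ≤ i.arity.n) (x : FunComp P Q i.arity) :
    deltaW W (FW.of i x) = 0 := by
  simp [deltaW, h, FW.lift_of]

theorem starW_of {W₁ W₂ W : ℤ} (hW : W₁ + W₂ = W) (i : WIdx W₁) (j : WIdx W₂)
    (x : FunComp P Q i.arity) (y : FunComp P Q j.arity) :
    starW hW (FW.of i x) (FW.of j y) = FW.of (WIdx.star hW i j)
      (starComp (l := (WIdx.star hW i j).arity) rfl rfl x y) := by
  simp [starW, FW.lift_of]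

theorem sharpW_of {W W' : ℤ} (hW : W' = W + 4) (i : WIdx W) (x : FunComp P Q i.arity) :
    sharpW hW (FW.of i x) =
      FW.of (i.sharp hW) (sharpComp (i := i.arity) (l := (i.sharp hW).arity) rfl rfl x) := by
  simp [sharpW, FW.lift_of]

theorem kappaW_of {W W' : ℤ} (hW : W' = W + 4) (i : WIdx W) (x : FunComp P Q i.arity) :
    kappaW hW (FW.of i x) = FW.of (i.kappa hW) x :=
  FW.lift_of _ i x

theorem FW.induction {W : ℤ} {p : FW P Q W → Prop} (x : FW P Q W) (hz : p 0)
    (hof : ∀ i x, p (FW.of (k := k) i x)) (add : ∀ x y, p x → p y → p (x + y)) : p x :=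
  DirectSum.induction_on x hz (fun i x => hof i x) add

theorem FW.of_sharp_congr {W : ℤ} {A B : WIdx W} (e : A = B) {l : Arity} (z : FunComp P Q l)
    (hnA : A.arity.n = l.n) (hgA : A.arity.g = l.g + 4) (hnB : B.arity.n = l.n)
    (hgB : B.arity.g = l.g + 4) :
    FW.of A (sharpComp hnA hgA z) = FW.of B (sharpComp hnB hgB z) := by
  subst e; rfl

theorem FW.of_q_congr {W : ℤ} {a : Arity} {q q' : ℤ} (hq : q = q')
    (h : (a.n : ℤ) + a.g + 4 * q + 2 = W) (h' : (a.n : ℤ) + a.g + 4 * q' + 2 = W)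
    (z : FunComp P Q a) :
    FW.of (⟨a, q, h⟩ : WIdx W) z = FW.of (⟨a, q', h'⟩ : WIdx W) z := by
  subst hq; rfl

/-- `♯ X - ϰ X` in a fixed weight. -/
def relW {W W' : ℤ} (hW : W' = W + 4) : FW P Q W →ₗ[k] FW P Q W' := sharpW hW - kappaW hW

theorem relW_of {W W' : ℤ} (hW : W' = W + 4) (i : WIdx W) (x : FunComp P Q i.arity) :
    relW hW (FW.of i x) =
      FW.of (i.sharp hW) (sharpComp (i := i.arity) (l := (i.sharp hW).arity) rfl rfl x) -
        FW.of (i.kappa hW) x := by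
  rw [relW, LinearMap.sub_apply, sharpW_of, kappaW_of]

theorem dW_relW {W W' : ℤ} (hW : W' = W + 4) (x : FW P Q W) :
    dW W' (relW hW x) = relW hW (dW W x) := by
  induction x using FW.induction with
  | hz => simp
  | add x y hx hy => simp only [map_add, hx, hy]
  | hof i x =>
    rw [relW_of, map_sub, dW_of, dW_of, dW_of, relW_of, dComp_sharpComp]

theorem deltaW_relW {W W' : ℤ} (hW : W' = W + 4) (x : FW P Q W) :
    deltaW W' (relW hW x) = relW hW (deltaW W x) := by
  induction x using FW.induction with
  | hz => simp
  | add x y hx hy => simp only [map_add, hx, hy]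
  | hof i x =>
    by_cases h : 2 ≤ i.arity.n
    · have h1 : 2 ≤ (i.sharp hW).arity.n := h
      have h2 : 2 ≤ (i.kappa hW).arity.n := h
      rw [deltaW_of i h, relW_of, map_sub, deltaW_of _ h1, deltaW_of _ h2, relW_of]
      congr 1
      exact congrArg (FW.of _) (deltaComp_sharpComp (i := i.arity) (l := (i.delta h).arity)
        (i' := (i.sharp hW).arity) (l' := ((i.sharp hW).delta h1).arity) rfl rfl rfl
        (Nat.add_right_comm _ 4 2) _ rfl _ rfl x)
    · have h1 : ¬ 2 ≤ (i.sharp hW).arity.n := h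
      have h2 : ¬ 2 ≤ (i.kappa hW).arity.n := h
      rw [deltaW_of_not i h, relW_of, map_sub, deltaW_of_not _ h1, deltaW_of_not _ h2]
      simp

theorem starW_relW_left {W₁ W₁' W₂ W W' : ℤ} (h₁ : W₁' = W₁ + 4) (h : W' = W + 4)
    (hW : W₁ + W₂ = W) (hW' : W₁' + W₂ = W') (x : FW P Q W₁) (y : FW P Q W₂) :
    starW hW' (relW h₁ x) y = relW h (starW hW x y) := by
  induction x using FW.induction with
  | hz => simp
  | add x y hx hy => simp only [map_add, LinearMap.add_apply, hx, hy]
  | hof i x =>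
    induction y using FW.induction with
    | hz => simp
    | add x y hx hy => simp only [map_add, hx, hy]
    | hof j y =>
      rw [relW_of, map_sub, LinearMap.sub_apply, starW_of, starW_of, starW_of, relW_of]
      congr 1
      · have e : (WIdx.star hW' (WIdx.sharp h₁ i) j).arity.g = (WIdx.star hW i j).arity.g + 4 := by
          simp only; omega
        refine (congrArg (FW.of _) (starComp_sharpComp_left (i := i.arity) (j := j.arity)
          (l := (WIdx.star hW i j).arity) (i' := (WIdx.sharp h₁ i).arity)
          (l' := (WIdx.star hW' (WIdx.sharp h₁ i) j).arity) rfl rfl rfl e rfl rfl rfl rfl x y)).trans ?_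
        refine FW.of_sharp_congr (A := WIdx.star hW' (WIdx.sharp h₁ i) j)
          (B := WIdx.sharp h (WIdx.star hW i j))
          (WIdx.ext (Arity.ext rfl e) rfl) _ _ _ _ _
      · exact FW.of_q_congr (by simp only; omega) _ _ _

theorem starW_relW_right {W₁ W₂ W₂' W W' : ℤ} (h₂ : W₂' = W₂ + 4) (h : W' = W + 4)
    (hW : W₁ + W₂ = W) (hW' : W₁ + W₂' = W') (x : FW P Q W₁) (y : FW P Q W₂) :
    starW hW' x (relW h₂ y) = relW h (starW hW x y) := by
  induction x using FW.induction with
  | hz => simp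
  | add x y hx hy => simp only [map_add, LinearMap.add_apply, hx, hy]
  | hof i x =>
    induction y using FW.induction with
    | hz => simp
    | add x y hx hy => simp only [map_add, hx, hy]
    | hof j y =>
      rw [relW_of, map_sub, starW_of, starW_of, starW_of, relW_of]
      congr 1
      · have e : (WIdx.star hW' i (WIdx.sharp h₂ j)).arity.g = (WIdx.star hW i j).arity.g + 4 := by
          simp only; omega
        refine (congrArg (FW.of _) (starComp_sharpComp_right (i := i.arity) (j := j.arity)
          (l := (WIdx.star hW i j).arity) (j' := (WIdx.sharp h₂ j).arity)
          (l' := (WIdx.star hW' i (WIdx.sharp h₂ j)).arity) rfl rfl rfl e rfl rfl rfl rfl x y)).trans ?_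
        refine FW.of_sharp_congr (B := WIdx.sharp h (WIdx.star hW i j))
          (WIdx.ext (Arity.ext rfl e) rfl) _ _ _ _ _
      · exact FW.of_q_congr (by simp only; omega) _ _ _

theorem relW_kappaW {W W' W'' : ℤ} (h : W' = W + 4) (h' : W'' = W' + 4) (x : FW P Q W) :
    relW h' (kappaW h x) = kappaW h' (relW h x) := by
  induction x using FW.induction with
  | hz => simp
  | add x y hx hy => simp only [map_add, hx, hy]
  | hof i x =>
    rw [kappaW_of, relW_of, relW_of, map_sub, kappaW_of, kappaW_of]

theorem kappaW_surjective {W W' : ℤ} (h : W' = W + 4) :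
    Function.Surjective (kappaW (P := P) (Q := Q) h) := by
  intro y
  induction y using FW.induction with
  | hz => exact ⟨0, map_zero _⟩
  | add x y hx hy =>
    obtain ⟨a, rfl⟩ := hx
    obtain ⟨b, rfl⟩ := hy
    exact ⟨a + b, map_add _ _ _⟩
  | hof i y =>
    refine ⟨FW.of (⟨i.arity, i.q - 1, by have := i.weight; omega⟩ : WIdx W) y, ?_⟩
    rw [kappaW_of]
    exact FW.of_q_congr (by simp) _ i.weight _

theorem kappaW_injective {W W' : ℤ} (h : W' = W + 4) :
    Function.Injective (kappaW (P := P) (Q := Q) h) := by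
  let f : FW P Q W' →ₗ[k] FW P Q W := FW.lift fun i =>
    FW.of (⟨i.arity, i.q - 1, by have := i.weight; omega⟩ : WIdx W)
  refine Function.LeftInverse.injective (g := f) fun x => ?_
  induction x using FW.induction with
  | hz => simp
  | add x y hx hy => simp only [map_add, hx, hy]
  | hof i x =>
    rw [kappaW_of]
    refine (FW.lift_of _ _ _).trans ?_
    exact FW.of_q_congr (by simp) _ i.weight _

/-! The quotient. -/

/-- `X ↦ ♯ X - ϰ X` on the completed product of the spaces of weight at least `-3/2`. -/
def relGe (P : ModularOperadCS.{u, v} k) (Q : OddModularOperadCS.{u, w} k) :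
    FGe P Q (-3) →ₗ[k] FGe P Q 1 :=
  LinearMap.pi fun W =>
    relW (W := W.1 - 4) (by omega) ∘ₗ FGe.proj (by have := W.2; omega)

/-- The subspace `{♯ X - ϰ X}` of the completed product of the spaces of weight at least `1/2`. -/
def relSub (P : ModularOperadCS.{u, v} k) (Q : OddModularOperadCS.{u, w} k) :
    Submodule k (FGe P Q 1) :=
  LinearMap.range (relGe P Q)

/-- `Fun_Exp(P, Q)`. -/
abbrev FunExp (P : ModularOperadCS.{u, v} k) (Q : OddModularOperadCS.{u, w} k) :
    Type (max v w) :=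
  FGe P Q 1 ⧸ relSub P Q

theorem mem_relSub {X : FGe P Q 1} :
    X ∈ relSub P Q ↔
      ∀ W : {W : ℤ // 1 ≤ W}, ∃ Y : FW P Q (W.1 - 4), relW (Int.sub_add_cancel W.1 4).symm Y = X W := by
  constructor
  · rintro ⟨Y, rfl⟩ W
    exact ⟨Y ⟨W.1 - 4, by have := W.2; omega⟩, rfl⟩
  · intro h
    have aux : ∀ (W : ℤ) (h1 : 1 ≤ W) (V : ℤ) (hV : W = V + 4),
        ∃ Y : FW P Q V, relW hV Y = X ⟨W, h1⟩ := by
      intro W h1 V hV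
      obtain rfl : V = W - 4 := by omega
      exact h ⟨W, h1⟩
    choose Y hY using aux
    refine ⟨fun V => Y (V.1 + 4) (by have := V.2; omega) V.1 rfl, ?_⟩
    funext W
    have aux' : ∀ (W' : ℤ) (h1 : 1 ≤ W') (V : ℤ) (hV : W' = V + 4) (hV' : W.1 = V + 4),
        relW hV' (Y W' h1 V hV) = X W := by
      intro W' h1 V hV hV'
      obtain rfl : W' = W.1 := by omega
      exact hY _ _ _ _
    exact aux' _ _ _ _ _

/-- Multiplication by `ϰ` on the completed product. -/
def kappaGe : FGe P Q 1 →ₗ[k] FGe P Q 1 :=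
  LinearMap.pi fun W =>
    if h : 1 ≤ W.1 - 4 then kappaW (W := W.1 - 4) (by omega) ∘ₗ FGe.proj h else 0

/-- `d + Δ` on the completed product. -/
def dDeltaGe : FGe P Q 1 →ₗ[k] FGe P Q 1 :=
  LinearMap.pi fun W => (dW W.1 + deltaW W.1) ∘ₗ LinearMap.proj W

/-- `⋆` on the completed product. -/
def starGe : FGe P Q 1 →ₗ[k] FGe P Q 1 →ₗ[k] FGe P Q 1 :=
  LinearMap.mk₂ k
    (fun X Y W => ∑ V : ↥(Finset.Icc (1 : ℤ) (W.1 - 1)),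
      starW (W₁ := V.1) (W₂ := W.1 - V.1) (by omega) (X ⟨V.1, (Finset.mem_Icc.1 V.2).1⟩)
        (Y ⟨W.1 - V.1, by have := (Finset.mem_Icc.1 V.2).2; omega⟩))
    (fun X X' Y => by funext W; simp [Finset.sum_add_distrib])
    (fun r X Y => by funext W; simp [Finset.smul_sum])
    (fun X Y Y' => by funext W; simp [Finset.sum_add_distrib])
    (fun r X Y => by funext W; simp [Finset.smul_sum])

theorem relW_sum_mem {W : ℤ} {ι : Type} [Fintype ι] (f : ι → FW P Q W)
    (h : ∀ i, ∃ Y : FW P Q (W - 4), relW (Int.sub_add_cancel W 4).symm Y = f i) :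
    ∃ Y : FW P Q (W - 4), relW (Int.sub_add_cancel W 4).symm Y = ∑ i, f i := by
  choose Y hY using h
  exact ⟨∑ i, Y i, by rw [map_sum]; exact Finset.sum_congr rfl fun i _ => hY i⟩

theorem starGe_mem_left {X : FGe P Q 1} (hX : X ∈ relSub P Q) (Y : FGe P Q 1) :
    starGe X Y ∈ relSub P Q := by
  rw [mem_relSub] at hX ⊢
  intro W
  refine relW_sum_mem (ι := ↥(Finset.Icc (1 : ℤ) (W.1 - 1))) (fun V =>
    starW (W₁ := V.1) (W₂ := W.1 - V.1) (by omega) (X ⟨V.1, (Finset.mem_Icc.1 V.2).1⟩)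
      (Y ⟨W.1 - V.1, by have := (Finset.mem_Icc.1 V.2).2; omega⟩)) fun V => ?_
  obtain ⟨Z, hZ⟩ := hX ⟨V.1, (Finset.mem_Icc.1 V.2).1⟩
  rw [← hZ]
  exact ⟨_, (starW_relW_left _ _ (by simp only; omega) _ Z _).symm⟩

theorem starGe_mem_right (X : FGe P Q 1) {Y : FGe P Q 1} (hY : Y ∈ relSub P Q) :
    starGe X Y ∈ relSub P Q := by
  rw [mem_relSub] at hY ⊢
  intro W
  refine relW_sum_mem (ι := ↥(Finset.Icc (1 : ℤ) (W.1 - 1))) (fun V =>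
    starW (W₁ := V.1) (W₂ := W.1 - V.1) (by omega) (X ⟨V.1, (Finset.mem_Icc.1 V.2).1⟩)
      (Y ⟨W.1 - V.1, by have := (Finset.mem_Icc.1 V.2).2; omega⟩)) fun V => ?_
  obtain ⟨Z, hZ⟩ := hY ⟨W.1 - V.1, by have := (Finset.mem_Icc.1 V.2).2; omega⟩
  rw [← hZ]
  exact ⟨_, (starW_relW_right _ _ (by simp only; omega) _ _ Z).symm⟩

theorem dDeltaGe_mem : relSub P Q ≤ (relSub P Q).comap dDeltaGe := by
  intro X hX
  rw [Submodule.mem_comap]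
  rw [mem_relSub] at hX ⊢
  intro W
  obtain ⟨Y, hY⟩ := hX W
  refine ⟨dW _ Y + deltaW _ Y, ?_⟩
  change _ = dW W.1 (X W) + deltaW W.1 (X W)
  rw [← hY, map_add, dW_relW, deltaW_relW]

theorem kappaGe_mem : relSub P Q ≤ (relSub P Q).comap kappaGe := by
  intro X hX
  rw [Submodule.mem_comap]
  rw [mem_relSub] at hX ⊢
  intro W
  by_cases h : 1 ≤ W.1 - 4
  · obtain ⟨Y, hY⟩ := hX ⟨W.1 - 4, h⟩
    refine ⟨kappaW (W := W.1 - 4 - 4) (by ring) Y, ?_⟩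
    refine (relW_kappaW _ _ Y).trans ?_
    rw [hY]
    simp [kappaGe, h, FGe.proj_apply]
  · exact ⟨0, by simp [kappaGe, h]⟩

/-- Multiplication by `ϰ` on `Fun_Exp(P, Q)`. -/
def FunExp.kappa : FunExp P Q →ₗ[k] FunExp P Q :=
  (relSub P Q).mapQ (relSub P Q) kappaGe kappaGe_mem

/-- `d + Δ` on `Fun_Exp(P, Q)`. -/
def FunExp.dDelta : FunExp P Q →ₗ[k] FunExp P Q :=
  (relSub P Q).mapQ (relSub P Q) dDeltaGe dDeltaGe_mem

/-- `S ↦ S ⊗ ϰ^q`: its component of weight `w = W/2` consists of the components of `S` in `(n, G)`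
with `n/2 + G + 2 q + 1 = w`. -/
def embed (q : ℤ) (S : Fun P Q) : FGe P Q 1 := fun W =>
  ∑ p ∈ Finset.HasAntidiagonal.antidiagonal (W.1 - 2 - 4 * q).toNat,
    if h : 2 < p.2 + p.1 ∧ (p.1 : ℤ) + p.2 + 4 * q + 2 = W.1 then
      FW.of ⟨⟨p.1, p.2, h.1⟩, q, h.2⟩ (S _)
    else 0

/-- The natural map `ι : Fun(P, Q) → Fun_Exp(P, Q)`. -/
def iota (S : Fun P Q) : FunExp P Q := Submodule.Quotient.mk (embed 0 S)

/-- `ι(S)/ϰ`. -/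
def iotaDivKappa (S : Fun P Q) : FunExp P Q := Submodule.Quotient.mk (embed (-1) S)

theorem kappa_iotaDivKappa (S : Fun P Q) : FunExp.kappa (iotaDivKappa S) = iota S := by
  refine congrArg (Submodule.Quotient.mk (p := relSub P Q)) ?_
  funext W
  by_cases h : 1 ≤ W.1 - 4
  · simp only [kappaGe, LinearMap.pi_apply, h, dite_true, LinearMap.comp_apply, FGe.proj_apply,
      embed]
    rw [map_sum, show W.1 - 4 - 2 - 4 * (-1) = W.1 - 2 - 4 * 0 by ring]
    refine Finset.sum_congr rfl fun p _ => ?_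
    by_cases hp : 2 < p.2 + p.1 ∧ (p.1 : ℤ) + p.2 + 4 * 0 + 2 = W.1
    · have hp' : 2 < p.2 + p.1 ∧ (p.1 : ℤ) + p.2 + 4 * (-1) + 2 = W.1 - 4 := ⟨hp.1, by omega⟩
      rw [dif_pos hp, dif_pos hp', kappaW_of]
      rfl
    · have hp' : ¬ (2 < p.2 + p.1 ∧ (p.1 : ℤ) + p.2 + 4 * (-1) + 2 = W.1 - 4) := by omega
      rw [dif_neg hp, dif_neg hp', map_zero]
  · simp only [kappaGe, LinearMap.pi_apply, h, dite_false, LinearMap.zero_apply, embed]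
    refine (Finset.sum_eq_zero fun p _ => dif_neg ?_).symm
    omega

/-- `ϰ` is injective on `Fun_Exp(P, Q)`, so `ι(S)/ϰ` is the only element `y` with `ϰ y = ι(S)`. -/
theorem kappa_injective : Function.Injective (FunExp.kappa (P := P) (Q := Q)) := by
  rw [injective_iff_map_eq_zero]
  intro x hx
  obtain ⟨X, rfl⟩ := Submodule.Quotient.mk_surjective _ x
  have hX : kappaGe X ∈ relSub P Q := (Submodule.Quotient.mk_eq_zero _).1 hx
  refine (Submodule.Quotient.mk_eq_zero _).2 ?_
  rw [mem_relSub] at hX ⊢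
  rintro ⟨W, hW⟩
  obtain ⟨Y, hY⟩ := hX ⟨W + 4, by omega⟩
  obtain ⟨Z, hZ⟩ := kappaW_surjective (P := P) (Q := Q) (W := W - 4) (W' := W + 4 - 4) (by omega) Y
  refine ⟨Z, kappaW_injective (W' := W + 4) rfl ?_⟩
  have e : kappaGe X ⟨W + 4, by omega⟩ = kappaW (W := W) rfl (X ⟨W, hW⟩) := by
    have h : 1 ≤ W + 4 - 4 := by omega
    simp only [kappaGe, LinearMap.pi_apply, h, dite_true, LinearMap.comp_apply,
      FGe.proj_apply]
    have aux : ∀ (V : ℤ) (hV : 1 ≤ V) (h1 : W + 4 = V + 4),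
        kappaW h1 (X ⟨V, hV⟩) = kappaW (W := W) rfl (X ⟨W, hW⟩) := by
      intro V hV h1
      obtain rfl : V = W := by omega
      rfl
    exact aux _ _ _
  rw [← e, ← hY, ← hZ]
  have aux : ∀ (V : ℤ) (h1 : V = W - 4 + 4) (h2 : W + 4 = V + 4),
      kappaW (P := P) (Q := Q) rfl (relW (W' := W) (by omega) Z) =
        relW h2 (kappaW h1 Z) := by
    intro V h1 h2
    obtain rfl : V = W := by omega
    exact (relW_kappaW _ _ _).symm
  exact aux _ _ _

/-! The exponential. -/

/-- `powGe X n = X ⋆ … ⋆ X` with `n + 1` factors. -/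
def powGe (X : FGe P Q 1) : ℕ → FGe P Q 1
  | 0 => X
  | n + 1 => starGe (powGe X n) X

/-- `X + X²/2! + X³/3! + …`; as `X ^ m` has no components of weight less than `m/2`, only the
terms `X ^ m` with `m ≤ W` contribute to the component of weight `W/2`. -/
def expGe (X : FGe P Q 1) : FGe P Q 1 := fun W =>
  ∑ n ∈ Finset.range W.1.toNat, ((Nat.factorial (n + 1) : k)⁻¹) • powGe X n W

theorem powGe_sub_mem {X Y : FGe P Q 1} (h : X - Y ∈ relSub P Q) (n : ℕ) :
    powGe X n - powGe Y n ∈ relSub P Q := by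
  induction n with
  | zero => exact h
  | succ n ih =>
    have e : powGe X (n + 1) - powGe Y (n + 1) =
        starGe (powGe X n - powGe Y n) X + starGe (powGe Y n) (X - Y) := by
      simp only [powGe, map_sub, LinearMap.sub_apply]; abel
    rw [e]
    exact add_mem (starGe_mem_left ih _) (starGe_mem_right _ h)

theorem expGe_sub_mem {X Y : FGe P Q 1} (h : X - Y ∈ relSub P Q) :
    expGe X - expGe Y ∈ relSub P Q := by
  rw [mem_relSub]
  intro W
  choose Z hZ using fun n => mem_relSub.1 (powGe_sub_mem h n) W
  refine ⟨∑ n ∈ Finset.range W.1.toNat, ((Nat.factorial (n + 1) : k)⁻¹) • Z n, ?_⟩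
  simp only [map_sum, map_smul, hZ, Pi.sub_apply, expGe, smul_sub]
  exact Finset.sum_sub_distrib _ _

/-- `X + X²/2! + X³/3! + …` on `Fun_Exp(P, Q)`. -/
def FunExp.expTail : FunExp P Q → FunExp P Q :=
  Quotient.map' expGe fun X Y h => by
    rw [Submodule.quotientRel_def] at h ⊢
    exact expGe_sub_mem h

/-- The exponential `exp X = 1 + X + X²/2! + X³/3! + …`, for `X` in `Fun_Exp(P, Q)`, as an element
`1 + Y` of `k ⊕ Fun_Exp(P, Q)`. -/
def FunExp.exp (X : FunExp P Q) : Unitization k (FunExp P Q) :=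
  Unitization.inl 1 + Unitization.inr X.expTail

/-- `d + Δ` on `k ⊕ Fun_Exp(P, Q)`, with `(d + Δ)(1) = 0`. -/
def FunExp.dDeltaUnital : Unitization k (FunExp P Q) →ₗ[k] FunExp P Q :=
  FunExp.dDelta ∘ₗ Unitization.sndHom k k (FunExp P Q)

end Exp

end BDOperad

end

/-!
The operations on `Fun(P, Q)` make it a Batalin–Vilkovisky algebra up to `♯`: `⋆` is associative and
graded commutative, `d` is a derivation, and for even `S` the operator `Δ` satisfies
`Δ(S ⋆ T) = ΔS ⋆ T + S ⋆ ΔT + ♯{S, T}` (`Fun.delta_star`), where `{S, -}` is a derivation of `⋆`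
(`Fun.bracket_star`). Hence, with `S` of degree `0`,
`(d + Δ) S^n = n (d + Δ)S ⋆ S^(n-1) + n (n-1)/2 ♯{S, S} ⋆ S^(n-2)` (`Fun.d_add_delta_starPow`).
After dividing by `n! ϰ^n`, replacing `♯` by `ϰ` and summing over `n`, this becomes
`(d + Δ) e^(S/ϰ) = ϰ⁻¹ T ⋆ e^(S/ϰ)` with `T = (d + Δ)S + {S, S}/2` (`exists_dDelta_exp_eq`), which
gives one implication.

For the other one, multiplication by `S/ϰ` raises the weight, so that the component of lowest weight
of `T/ϰ` vanishes in `Fun_Exp(P, Q)` if the right hand side does. That component vanishes already in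
`Fun(P, Q)`: if `T ⊗ ϰ⁻¹ = ♯Y - ϰY`, where `Y` has finitely many components, then the map that sends
`x ⊗ ϰ^q` to `♯^(N + q) x` kills the right hand side for large `N`, and it sends the left hand side
to `♯^(N - 1) T`; as `♯` is injective, `T = 0` (`apply_eq_zero_of_embedW_eq_relW`).

The sums over decompositions of `[n]` in the definitions of `⋆` and of the bracket involve arbitrary
bijections, which makes iterated operations hard to compare. An element of `Fun(P, Q)` is therefore
replaced by an invariant family of elements of `P(C, G) ⊗ Q(C, G)`, indexed by all corollas
(`Fun.family`). On families, the operations are sums over all pairs of corollas with a given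
connected sum or gluing (`starFam`, `brFam`), the bijections disappear, and the identities above are
rearrangements of finite sums, checked summand by summand with the axioms of a connected sum.
-/

noncomputable section

namespace BDOperad

/-! ### Axioms of the operations on `P(C, G) ⊗ Q(C, G)` -/

section RawAxioms

variable {k : Type u} [Field k] {P : ModularOperadCS.{u, v} k} {Q : OddModularOperadCS.{u, w} k}

theorem neg_one_zpow_congr {m n : ℤ} (h : Even (m - n)) : (-1 : k) ^ m = (-1 : k) ^ n := by
  rw [← sub_add_cancel m n, zpow_add₀ (neg_ne_zero.2 one_ne_zero), h.neg_one_zpow, one_mul]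

theorem neg_one_zpow_add (m n : ℤ) : (-1 : k) ^ (m + n) = (-1 : k) ^ m * (-1 : k) ^ n :=
  zpow_add₀ (neg_ne_zero.2 one_ne_zero) m n

theorem csumRaw_assoc {x₀ y₀ z₀ e₁ e₂ f : Cor} (h₁ : ConnSum y₀ z₀ e₁) (h₁' : ConnSum x₀ e₁ f)
    (h₂ : ConnSum x₀ y₀ e₂) (h₂' : ConnSum e₂ z₀ f)
    (x : TP P Q x₀) (y : TP P Q y₀) (z : TP P Q z₀) :
    csumRaw h₁' x (csumRaw h₁ y z) = csumRaw h₂' (csumRaw h₂ x y) z := by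
  induction x using TP.induction with
  | hz => simp
  | add x y hx hy => simp [hx, hy]
  | tmul l i x x' hx hx' =>
    induction y using TP.induction with
    | hz => simp
    | add x y hx hy => simp only [map_add, LinearMap.add_apply, hx, hy]
    | tmul j m y y' hy hy' =>
      induction z using TP.induction with
      | hz => simp
      | add x y hx hy => simp only [map_add, hx, hy]
      | tmul r s z z' hz hz' =>
        rw [csumRaw_tmul h₁ y z' hy' hz, csumRaw_tmul h₂ x y' hx' hy, map_smul, map_smul,
          LinearMap.smul_apply, csumRaw_tmul h₁' x _ hx' (P.csum_mem h₁ hy hz),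
          csumRaw_tmul h₂' _ z' (Q.csum_mem h₂ hx' hy') hz, smul_smul, smul_smul,
          P.csum_assoc h₁ h₁' h₂ h₂', Q.csum_assoc h₁ h₁' h₂ h₂', ← neg_one_zpow_add,
          ← neg_one_zpow_add]
        congr 2
        ring

theorem ConnSum.symm {c c' e : Cor} (h : ConnSum c c' e) : ConnSum c' c e :=
  ⟨h.disj.symm, by rw [h.legs_eq, Finset.union_comm], by rw [h.twoG_eq]; omega⟩

/-- Graded commutativity of `#₂ ⊗ #₂`, when one argument is even. -/
theorem csumRaw_comm [CharZero k] {c c' e : Cor} (h : ConnSum c c' e) (h' : ConnSum c' c e)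
    {x : TP P Q c} (hx : sgnRaw x = x) (y : TP P Q c') :
    csumRaw h x y = csumRaw h' y x := by
  -- `x + sgnRaw x` is twice the even part of `x`, and this form of the claim is linear in `x`.
  have key : ∀ (x : TP P Q c) (y : TP P Q c'),
      csumRaw h (x + sgnRaw x) y = csumRaw h' y (x + sgnRaw x) := by
    intro x y
    induction x using TP.induction with
    | hz => simp
    | add x y hx hy =>
      rw [map_add sgnRaw, add_add_add_comm, map_add (csumRaw h) (x + sgnRaw x),
        LinearMap.add_apply, hx, hy, ← map_add]
    | tmul l i x x' hx hx' =>
      rw [sgnRaw_tmul hx hx', ← neg_one_zpow_add]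
      -- Odd elements have even part `0`, so that only even `x` remain.
      rcases Int.even_or_odd (l + i) with hp | hp
      · rw [hp.neg_one_zpow, one_smul, map_add, map_add, LinearMap.add_apply]
        suffices csumRaw h (x ⊗ₜ x') y = csumRaw h' y (x ⊗ₜ[k] x') by rw [this]
        induction y using TP.induction with
        | hz => simp
        | add x y hx hy => simp only [map_add, LinearMap.add_apply, hx, hy]
        | tmul j m y y' hy hy' =>
          rw [csumRaw_tmul h x y' hx' hy, csumRaw_tmul h' y x' hy' hx,
            ← P.csum_symm h h' hx hy, ← Q.csum_symm h h' hx' hy', TensorProduct.smul_tmul_smul,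
            smul_smul, ← neg_one_zpow_add, ← neg_one_zpow_add]
          congr 1
          refine neg_one_zpow_congr ?_
          obtain ⟨t, ht⟩ := hp
          obtain rfl : l = 2 * t - i := by omega
          exact ⟨t * j + i * m - t * m, by ring⟩
      · rw [hp.neg_one_zpow]; simp
  have h2 := key x y
  rw [hx, ← two_smul k x, map_smul, map_smul, LinearMap.smul_apply] at h2
  exact smul_right_injective _ (two_ne_zero (α := k)) h2

/-- `d` is a derivation of `#₂ ⊗ #₂`. -/
theorem dRaw_csumRaw {c c' e : Cor} (h : ConnSum c c' e) (x : TP P Q c) (y : TP P Q c') :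
    dRaw (csumRaw h x y) = csumRaw h (dRaw x) y + csumRaw h (sgnRaw x) (dRaw y) := by
  induction x using TP.induction with
  | hz => simp
  | add x y hx hy => simp only [map_add, LinearMap.add_apply, hx, hy]; abel
  | tmul l i x x' hx hx' =>
    induction y using TP.induction with
    | hz => simp
    | add x y hx hy => simp only [map_add, hx, hy]; abel
    | tmul j m y y' hy hy' =>
      rw [csumRaw_tmul h x y' hx' hy, map_smul, dRaw_tmul _ (P.csum_mem h hx hy),
        dRaw_tmul _ hx, dRaw_tmul _ hy, sgnRaw_tmul hx hx', P.csum_d h _ hx, Q.csum_d h _ hx']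
      simp only [map_sub, map_smul, LinearMap.sub_apply, LinearMap.smul_apply]
      rw [csumRaw_tmul h _ y' hx' hy, csumRaw_tmul h _ y' ((Q.obj c).d_mem hx') hy,
        csumRaw_tmul h _ y' hx' ((P.obj c').d_mem hy), csumRaw_tmul h _ _ hx' hy]
      simp only [TensorProduct.add_tmul, TensorProduct.tmul_add, TensorProduct.smul_tmul',
        TensorProduct.tmul_smul, smul_sub, smul_add, smul_smul]
      have e1 : (-1 : k) ^ (i * j) * (-1 : k) ^ l =
          (-1 : k) ^ l * (-1 : k) ^ i * (-1 : k) ^ (i * (j + 1)) := by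
        simp only [← neg_one_zpow_add]
        exact neg_one_zpow_congr ⟨-i, by ring⟩
      have e2 : (-1 : k) ^ (i * j) * (-1 : k) ^ (l + j) =
          (-1 : k) ^ l * (-1 : k) ^ ((i + 1) * j) := by
        simp only [← neg_one_zpow_add]
        exact neg_one_zpow_congr ⟨0, by ring⟩
      have e3 : (-1 : k) ^ (i * j) * ((-1 : k) ^ (l + j) * (-1 : k) ^ i) =
          (-1 : k) ^ j * ((-1 : k) ^ l * (-1 : k) ^ i * (-1 : k) ^ (i * j)) := by
        simp only [← neg_one_zpow_add]
        exact neg_one_zpow_congr ⟨0, by ring⟩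
      simp only [mul_assoc] at e1 e2 e3 ⊢
      rw [e1, e2, e3]
      abel

/-- `∘ab ⊗ •ab` on a connected sum, with both labels on the first argument. -/
theorem selfRaw_csumRaw_left {x₀ y₀ e₁ e₂ f : Cor} {a b : ℕ} (h₁ : ConnSum x₀ y₀ e₁)
    (h₁' : SelfGlue a b e₁ f) (h₂ : SelfGlue a b x₀ e₂) (h₂' : ConnSum e₂ y₀ f)
    (x : TP P Q x₀) (y : TP P Q y₀) :
    selfRaw h₁' (csumRaw h₁ x y) = csumRaw h₂' (selfRaw h₂ x) y := by
  induction x using TP.induction with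
  | hz => simp
  | add x y hx hy => simp only [map_add, LinearMap.add_apply, hx, hy]
  | tmul l i x x' hx hx' =>
    induction y using TP.induction with
    | hz => simp
    | add x y hx hy => simp only [map_add, hx, hy]
    | tmul j m y y' hy hy' =>
      rw [csumRaw_tmul h₁ x y' hx' hy, map_smul, selfRaw_tmul h₁' _ (P.csum_mem h₁ hx hy),
        selfRaw_tmul h₂ _ hx, map_smul, LinearMap.smul_apply,
        csumRaw_tmul h₂' _ y' (Q.self_mem h₂ hx') hy, smul_smul, smul_smul,
        P.self_csum_left h₁ h₁' h₂ h₂', Q.self_csum_left h₁ h₁' h₂ h₂', ← neg_one_zpow_add,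
        ← neg_one_zpow_add]
      congr 2
      ring

/-- `∘ab ⊗ •ab` on a connected sum, with `a` on the first and `b` on the second argument. -/
theorem selfRaw_csumRaw_mid {x₀ y₀ e₁ e₂ f : Cor} {a b : ℕ} (h₁ : ConnSum x₀ y₀ e₁)
    (h₁' : SelfGlue a b e₁ f) (h₂ : Glue a b x₀ y₀ e₂) (h₂' : Handle e₂ f)
    (x : TP P Q x₀) (y : TP P Q y₀) :
    selfRaw h₁' (csumRaw h₁ x y) = handleRaw h₂' (compRaw h₂ x y) := by
  induction x using TP.induction with
  | hz => simp
  | add x y hx hy => simp only [map_add, LinearMap.add_apply, hx, hy]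
  | tmul l i x x' hx hx' =>
    induction y using TP.induction with
    | hz => simp
    | add x y hx hy => simp only [map_add, hx, hy]
    | tmul j m y y' hy hy' =>
      rw [csumRaw_tmul h₁ x y' hx' hy, map_smul, selfRaw_tmul h₁' _ (P.csum_mem h₁ hx hy),
        compRaw_tmul h₂ y' hx hx' hy, map_smul, handleRaw_tmul, smul_smul,
        P.self_csum_mid h₁ h₁' h₂ h₂', Q.self_csum_mid h₁ h₁' h₂ h₂', neg_one_zpow_add, mul_assoc]

/-- `∘ab ⊗ •ab` on a connected sum, with `b` on the first and `a` on the second argument. -/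
theorem selfRaw_csumRaw_mid' {x₀ y₀ e₁ e₂ f : Cor} {a b : ℕ} (h₁ : ConnSum x₀ y₀ e₁)
    (h₁' : SelfGlue a b e₁ f) (h₂ : Glue b a x₀ y₀ e₂) (h₂' : Handle e₂ f)
    (x : TP P Q x₀) (y : TP P Q y₀) :
    selfRaw h₁' (csumRaw h₁ x y) = handleRaw h₂' (compRaw h₂ x y) := by
  induction x using TP.induction with
  | hz => simp
  | add x y hx hy => simp only [map_add, LinearMap.add_apply, hx, hy]
  | tmul l i x x' hx hx' =>
    induction y using TP.induction with
    | hz => simp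
    | add x y hx hy => simp only [map_add, hx, hy]
    | tmul j m y y' hy hy' =>
      rw [csumRaw_tmul h₁ x y' hx' hy, map_smul, selfRaw_tmul h₁' _ (P.csum_mem h₁ hx hy),
        compRaw_tmul h₂ y' hx hx' hy, map_smul, handleRaw_tmul, smul_smul,
        P.self_csum_mid' h₁ h₁' h₂ h₂', Q.self_csum_mid' h₁ h₁' h₂ h₂', neg_one_zpow_add,
        mul_assoc]

/-- `a∘b ⊗ a•b` on a connected sum in the second argument, with `b` on its first factor. -/
theorem compRaw_csumRaw_left {x₀ y₀ z₀ e₁ e₂ f : Cor} {a b : ℕ} (h₁ : ConnSum y₀ z₀ e₁)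
    (h₁' : Glue a b x₀ e₁ f) (h₂ : Glue a b x₀ y₀ e₂) (h₂' : ConnSum e₂ z₀ f)
    (x : TP P Q x₀) (y : TP P Q y₀) (z : TP P Q z₀) :
    compRaw h₁' x (csumRaw h₁ y z) = csumRaw h₂' (compRaw h₂ x y) z := by
  induction x using TP.induction with
  | hz => simp
  | add x y hx hy => simp [hx, hy]
  | tmul l i x x' hx hx' =>
    induction y using TP.induction with
    | hz => simp
    | add x y hx hy => simp only [map_add, LinearMap.add_apply, hx, hy]
    | tmul j m y y' hy hy' =>
      induction z using TP.induction with
      | hz => simp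
      | add x y hx hy => simp only [map_add, hx, hy]
      | tmul r s z z' hz hz' =>
        rw [csumRaw_tmul h₁ y z' hy' hz, compRaw_tmul h₂ y' hx hx' hy, map_smul, map_smul,
          LinearMap.smul_apply, compRaw_tmul h₁' _ hx hx' (P.csum_mem h₁ hy hz),
          csumRaw_tmul h₂' _ z' (Q.comp_mem h₂ hx' hy') hz, smul_smul, smul_smul,
          P.comp_csum_left h₁ h₁' h₂ h₂', Q.comp_csum_left h₁ h₁' h₂ h₂']
        simp only [← neg_one_zpow_add]
        congr 2
        ring

/-- Elements of even degree, in particular those of degree `0`, are fixed by the parity operator. -/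
theorem sgnRaw_of_mem_tensorDeg {c : Cor} {x : TP P Q c}
    (hx : x ∈ DGSpace.tensorDeg (P.obj c) (Q.obj c) 0) : sgnRaw x = x := by
  have h : DGSpace.tensorDeg (P.obj c) (Q.obj c) 0 ≤
      LinearMap.eqLocus (sgnRaw (P := P) (Q := Q) (c := c)) LinearMap.id := by
    refine iSup_le fun p => Submodule.map₂_le.2 fun x hx y hy => ?_
    rw [LinearMap.mem_eqLocus]
    refine (sgnRaw_tmul hx hy).trans ?_
    rw [← neg_one_zpow_add, (show Even (p + (0 - p)) by simp).neg_one_zpow, one_smul]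
    rfl
  exact h hx

end RawAxioms

/-! ### Sources and targets of the compositions -/

/-- The corolla `(C ⊔ C', G + G' + 1)`, for disjoint `C` and `C'`. -/
def Cor.csum (x y : Cor) : Cor :=
  ⟨x.legs ∪ y.legs, x.twoG + y.twoG + 2, by
    have := x.stable
    have := Finset.card_le_card (Finset.subset_union_left (s₁ := x.legs) (s₂ := y.legs))
    omega⟩

/-- The corolla `(C - {a, b}, G + 1)`. -/
def Cor.selfGlue (a b : ℕ) (x : Cor) : Cor :=
  ⟨(x.legs.erase a).erase b, x.twoG + 2, by
    have := x.stable
    have := Finset.pred_card_le_card_erase (s := x.legs) (a := a)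
    have := Finset.pred_card_le_card_erase (s := x.legs.erase a) (a := b)
    omega⟩

/-- The corolla `((C - {a}) ⊔ (C' - {b}), G + G')`, for disjoint `C` and `C'`. -/
def Cor.glue (a b : ℕ) (x y : Cor) (h : Disjoint x.legs y.legs) : Cor :=
  ⟨x.legs.erase a ∪ y.legs.erase b, x.twoG + y.twoG, by
    have := x.stable
    have := y.stable
    have := Finset.pred_card_le_card_erase (s := x.legs) (a := a)
    have := Finset.pred_card_le_card_erase (s := y.legs) (a := b)
    rw [Finset.card_union_of_disjoint (h.mono (Finset.erase_subset _ _) (Finset.erase_subset _ _))]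
    omega⟩

theorem ConnSum.eq {x y e : Cor} (h : ConnSum x y e) : e = x.csum y :=
  Cor.ext h.legs_eq h.twoG_eq

theorem ConnSum.of_disjoint {x y : Cor} (h : Disjoint x.legs y.legs) : ConnSum x y (x.csum y) :=
  ⟨h, rfl, rfl⟩

theorem SelfGlue.eq {a b : ℕ} {x e : Cor} (h : SelfGlue a b x e) : e = x.selfGlue a b :=
  Cor.ext h.legs_eq h.twoG_eq

theorem Glue.eq {a b : ℕ} {x y e : Cor} (h : Glue a b x y e) : e = x.glue a b y h.disj :=
  Cor.ext h.legs_eq h.twoG_eq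

theorem SelfGlue.unique_source {a b : ℕ} {x x' e : Cor} (h : SelfGlue a b x e)
    (h' : SelfGlue a b x' e) : x = x' := by
  have h1 := Finset.ext_iff.1 (h.legs_eq.symm.trans h'.legs_eq)
  have := h.left; have := h.right; have := h'.left; have := h'.right
  refine Cor.ext ?_ (by have := h.twoG_eq; have := h'.twoG_eq; omega)
  ext z
  have := h1 z
  grind

theorem Handle.unique_source {x x' e : Cor} (h : Handle x e) (h' : Handle x' e) : x = x' :=
  Cor.ext (h.legs_eq.symm.trans h'.legs_eq) (by have := h.twoG_eq; have := h'.twoG_eq; omega)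

theorem Cor.finite_le (s : Finset ℕ) (g : ℕ) : {c : Cor | c.legs ⊆ s ∧ c.twoG ≤ g}.Finite := by
  refine Set.Finite.of_injOn (f := fun c : Cor => (c.legs, c.twoG))
    (t := ↑(s.powerset ×ˢ Finset.range (g + 1))) (fun c hc => ?_) (fun c _ c' _ h => ?_)
    (Finset.finite_toSet _)
  · simpa [Nat.lt_succ_iff] using hc
  · exact Cor.ext (congrArg Prod.fst h) (congrArg Prod.snd h)

/-- The pairs of corollas with connected sum `c`. -/
abbrev ConnSum.Pair (c : Cor) := {p : Cor × Cor // ConnSum p.1 p.2 c}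

/-- The pairs of corollas from which `c` is obtained by gluing the label `a` of the first one to
the label `b` of the second one. -/
abbrev Glue.Pair (a b : ℕ) (c : Cor) := {p : Cor × Cor // Glue a b p.1 p.2 c}

/-- The corollas from which `c` is obtained by gluing the labels `a` and `b`; there is at most
one. -/
abbrev SelfGlue.Source (a b : ℕ) (c : Cor) := {x : Cor // SelfGlue a b x c}

/-- The corollas from which `c` is obtained by raising the genus by `2`; there is at most one. -/
abbrev Handle.Source (c : Cor) := {x : Cor // Handle x c}

instance ConnSum.finite (c : Cor) : Finite (ConnSum.Pair c) := by
  refine ((Cor.finite_le c.legs c.twoG).prod (Cor.finite_le c.legs c.twoG)).subset fun p hp => ?_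
  replace hp : ConnSum p.1 p.2 c := hp
  have h1 := hp.legs_eq
  have h2 := hp.twoG_eq
  refine ⟨⟨by grind, by omega⟩, ⟨by grind, by omega⟩⟩

instance Glue.finite (a b : ℕ) (c : Cor) : Finite (Glue.Pair a b c) := by
  refine ((Cor.finite_le (insert a c.legs) c.twoG).prod
    (Cor.finite_le (insert b c.legs) c.twoG)).subset fun p hp => ?_
  replace hp : Glue a b p.1 p.2 c := hp
  have h1 := hp.legs_eq
  have h2 := hp.twoG_eq
  refine ⟨⟨by grind, by omega⟩, ⟨by grind, by omega⟩⟩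

instance SelfGlue.finite (a b : ℕ) (c : Cor) : Finite (SelfGlue.Source a b c) :=
  @Finite.of_subsingleton _ ⟨fun x y => Subtype.ext (x.2.unique_source y.2)⟩

instance Handle.finite (c : Cor) : Finite (Handle.Source c) :=
  @Finite.of_subsingleton _ ⟨fun x y => Subtype.ext (x.2.unique_source y.2)⟩

instance ConnSum.fintype (c : Cor) : Fintype (ConnSum.Pair c) :=
  Fintype.ofFinite _

instance Glue.fintype (a b : ℕ) (c : Cor) : Fintype (Glue.Pair a b c) :=
  Fintype.ofFinite _

instance SelfGlue.fintype (a b : ℕ) (c : Cor) : Fintype (SelfGlue.Source a b c) :=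
  Fintype.ofFinite _

instance Handle.fintype (c : Cor) : Fintype (Handle.Source c) :=
  Fintype.ofFinite _

/-! ### Operations on families of elements indexed by all corollas -/

section Families

variable {k : Type u} [Field k] {P : ModularOperadCS.{u, v} k} {Q : OddModularOperadCS.{u, w} k}

/-- The product `⋆` of families: the sum over all ways to write `c` as a connected sum. -/
def starFam (F G : ∀ c : Cor, TP P Q c) (c : Cor) : TP P Q c :=
  ∑ p : ConnSum.Pair c, csumRaw p.2 (F p.1.1) (G p.1.2)

/-- Half of the bracket of families, without its sign: the sum over all ways to obtain `c` by gluing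
the label `a` of one corolla to the label `b` of another one. It vanishes on corollas that have `a`
or `b` among their labels. -/
def brFam (a b : ℕ) (F G : ∀ c : Cor, TP P Q c) (c : Cor) : TP P Q c :=
  ∑ p : Glue.Pair a b c, compRaw p.2 (F p.1.1) (G p.1.2)

/-- The operator `Δ` on families. The sum over the corollas with self-gluing `c` has at most one
term, and none if `a` or `b` is a label of `c` or if the genus of `c` is too small. -/
def deltaFam (a b : ℕ) (F : ∀ c : Cor, TP P Q c) (c : Cor) : TP P Q c :=
  ∑ x : SelfGlue.Source a b c, selfRaw x.2 (F x.1)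

/-- The operator `♯` on families; the sum has at most one term. -/
def sharpFam (F : ∀ c : Cor, TP P Q c) (c : Cor) : TP P Q c :=
  ∑ x : Handle.Source c, handleRaw x.2 (F x.1)

theorem starFam_congr {F F' G G' : ∀ c : Cor, TP P Q c} {c : Cor}
    (hF : ∀ x : Cor, x.legs ⊆ c.legs → F x = F' x)
    (hG : ∀ x : Cor, x.legs ⊆ c.legs → G x = G' x) : starFam F G c = starFam F' G' c := by
  refine Finset.sum_congr rfl fun p _ => ?_
  have h := p.2.legs_eq
  rw [hF p.1.1 (by grind), hG p.1.2 (by grind)]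

theorem starFam_comm [CharZero k] {F G : ∀ c : Cor, TP P Q c} (hF : ∀ c, sgnRaw (F c) = F c)
    (c : Cor) : starFam F G c = starFam G F c := by
  refine Fintype.sum_equiv
    ((Equiv.prodComm Cor Cor).subtypeEquiv fun p => ⟨ConnSum.symm, ConnSum.symm⟩) _ _ fun p => ?_
  exact csumRaw_comm p.2 p.2.symm (hF _) _

/-- Both sides are sums over all ways to write `c` as a connected sum of three corollas. -/
theorem starFam_assoc (F G H : ∀ c : Cor, TP P Q c) (c : Cor) :
    starFam F (starFam G H) c = starFam (starFam F G) H c := by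
  simp only [starFam, map_sum, LinearMap.sum_apply]
  rw [← Fintype.sum_sigma' (f := fun (p : ConnSum.Pair c)
      (q : ConnSum.Pair p.1.2) =>
      csumRaw p.2 (F p.1.1) (csumRaw q.2 (G q.1.1) (H q.1.2))),
    ← Fintype.sum_sigma' (f := fun (p : ConnSum.Pair c)
      (q : ConnSum.Pair p.1.1) =>
      csumRaw p.2 (csumRaw q.2 (F q.1.1) (G q.1.2)) (H p.1.2))]
  refine Finset.sum_bij' (fun s _ => ⟨⟨(s.1.1.1.csum s.2.1.1, s.2.1.2), ?_⟩,
      ⟨(s.1.1.1, s.2.1.1), ?_⟩⟩)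
    (fun s _ => ⟨⟨(s.2.1.1, s.2.1.2.csum s.1.1.2), ?_⟩, ⟨(s.2.1.2, s.1.1.2), ?_⟩⟩)
    (fun _ _ => Finset.mem_univ _) (fun _ _ => Finset.mem_univ _) ?_ ?_ ?_
  all_goals
    try (obtain ⟨⟨⟨x, e⟩, h⟩, ⟨⟨y, z⟩, h'⟩⟩ := s
         have h1 := h.legs_eq; have h2 := h'.legs_eq; have h3 := h.disj; have h4 := h'.disj
         have h5 := h.twoG_eq; have h6 := h'.twoG_eq
         dsimp only at h1 h2 h3 h4 h5 h6 ⊢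
         rw [Finset.disjoint_left] at h3 h4)
  · refine ⟨?_, ?_, ?_⟩
    · simp only [Cor.csum, Finset.disjoint_left]; grind
    · simp only [Cor.csum]; grind
    · simp only [Cor.csum]; omega
  · refine ConnSum.of_disjoint ?_
    simp only [Finset.disjoint_left]; grind
  · refine ⟨?_, ?_, ?_⟩
    · simp only [Cor.csum, Finset.disjoint_left]; grind
    · simp only [Cor.csum]; grind
    · simp only [Cor.csum]; omega
  · refine ConnSum.of_disjoint ?_
    simp only [Finset.disjoint_left]; grind
  · rintro ⟨⟨⟨x, e⟩, h⟩, ⟨⟨y, z⟩, h'⟩⟩ -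
    obtain rfl : e = y.csum z := h'.eq
    rfl
  · rintro ⟨⟨⟨e, z⟩, h⟩, ⟨⟨x, y⟩, h'⟩⟩ -
    obtain rfl : e = x.csum y := h'.eq
    rfl
  · rintro ⟨⟨⟨x, e⟩, h⟩, ⟨⟨y, z⟩, h'⟩⟩ -
    exact csumRaw_assoc _ _ _ _ _ _ _

end Families

/-! ### Second order identities for families -/

section SecondOrder

variable {k : Type u} [Field k] {P : ModularOperadCS.{u, v} k} {Q : OddModularOperadCS.{u, w} k}

/-- Reindexing of the part of an iterated sum that is cut out by a condition `p`. -/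
theorem sum_sum_ite_eq_of_bij {ι κ M : Type*} [AddCommMonoid M] {α : ι → Type*}
    {β : κ → Type*} [Fintype ι] [Fintype κ] [∀ i, Fintype (α i)] [∀ j, Fintype (β j)]
    (p : ∀ i, α i → Prop) [∀ i, DecidablePred (p i)]
    (f : ∀ i, α i → M) (g : ∀ j, β j → M) (e : ∀ j, β j → Σ i, α i)
    (hp : ∀ j b, p (e j b).1 (e j b).2)
    (hinj : ∀ j b j' b', e j b = e j' b' → (⟨j, b⟩ : Σ j, β j) = ⟨j', b'⟩)
    (hsurj : ∀ i a, p i a → ∃ j b, e j b = ⟨i, a⟩)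
    (hfg : ∀ j b, f (e j b).1 (e j b).2 = g j b) :
    ∑ i, ∑ a, (if p i a then f i a else 0) = ∑ j, ∑ b, g j b := by
  rw [← Fintype.sum_sigma' (f := fun i a => if p i a then f i a else 0),
    ← Fintype.sum_sigma' (f := g), ← Finset.sum_filter]
  refine (Finset.sum_bij (fun s _ => e s.1 s.2) ?_ ?_ ?_ ?_).symm
  · intro s _; simp [hp]
  · rintro ⟨j, b⟩ - ⟨j', b'⟩ - h; exact hinj _ _ _ _ h
  · rintro ⟨i, a⟩ h
    obtain ⟨j, b, h'⟩ := hsurj i a (by simpa using h)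
    exact ⟨⟨j, b⟩, Finset.mem_univ _, h'⟩
  · intro s _; exact (hfg _ _).symm

/-- The part of `Δ(F ⋆ G)` in which both labels belong to the corolla of `F`. -/
theorem deltaFam_starFam_left (F G : ∀ c : Cor, TP P Q c) {a b : ℕ} {c : Cor}
    (ha : a ∉ c.legs) (hb : b ∉ c.legs) :
    ∑ s : SelfGlue.Source a b c, ∑ p : ConnSum.Pair s.1,
      (if a ∈ p.1.1.legs ∧ b ∈ p.1.1.legs then
        selfRaw s.2 (csumRaw p.2 (F p.1.1) (G p.1.2)) else 0) =
      starFam (deltaFam a b F) G c := by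
  simp only [starFam, deltaFam, map_sum, LinearMap.sum_apply]
  refine sum_sum_ite_eq_of_bij
    (p := fun (s : SelfGlue.Source a b c)
      (p : ConnSum.Pair s.1) => a ∈ p.1.1.legs ∧ b ∈ p.1.1.legs)
    (f := fun (s : SelfGlue.Source a b c) (p : ConnSum.Pair s.1) =>
      selfRaw s.2 (csumRaw p.2 (F p.1.1) (G p.1.2)))
    (g := fun (p : ConnSum.Pair c) (x : SelfGlue.Source a b p.1.1) =>
      csumRaw p.2 (selfRaw x.2 (F x.1)) (G p.1.2))
    (e := fun (p : ConnSum.Pair c) (x : SelfGlue.Source a b p.1.1) =>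
      ⟨⟨x.1.csum p.1.2, ?_⟩, ⟨(x.1, p.1.2), ?_⟩⟩) ?_ ?_ ?_ ?_
  · obtain ⟨⟨e, y⟩, h⟩ := p
    obtain ⟨x, h'⟩ := x
    have h1 := h.legs_eq; have h2 := h'.legs_eq; have h3 := h.disj
    have h5 := h.twoG_eq; have h6 := h'.twoG_eq; have h7 := h'.left; have h8 := h'.right
    dsimp only at *
    refine ⟨h'.ne, by simp only [Cor.csum]; grind, by simp only [Cor.csum]; grind, ?_, ?_⟩
    · simp only [Cor.csum]; grind
    · simp only [Cor.csum]; omega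
  · obtain ⟨⟨e, y⟩, h⟩ := p
    obtain ⟨x, h'⟩ := x
    have h1 := h.legs_eq; have h2 := h'.legs_eq; have h3 := h.disj
    dsimp only at *
    refine ConnSum.of_disjoint ?_
    rw [Finset.disjoint_left] at h3 ⊢
    grind
  · intro p x
    exact ⟨x.2.left, x.2.right⟩
  · rintro ⟨⟨e, y⟩, h⟩ ⟨x, h'⟩ ⟨⟨e', y'⟩, h''⟩ ⟨x', h₃⟩ heq
    have := congrArg (fun u => (u.2.1 : Cor × Cor)) heq
    obtain ⟨rfl, rfl⟩ := Prod.ext_iff.1 this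
    dsimp only at *
    obtain rfl := h'.eq.trans h₃.eq.symm
    rfl
  · rintro ⟨e, h⟩ ⟨⟨x, y⟩, h'⟩ hp
    have h1 := h.legs_eq; have h2 := h'.legs_eq; have h3 := h'.disj
    have h5 := h.twoG_eq; have h6 := h'.twoG_eq
    obtain rfl := h'.eq
    dsimp only at *
    rw [Finset.disjoint_left] at h3
    refine ⟨⟨(x.selfGlue a b, y), ?_, ?_, ?_⟩, ⟨x, h.ne, hp.1, hp.2, rfl, rfl⟩, rfl⟩
    · simp only [Cor.selfGlue, Finset.disjoint_left]; grind
    · simp only [Cor.selfGlue]; grind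
    · simp only [Cor.selfGlue]; omega
  · intro p x
    exact selfRaw_csumRaw_left _ _ _ _ _ _

/-- The part of `Δ(F ⋆ G)` in which one label belongs to the corolla of `F` and the other one to
that of `G`. -/
theorem deltaFam_starFam_mid (F G : ∀ c : Cor, TP P Q c) {a b a' b' : ℕ} {c : Cor}
    (h : (a' = a ∧ b' = b) ∨ (a' = b ∧ b' = a)) :
    ∑ s : SelfGlue.Source a b c, ∑ p : ConnSum.Pair s.1,
      (if a' ∈ p.1.1.legs ∧ b' ∈ p.1.2.legs then
        selfRaw s.2 (csumRaw p.2 (F p.1.1) (G p.1.2)) else 0) =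
      sharpFam (brFam a' b' F G) c := by
  simp only [sharpFam, brFam, map_sum]
  refine sum_sum_ite_eq_of_bij
    (p := fun (s : SelfGlue.Source a b c) (p : ConnSum.Pair s.1) =>
      a' ∈ p.1.1.legs ∧ b' ∈ p.1.2.legs)
    (f := fun (s : SelfGlue.Source a b c) (p : ConnSum.Pair s.1) =>
      selfRaw s.2 (csumRaw p.2 (F p.1.1) (G p.1.2)))
    (g := fun (s : Handle.Source c) (p : Glue.Pair a' b' s.1) =>
      handleRaw s.2 (compRaw p.2 (F p.1.1) (G p.1.2)))
    (e := fun (s : Handle.Source c) (p : Glue.Pair a' b' s.1) =>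
      ⟨⟨p.1.1.csum p.1.2, ?_⟩, ⟨(p.1.1, p.1.2), ConnSum.of_disjoint p.2.disj⟩⟩) ?_ ?_ ?_ ?_
  · obtain ⟨e, h⟩ := s
    obtain ⟨⟨x, y⟩, h'⟩ := p
    have h1 := h.legs_eq; have h2 := h'.legs_eq; have h3 := h'.disj
    have h5 := h.twoG_eq; have h6 := h'.twoG_eq; have h7 := h'.left; have h8 := h'.right
    dsimp only at *
    rw [Finset.disjoint_left] at h3
    have ne : a' ≠ b' := fun e => h3 h7 (e ▸ h8)
    refine ⟨by grind, by simp only [Cor.csum]; grind, by simp only [Cor.csum]; grind, ?_, ?_⟩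
    · simp only [Cor.csum]; grind
    · simp only [Cor.csum]; omega
  · intro s p
    exact ⟨p.2.left, p.2.right⟩
  · rintro ⟨e, h⟩ ⟨⟨x, y⟩, h'⟩ ⟨e', h''⟩ ⟨⟨x', y'⟩, h₃⟩ heq
    have := congrArg (fun u => (u.2.1 : Cor × Cor)) heq
    obtain ⟨rfl, rfl⟩ := Prod.ext_iff.1 this
    dsimp only at *
    obtain rfl := h'.eq.trans h₃.eq.symm
    rfl
  · rintro ⟨e, h⟩ ⟨⟨x, y⟩, h'⟩ hp
    have h1 := h.legs_eq; have h2 := h'.legs_eq; have h3 := h'.disj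
    have h5 := h.twoG_eq; have h6 := h'.twoG_eq
    obtain rfl := h'.eq
    dsimp only at *
    refine ⟨⟨x.glue a' b' y h3, ?_, ?_⟩, ⟨(x, y), hp.1, hp.2, h3, rfl, rfl⟩, rfl⟩
    · rw [Finset.disjoint_left] at h3
      simp only [Cor.glue]; grind
    · simp only [Cor.glue]; omega
  · intro s p
    rcases h with ⟨rfl, rfl⟩ | ⟨rfl, rfl⟩
    · exact selfRaw_csumRaw_mid _ _ _ _ _ _
    · exact selfRaw_csumRaw_mid' _ _ _ _ _ _

/-- `Δ` is a second order operator with respect to `⋆`: the terms in which the glued labels lie on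
different factors form the bracket. -/
theorem deltaFam_starFam [CharZero k] {F : ∀ c : Cor, TP P Q c} (hF : ∀ c, sgnRaw (F c) = F c)
    (G : ∀ c : Cor, TP P Q c) {a b : ℕ} {c : Cor} (ha : a ∉ c.legs) (hb : b ∉ c.legs) :
    deltaFam a b (starFam F G) c =
      starFam (deltaFam a b F) G c + starFam (deltaFam a b G) F c +
        (sharpFam (brFam a b F G) c + sharpFam (brFam b a F G) c) := by
  rw [← deltaFam_starFam_left F G ha hb, ← deltaFam_starFam_left G F ha hb,
    ← deltaFam_starFam_mid F G (Or.inl ⟨rfl, rfl⟩), ← deltaFam_starFam_mid F G (Or.inr ⟨rfl, rfl⟩),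
    deltaFam, ← Finset.sum_add_distrib, ← Finset.sum_add_distrib, ← Finset.sum_add_distrib]
  refine Finset.sum_congr rfl fun s _ => ?_
  -- As `F` is even, the case of both labels on the second factor reduces to that of both labels on
  -- the first one.
  have swap : ∑ p : ConnSum.Pair s.1, (if a ∈ p.1.1.legs ∧ b ∈ p.1.1.legs then
        selfRaw s.2 (csumRaw p.2 (G p.1.1) (F p.1.2)) else 0) =
      ∑ p : ConnSum.Pair s.1, (if a ∈ p.1.2.legs ∧ b ∈ p.1.2.legs then
        selfRaw s.2 (csumRaw p.2 (F p.1.1) (G p.1.2)) else 0) := by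
    refine Fintype.sum_equiv
      ((Equiv.prodComm Cor Cor).subtypeEquiv fun p => ⟨ConnSum.symm, ConnSum.symm⟩) _ _ fun p => ?_
    rw [← csumRaw_comm p.2.symm p.2 (hF _)]
    rfl
  rw [swap, starFam, map_sum, ← Finset.sum_add_distrib, ← Finset.sum_add_distrib,
    ← Finset.sum_add_distrib]
  refine Finset.sum_congr rfl fun p _ => ?_
  obtain ⟨e, h⟩ := s
  obtain ⟨⟨x, y⟩, h'⟩ := p
  have h1 := h'.legs_eq; have h2 := h'.disj
  have h3 := h.left; have h4 := h.right
  dsimp only at *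
  rw [Finset.disjoint_left] at h2
  rw [h1, Finset.mem_union] at h3 h4
  rcases h3 with h3 | h3 <;> rcases h4 with h4 | h4
  · simp [h3, h4, h2 h3, h2 h4]
  · have h5 : b ∉ x.legs := fun h => h2 h h4
    simp [h3, h4, h2 h3, h5]
  · have h5 : a ∉ x.legs := fun h => h2 h h3
    simp [h3, h4, h2 h4, h5]
  · have h5 : a ∉ x.legs := fun h => h2 h h3
    have h6 : b ∉ x.legs := fun h => h2 h h4
    simp [h3, h4, h5, h6]

/-- The part of `{F, G ⋆ H}` in which the glued label belongs to the corolla of `G`. -/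
theorem brFam_starFam_left (F G H : ∀ c : Cor, TP P Q c) {a b : ℕ} {c : Cor}
    (ha : a ∉ c.legs) (hb : b ∉ c.legs) :
    ∑ s : Glue.Pair a b c, ∑ p : ConnSum.Pair s.1.2,
      (if b ∈ p.1.1.legs then
        compRaw s.2 (F s.1.1) (csumRaw p.2 (G p.1.1) (H p.1.2)) else 0) =
      starFam (brFam a b F G) H c := by
  simp only [starFam, brFam, map_sum, LinearMap.sum_apply]
  refine sum_sum_ite_eq_of_bij
    (p := fun (s : Glue.Pair a b c) (p : ConnSum.Pair s.1.2) => b ∈ p.1.1.legs)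
    (f := fun (s : Glue.Pair a b c) (p : ConnSum.Pair s.1.2) =>
      compRaw s.2 (F s.1.1) (csumRaw p.2 (G p.1.1) (H p.1.2)))
    (g := fun (p : ConnSum.Pair c) (q : Glue.Pair a b p.1.1) =>
      csumRaw p.2 (compRaw q.2 (F q.1.1) (G q.1.2)) (H p.1.2))
    (e := fun (p : ConnSum.Pair c) (q : Glue.Pair a b p.1.1) =>
      ⟨⟨(q.1.1, q.1.2.csum p.1.2), ?_⟩, ⟨(q.1.2, p.1.2), ?_⟩⟩) ?_ ?_ ?_ ?_
  · obtain ⟨⟨e, z⟩, h⟩ := p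
    obtain ⟨⟨x, y⟩, h'⟩ := q
    have h1 := h.legs_eq; have h2 := h'.legs_eq; have h3 := h.disj; have h4 := h'.disj
    have h5 := h.twoG_eq; have h6 := h'.twoG_eq; have h7 := h'.left; have h8 := h'.right
    dsimp only at *
    rw [Finset.disjoint_left] at h3 h4
    refine ⟨h7, by simp only [Cor.csum]; grind, ?_, ?_, ?_⟩
    · simp only [Cor.csum, Finset.disjoint_left]; grind
    · simp only [Cor.csum]; grind
    · simp only [Cor.csum]; omega
  · obtain ⟨⟨e, z⟩, h⟩ := p
    obtain ⟨⟨x, y⟩, h'⟩ := q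
    have h1 := h.legs_eq; have h2 := h'.legs_eq; have h3 := h.disj
    dsimp only at *
    refine ConnSum.of_disjoint ?_
    rw [Finset.disjoint_left] at h3 ⊢
    grind
  · intro p q
    exact q.2.right
  · rintro ⟨⟨e, z⟩, h⟩ ⟨⟨x, y⟩, h'⟩ ⟨⟨e', z'⟩, h''⟩ ⟨⟨x', y'⟩, h₃⟩ heq
    have h1 := congrArg (fun u => (u.2.1 : Cor × Cor)) heq
    have h2 := congrArg (fun u => (u.1.1.1 : Cor)) heq
    obtain ⟨rfl, rfl⟩ := Prod.ext_iff.1 h1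
    dsimp only at *
    subst h2
    obtain rfl := h'.eq.trans h₃.eq.symm
    rfl
  · rintro ⟨⟨x, e⟩, h⟩ ⟨⟨y, z⟩, h'⟩ hp
    have h1 := h.legs_eq; have h2 := h'.legs_eq; have h3 := h.disj; have h4 := h'.disj
    have h5 := h.twoG_eq; have h6 := h'.twoG_eq; have h7 := h.left
    obtain rfl := h'.eq
    dsimp only at *
    rw [h2] at h3
    have h8 := (Finset.disjoint_union_right.1 h3).1
    refine ⟨⟨(x.glue a b y h8, z), ?_, ?_, ?_⟩, ⟨(x, y), h7, hp, h8, rfl, rfl⟩, rfl⟩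
    all_goals rw [Finset.disjoint_left] at h3 h4
    · simp only [Cor.glue, Finset.disjoint_left]; grind
    · simp only [Cor.glue]; grind
    · simp only [Cor.glue]; omega
  · intro p q
    exact compRaw_csumRaw_left _ _ _ _ _ _ _

/-- The bracket is a derivation of `⋆`. -/
theorem brFam_starFam [CharZero k] (F G : ∀ c : Cor, TP P Q c) {H : ∀ c : Cor, TP P Q c}
    (hH : ∀ c, sgnRaw (H c) = H c) {a b : ℕ} {c : Cor} (ha : a ∉ c.legs) (hb : b ∉ c.legs) :
    brFam a b F (starFam G H) c =
      starFam (brFam a b F G) H c + starFam (brFam a b F H) G c := by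
  rw [← brFam_starFam_left F G H ha hb, ← brFam_starFam_left F H G ha hb, brFam,
    ← Finset.sum_add_distrib]
  refine Finset.sum_congr rfl fun s _ => ?_
  have swap : ∑ p : ConnSum.Pair s.1.2, (if b ∈ p.1.1.legs then
        compRaw s.2 (F s.1.1) (csumRaw p.2 (H p.1.1) (G p.1.2)) else 0) =
      ∑ p : ConnSum.Pair s.1.2, (if b ∈ p.1.2.legs then
        compRaw s.2 (F s.1.1) (csumRaw p.2 (G p.1.1) (H p.1.2)) else 0) := by
    refine Fintype.sum_equiv
      ((Equiv.prodComm Cor Cor).subtypeEquiv fun p => ⟨ConnSum.symm, ConnSum.symm⟩) _ _ fun p => ?_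
    rw [csumRaw_comm p.2 p.2.symm (hH _)]
    rfl
  rw [swap, starFam, map_sum, ← Finset.sum_add_distrib]
  refine Finset.sum_congr rfl fun p _ => ?_
  have h1 := p.2.legs_eq; have h2 := Finset.disjoint_left.1 p.2.disj
  have h3 := s.2.right
  rw [h1, Finset.mem_union] at h3
  rcases h3 with h3 | h3
  · simp [h3, h2 h3]
  · have h4 : b ∉ p.1.1.legs := fun h => h2 h h3
    simp [h3, h4]

theorem sharpFam_starFam (F G : ∀ c : Cor, TP P Q c) (c : Cor) :
    sharpFam (starFam F G) c = starFam (sharpFam F) G c := by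
  simp only [starFam, sharpFam, map_sum, LinearMap.sum_apply]
  rw [← Fintype.sum_sigma' (f := fun (s : Handle.Source c) (p : ConnSum.Pair s.1) =>
      handleRaw s.2 (csumRaw p.2 (F p.1.1) (G p.1.2))),
    ← Fintype.sum_sigma' (f := fun (p : ConnSum.Pair c) (s : Handle.Source p.1.1) =>
      csumRaw p.2 (handleRaw s.2 (F s.1)) (G p.1.2))]
  refine Finset.sum_bij
    (fun s _ => ⟨⟨(⟨s.2.1.1.legs, s.2.1.1.twoG + 4, ?_⟩, s.2.1.2), ?_⟩, ⟨s.2.1.1, rfl, rfl⟩⟩)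
    (fun _ _ => Finset.mem_univ _) ?_ ?_ ?_
  · have := s.2.1.1.stable; omega
  · have h1 := s.1.2.twoG_eq; have h2 := s.2.2.twoG_eq
    exact ⟨s.2.2.disj, by rw [s.1.2.legs_eq, s.2.2.legs_eq], by dsimp only; omega⟩
  · rintro ⟨⟨e, h⟩, ⟨⟨x, y⟩, h'⟩⟩ - ⟨⟨e', h''⟩, ⟨⟨x', y'⟩, h₃⟩⟩ - heq
    have h1 := congrArg (fun u => (u.2.1 : Cor)) heq
    have h2 := congrArg (fun u => (u.1.1.2 : Cor)) heq
    dsimp only at h1 h2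
    subst h1 h2
    obtain rfl := h'.eq.trans h₃.eq.symm
    rfl
  · rintro ⟨⟨⟨e, y⟩, h⟩, ⟨x, h'⟩⟩ -
    have h1 := h'.legs_eq
    have h2 := h'.twoG_eq
    have h3 := h.legs_eq
    have h4 := h.twoG_eq
    have h5 := h.disj
    obtain ⟨l, g, st⟩ := e
    dsimp only at h1 h2 h3 h4 h5
    subst h1 h2
    exact ⟨⟨⟨x.csum y, h3, by simp only [Cor.csum]; omega⟩,
      ⟨(x, y), ConnSum.of_disjoint h5⟩⟩, Finset.mem_univ _, rfl⟩
  · rintro ⟨⟨e, h⟩, ⟨⟨x, y⟩, h'⟩⟩ -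
    exact (csumRaw_handleRaw _ _ _ _ _ _).symm

theorem dRaw_starFam {F : ∀ c : Cor, TP P Q c} (hF : ∀ c, sgnRaw (F c) = F c)
    (G : ∀ c : Cor, TP P Q c) (c : Cor) :
    dRaw (starFam F G c) =
      starFam (fun c => dRaw (F c)) G c + starFam F (fun c => dRaw (G c)) c := by
  simp only [starFam, map_sum, dRaw_csumRaw, hF, Finset.sum_add_distrib]

end SecondOrder

/-! ### Permutations of the labels and invariant families -/

/-- The corolla obtained from `c` by applying a permutation of all labels. -/
def Cor.perm (π : Equiv.Perm ℕ) : Cor ≃ Cor where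
  toFun c := ⟨c.legs.map π.toEmbedding, c.twoG, by simpa using c.stable⟩
  invFun c := ⟨c.legs.map π.symm.toEmbedding, c.twoG, by simpa using c.stable⟩
  left_inv c := by ext x <;> simp
  right_inv c := by ext x <;> simp

theorem Cor.mem_perm {π : Equiv.Perm ℕ} {c : Cor} {x : ℕ} :
    π x ∈ (Cor.perm π c).legs ↔ x ∈ c.legs := by
  simp [Cor.perm]

/-- The morphism `c ⟶ π c` given by `π`. -/
def Cor.permHom (π : Equiv.Perm ℕ) (c : Cor) : Cor.Hom c (Cor.perm π c) :=
  Cor.Hom.ofPerm π (fun _ => Cor.mem_perm.symm) rfl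

theorem Cor.permHom_maps {π : Equiv.Perm ℕ} {c : Cor} {x y : ℕ} :
    (Cor.permHom π c).Maps x y ↔ x ∈ c.legs ∧ π x = y :=
  Cor.Hom.ofPerm_maps _ _ _ _ _

theorem connSum_perm (π : Equiv.Perm ℕ) {x y c : Cor} :
    ConnSum x y c ↔ ConnSum (Cor.perm π x) (Cor.perm π y) (Cor.perm π c) := by
  constructor
  · rintro ⟨h1, h2, h3⟩
    exact ⟨by simpa [Cor.perm] using h1, by simp [Cor.perm, h2, Finset.map_union], h3⟩
  · rintro ⟨h1, h2, h3⟩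
    simp only [Cor.perm, Equiv.coe_fn_mk, Finset.disjoint_map, ← Finset.map_union,
      Finset.map_inj] at h1 h2 h3
    exact ⟨h1, h2, h3⟩

theorem glue_perm (π : Equiv.Perm ℕ) {a b : ℕ} {x y c : Cor} :
    Glue a b x y c ↔ Glue (π a) (π b) (Cor.perm π x) (Cor.perm π y) (Cor.perm π c) := by
  have ea : π a = π.toEmbedding a := rfl
  have eb : π b = π.toEmbedding b := rfl
  constructor
  · rintro ⟨h1, h2, h3, h4, h5⟩
    refine ⟨Cor.mem_perm.2 h1, Cor.mem_perm.2 h2, by simpa [Cor.perm] using h3, ?_, h5⟩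
    simp only [Cor.perm, Equiv.coe_fn_mk, h4]
    rw [Finset.map_union, Finset.map_erase, Finset.map_erase, ea, eb]
  · rintro ⟨h1, h2, h3, h4, h5⟩
    refine ⟨Cor.mem_perm.1 h1, Cor.mem_perm.1 h2, by simpa [Cor.perm] using h3, ?_, h5⟩
    simp only [Cor.perm, Equiv.coe_fn_mk] at h4
    rwa [ea, eb, ← Finset.map_erase, ← Finset.map_erase, ← Finset.map_union,
      Finset.map_inj] at h4

theorem selfGlue_perm (π : Equiv.Perm ℕ) {a b : ℕ} {x c : Cor} :
    SelfGlue a b x c ↔ SelfGlue (π a) (π b) (Cor.perm π x) (Cor.perm π c) := by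
  have ea : π a = π.toEmbedding a := rfl
  have eb : π b = π.toEmbedding b := rfl
  constructor
  · rintro ⟨h0, h1, h2, h4, h5⟩
    refine ⟨π.injective.ne h0, Cor.mem_perm.2 h1, Cor.mem_perm.2 h2, ?_, h5⟩
    simp only [Cor.perm, Equiv.coe_fn_mk, h4]
    rw [Finset.map_erase, Finset.map_erase, ea, eb]
  · rintro ⟨h0, h1, h2, h4, h5⟩
    refine ⟨fun h => h0 (congrArg π h), Cor.mem_perm.1 h1, Cor.mem_perm.1 h2, ?_, h5⟩
    simp only [Cor.perm, Equiv.coe_fn_mk] at h4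
    rwa [ea, eb, ← Finset.map_erase, ← Finset.map_erase, Finset.map_inj] at h4

theorem handle_perm (π : Equiv.Perm ℕ) {x c : Cor} :
    Handle x c ↔ Handle (Cor.perm π x) (Cor.perm π c) := by
  constructor
  · rintro ⟨h1, h2⟩
    exact ⟨by simp [Cor.perm, h1], h2⟩
  · rintro ⟨h1, h2⟩
    simp only [Cor.perm, Equiv.coe_fn_mk, Finset.map_inj] at h1
    exact ⟨h1, h2⟩

/-- Any morphism of corollas is induced by a permutation of all labels, whose values at two
further labels can be prescribed. -/
theorem Cor.Hom.exists_perm_apply {c d : Cor} (ρ : Cor.Hom c d) {a b a' b' : ℕ} (hab : a ≠ b)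
    (ha : a ∉ c.legs) (hb : b ∉ c.legs) (hab' : a' ≠ b') (ha' : a' ∉ d.legs)
    (hb' : b' ∉ d.legs) :
    ∃ π : Equiv.Perm ℕ, (∀ x, ∀ hx : x ∈ c.legs, π x = ρ.equiv ⟨x, hx⟩) ∧ π a = a' ∧ π b = b' := by
  have : Infinite {x // x ∉ c.legs} := c.legs.finite_toSet.infinite_compl.to_subtype
  have : Infinite {x // x ∉ d.legs} := d.legs.finite_toSet.infinite_compl.to_subtype
  obtain ⟨f⟩ : Nonempty ({x // x ∉ c.legs} ≃ {x // x ∉ d.legs}) := nonempty_equiv_of_countable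
  let π₀ : Equiv.Perm ℕ := Equiv.subtypeCongr ρ.equiv f
  have h₀ : ∀ x, ∀ hx : x ∈ c.legs, π₀ x = ρ.equiv ⟨x, hx⟩ := fun x hx => by
    simp [π₀, Equiv.subtypeCongr, Equiv.sumCompl_symm_apply_of_pos, hx]
  have h₁ : ∀ x, x ∉ c.legs → π₀ x ∉ d.legs := fun x hx => by
    simp only [π₀, Equiv.subtypeCongr, Equiv.trans_apply,
      Equiv.sumCompl_symm_apply_of_neg hx, Equiv.sumCongr_apply, Sum.map_inr,
      Equiv.sumCompl_apply_inr]
    exact (f ⟨x, hx⟩).2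
  -- Transpositions correct the values at `a` and `b` without affecting those on the labels of `c`.
  let π₁ : Equiv.Perm ℕ := π₀.trans (Equiv.swap (π₀ a) a')
  have e₁ : π₁ a = a' := by simp [π₁]
  have h₂ : ∀ x, ∀ hx : x ∈ c.legs, π₁ x = ρ.equiv ⟨x, hx⟩ := fun x hx => by
    have h3 : π₀ x ≠ π₀ a := fun h => ha (π₀.injective h ▸ hx)
    have h4 : π₀ x ≠ a' := fun h => ha' (by rw [← h, h₀ x hx]; exact (ρ.equiv ⟨x, hx⟩).2)
    simp only [π₁, Equiv.trans_apply, Equiv.swap_apply_of_ne_of_ne h3 h4]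
    exact h₀ x hx
  refine ⟨π₁.trans (Equiv.swap (π₁ b) b'), fun x hx => ?_, ?_, by simp⟩
  · have h3 : π₁ x ≠ π₁ b := fun h => hb (π₁.injective h ▸ hx)
    have h4 : π₁ x ≠ b' := fun h => hb' (by rw [← h, h₂ x hx]; exact (ρ.equiv ⟨x, hx⟩).2)
    rw [Equiv.trans_apply, Equiv.swap_apply_of_ne_of_ne h3 h4]
    exact h₂ x hx
  · have h3 : a' ≠ π₁ b := fun h => hab (π₁.injective (e₁.trans h))
    rw [Equiv.trans_apply, e₁, Equiv.swap_apply_of_ne_of_ne h3 hab']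

theorem Cor.Hom.exists_perm_eq {c d : Cor} (ρ : Cor.Hom c d) {a b a' b' : ℕ} (hab : a ≠ b)
    (ha : a ∉ c.legs) (hb : b ∉ c.legs) (hab' : a' ≠ b') (ha' : a' ∉ d.legs)
    (hb' : b' ∉ d.legs) :
    ∃ π : Equiv.Perm ℕ, ∃ h : d = Cor.perm π c, h ▸ ρ = Cor.permHom π c ∧ π a = a' ∧ π b = b' := by
  obtain ⟨π, h1, h2, h3⟩ := ρ.exists_perm_apply hab ha hb hab' ha' hb'
  have h : d = Cor.perm π c := by
    refine Cor.ext ?_ ρ.twoG_eq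
    ext y
    simp only [Cor.perm, Equiv.coe_fn_mk, Finset.mem_map, Equiv.coe_toEmbedding]
    constructor
    · intro hy
      obtain ⟨⟨x, hx⟩, hxy⟩ := ρ.equiv.surjective ⟨y, hy⟩
      exact ⟨x, hx, by rw [h1 x hx, hxy]⟩
    · rintro ⟨x, hx, rfl⟩
      rw [h1 x hx]
      exact (ρ.equiv ⟨x, hx⟩).2
  refine ⟨π, h, ?_, h2, h3⟩
  subst h
  obtain ⟨r, hr⟩ := ρ
  simp only [Cor.permHom, Cor.Hom.ofPerm]
  congr 1
  ext x
  exact (h1 x x.2).symm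

theorem Cor.exists_fresh (c : Cor) : ∃ a b : ℕ, a ≠ b ∧ a ∉ c.legs ∧ b ∉ c.legs := by
  obtain ⟨a, ha⟩ := Infinite.exists_notMem_finset c.legs
  obtain ⟨b, hb⟩ := Infinite.exists_notMem_finset (insert a c.legs)
  rw [Finset.mem_insert, not_or] at hb
  exact ⟨a, b, Ne.symm hb.1, ha, hb.2⟩

section Invariant

variable {k : Type u} [Field k] {P : ModularOperadCS.{u, v} k} {Q : OddModularOperadCS.{u, w} k}

/-- A family of elements of `P(C, G) ⊗ Q(C, G)` that is preserved by all bijections of labels. -/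
def IsInvariant (F : ∀ c : Cor, TP P Q c) : Prop :=
  ∀ ⦃c d : Cor⦄ (ρ : Cor.Hom c d), relabel ρ (F c) = F d

theorem IsInvariant.of_perm {F : ∀ c : Cor, TP P Q c}
    (h : ∀ (π : Equiv.Perm ℕ) (c : Cor), relabel (Cor.permHom π c) (F c) = F (Cor.perm π c)) :
    IsInvariant F := by
  intro c d ρ
  obtain ⟨a, b, hab, ha, hb⟩ := c.exists_fresh
  obtain ⟨a', b', hab', ha', hb'⟩ := d.exists_fresh
  obtain ⟨π, rfl, hρ, -⟩ := ρ.exists_perm_eq hab ha hb hab' ha' hb'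
  obtain rfl : ρ = Cor.permHom π c := hρ
  exact h π c

theorem IsInvariant.star {F G : ∀ c : Cor, TP P Q c} (hF : IsInvariant F) (hG : IsInvariant G) :
    IsInvariant (starFam F G) := by
  refine .of_perm fun π c => ?_
  rw [starFam, map_sum]
  refine Fintype.sum_equiv (((Cor.perm π).prodCongr (Cor.perm π)).subtypeEquiv
    fun p => connSum_perm π) _ _ fun p => ?_
  rw [relabel_csumRaw p.2 ((connSum_perm π).1 p.2) (Cor.permHom π p.1.1) (Cor.permHom π p.1.2),
    hF, hG]
  · rfl
  all_goals
    intro x y h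
    rw [Cor.permHom_maps] at h ⊢
    rw [p.2.legs_eq]
    simp [h]

theorem IsInvariant.sharp {F : ∀ c : Cor, TP P Q c} (hF : IsInvariant F) :
    IsInvariant (sharpFam F) := by
  refine .of_perm fun π c => ?_
  rw [sharpFam, map_sum]
  refine Fintype.sum_equiv (Equiv.subtypeEquiv (p := fun x => Handle x c)
    (q := fun x => Handle x (Cor.perm π c)) (Cor.perm π) fun p => handle_perm π) _ _ fun p => ?_
  rw [relabel_handleRaw p.2 ((handle_perm π).1 p.2) (Cor.permHom π p.1), hF]
  · rfl
  · intro x y h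
    rw [Cor.permHom_maps] at h ⊢
    rwa [p.2.legs_eq]

theorem relabel_deltaFam_perm {F : ∀ c : Cor, TP P Q c} (hF : IsInvariant F) (a b : ℕ)
    (π : Equiv.Perm ℕ) (c : Cor) :
    relabel (Cor.permHom π c) (deltaFam a b F c) = deltaFam (π a) (π b) F (Cor.perm π c) := by
  rw [deltaFam, map_sum]
  refine Fintype.sum_equiv (Equiv.subtypeEquiv (p := fun x => SelfGlue a b x c)
    (q := fun x => SelfGlue (π a) (π b) x (Cor.perm π c)) (Cor.perm π)
    fun p => selfGlue_perm π) _ _ fun p => ?_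
  rw [relabel_selfRaw p.2 ((selfGlue_perm π).1 p.2) (Cor.permHom π p.1), hF]
  · rfl
  · exact Cor.permHom_maps.2 ⟨p.2.left, rfl⟩
  · exact Cor.permHom_maps.2 ⟨p.2.right, rfl⟩
  · intro x y h1 h2 h
    rw [Cor.permHom_maps] at h ⊢
    rw [p.2.legs_eq]
    simp [h, h1, h2]

theorem relabel_brFam_perm {F G : ∀ c : Cor, TP P Q c} (hF : IsInvariant F) (hG : IsInvariant G)
    (a b : ℕ) (π : Equiv.Perm ℕ) (c : Cor) :
    relabel (Cor.permHom π c) (brFam a b F G c) = brFam (π a) (π b) F G (Cor.perm π c) := by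
  rw [brFam, map_sum]
  refine Fintype.sum_equiv (((Cor.perm π).prodCongr (Cor.perm π)).subtypeEquiv
    fun p => glue_perm π) _ _ fun p => ?_
  rw [relabel_compRaw p.2 ((glue_perm π).1 p.2) (Cor.permHom π p.1.1) (Cor.permHom π p.1.2),
    hF, hG]
  · rfl
  · exact Cor.permHom_maps.2 ⟨p.2.left, rfl⟩
  · exact Cor.permHom_maps.2 ⟨p.2.right, rfl⟩
  all_goals
    intro x y h1 h
    rw [Cor.permHom_maps] at h ⊢
    rw [p.2.legs_eq]
    simp [h, h1]

/-- On invariant families, `Δ` is equivariant and does not depend on the names of the glued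
labels. -/
theorem relabel_deltaFam {F : ∀ c : Cor, TP P Q c} (hF : IsInvariant F) {c d : Cor}
    (ρ : Cor.Hom c d) {a b a' b' : ℕ} (hab : a ≠ b) (ha : a ∉ c.legs) (hb : b ∉ c.legs)
    (hab' : a' ≠ b') (ha' : a' ∉ d.legs) (hb' : b' ∉ d.legs) :
    relabel ρ (deltaFam a b F c) = deltaFam a' b' F d := by
  obtain ⟨π, rfl, hρ, rfl, rfl⟩ := ρ.exists_perm_eq hab ha hb hab' ha' hb'
  obtain rfl : ρ = Cor.permHom π c := hρ
  exact relabel_deltaFam_perm hF a b π c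

/-- On invariant families, the bracket is equivariant and does not depend on the names of the glued
labels. -/
theorem relabel_brFam {F G : ∀ c : Cor, TP P Q c} (hF : IsInvariant F) (hG : IsInvariant G)
    {c d : Cor} (ρ : Cor.Hom c d) {a b a' b' : ℕ} (hab : a ≠ b) (ha : a ∉ c.legs)
    (hb : b ∉ c.legs) (hab' : a' ≠ b') (ha' : a' ∉ d.legs) (hb' : b' ∉ d.legs) :
    relabel ρ (brFam a b F G c) = brFam a' b' F G d := by
  obtain ⟨π, rfl, hρ, rfl, rfl⟩ := ρ.exists_perm_eq hab ha hb hab' ha' hb'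
  obtain rfl : ρ = Cor.permHom π c := hρ
  exact relabel_brFam_perm hF hG a b π c

theorem brFam_symm {F G : ∀ c : Cor, TP P Q c} (hF : IsInvariant F) (hG : IsInvariant G)
    {c : Cor} {a b : ℕ} (ha : a ∉ c.legs) (hb : b ∉ c.legs) (hab : a ≠ b) :
    brFam b a F G c = brFam a b F G c := by
  rw [← relabel_brFam hF hG (Cor.Hom.id c) hab ha hb hab.symm hb ha, relabel_id]

/-! ### The invariant family of an element of `Fun(P, Q)` -/

/-- The arity `(card C, G)` of a corolla `(C, G)`. -/
def Cor.arity (c : Cor) : Arity := ⟨c.legs.card, c.twoG, c.stable⟩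

/-- The invariant family given by an element `S` of `Fun(P, Q)`: the value at `(C, G)` is the
component of `S` in `(card C, G)`, transported along any bijection `[card C] ≃ C`. -/
def Fun.family (S : Fun P Q) (c : Cor) : TP P Q c :=
  relabel (Cor.arb (c := c.arity.cor) (d := c) (by simp [Cor.arity]) rfl)
    (S c.arity : TP P Q c.arity.cor)

theorem Fun.family_eq (S : Fun P Q) {i : Arity} {c : Cor} (ρ : Cor.Hom i.cor c) :
    S.family c = relabel ρ (S i : TP P Q i.cor) := by
  obtain rfl : i = c.arity := by
    refine Arity.ext ?_ ρ.twoG_eq.symm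
    simpa [Cor.arity] using Finset.card_eq_of_equiv ρ.equiv
  exact relabel_eq _ _ (S _).2

theorem Fun.family_cor (S : Fun P Q) (i : Arity) : S.family i.cor = S i := by
  rw [S.family_eq (Cor.Hom.id i.cor), relabel_id]

theorem Fun.isInvariant_family (S : Fun P Q) : IsInvariant S.family := by
  intro c d ρ
  rw [Fun.family, ← relabel_comp, ← Fun.family_eq]

/-- An invariant family is determined by its values on the corollas `([n], G)`. -/
theorem Fun.family_eq_of_cor (S : Fun P Q) {F : ∀ c : Cor, TP P Q c} {c : Cor}
    (h : relabel (Cor.arb (c := c.arity.cor) (d := c) (by simp [Cor.arity]) rfl) (F c.arity.cor) =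
      F c)
    (h' : (S c.arity : TP P Q c.arity.cor) = F c.arity.cor) : S.family c = F c := by
  rw [Fun.family, h', h]

end Invariant

section FunOps

variable {k : Type u} [Field k] {P : ModularOperadCS.{u, v} k} {Q : OddModularOperadCS.{u, w} k}

/-! ### The operations on `Fun(P, Q)` through families -/

theorem Fun.family_add (S T : Fun P Q) (c : Cor) : (S + T).family c = S.family c + T.family c := by
  simp [Fun.family]

theorem Fun.family_smul (r : k) (S : Fun P Q) (c : Cor) : (r • S).family c = r • S.family c := by
  simp [Fun.family]

theorem Fun.ext_family {S T : Fun P Q} (h : ∀ i : Arity, S.family i.cor = T.family i.cor) :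
    S = T := by
  funext i
  exact Subtype.ext (by rw [← S.family_cor, ← T.family_cor, h])

/-- The product `⋆` on `Fun(P, Q)`. -/
def Fun.star : Fun P Q →ₗ[k] Fun P Q →ₗ[k] Fun P Q :=
  LinearMap.mk₂ k
    (fun S T i => ⟨starFam S.family T.family i.cor,
      fun σ => (S.isInvariant_family.star T.isInvariant_family) σ⟩)
    (fun S S' T => by
      funext i; exact Subtype.ext (by simp [starFam, Fun.family_add, Finset.sum_add_distrib]))
    (fun r S T => by
      funext i; exact Subtype.ext (by simp [starFam, Fun.family_smul, Finset.smul_sum]))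
    (fun S T T' => by
      funext i; exact Subtype.ext (by simp [starFam, Fun.family_add, Finset.sum_add_distrib]))
    (fun r S T => by
      funext i; exact Subtype.ext (by simp [starFam, Fun.family_smul, Finset.smul_sum]))

/-- The operator `♯` on `Fun(P, Q)`. -/
def Fun.sharp : Fun P Q →ₗ[k] Fun P Q where
  toFun S i := ⟨sharpFam S.family i.cor, fun σ => S.isInvariant_family.sharp σ⟩
  map_add' S T := by
    funext i; exact Subtype.ext (by simp [sharpFam, Fun.family_add, Finset.sum_add_distrib])
  map_smul' r S := by
    funext i; exact Subtype.ext (by simp [sharpFam, Fun.family_smul, Finset.smul_sum])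

theorem Fun.family_star (S T : Fun P Q) : (star S T).family = starFam S.family T.family :=
  funext fun _ => Fun.family_eq_of_cor _ ((S.isInvariant_family.star T.isInvariant_family) _) rfl

theorem Fun.family_sharp (S : Fun P Q) : (sharp S).family = sharpFam S.family :=
  funext fun _ => Fun.family_eq_of_cor _ (S.isInvariant_family.sharp _) rfl

theorem Fun.family_d (S : Fun P Q) : (Fun.d S).family = fun c => dRaw (S.family c) :=
  funext fun _ => Fun.family_eq_of_cor _ (F := fun c => dRaw (S.family c))
    (by rw [relabel_dRaw, S.isInvariant_family]) (by rw [S.family_cor]; rfl)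

theorem Fun.coe_delta (S : Fun P Q) (l : Arity) :
    (Fun.delta S l : TP P Q l.cor) = deltaFam (l.n + 1) (l.n + 2) S.family l.cor := by
  rw [deltaFam]
  by_cases h : 2 ≤ l.g
  · let i : Arity := ⟨l.n + 2, l.g - 2, by have := l.stable; omega⟩
    have hs : SelfGlue (l.n + 1) (l.n + 2) i.cor l.cor :=
      ⟨by omega, by simp [i], by simp [i], by ext x; simp [i]; omega, by simp only [i]; omega⟩
    rw [Fintype.sum_eq_single (⟨i.cor, hs⟩ : SelfGlue.Source _ _ _)
      fun x hx => (hx (Subtype.ext (x.2.unique_source hs))).elim, S.family_cor]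
    rw [Fun.delta, dif_pos h]
    rfl
  · rw [Fun.delta, dif_neg h]
    refine (Finset.sum_eq_zero fun x _ => (h ?_).elim).symm
    have := x.2.twoG_eq
    dsimp only at this
    omega

theorem Fun.family_delta (S : Fun P Q) {c : Cor} {a b : ℕ} (hab : a ≠ b) (ha : a ∉ c.legs)
    (hb : b ∉ c.legs) : (Fun.delta S).family c = deltaFam a b S.family c := by
  rw [Fun.family, Fun.coe_delta]
  exact relabel_deltaFam S.isInvariant_family _ (by omega) (by simp) (by simp) hab ha hb

theorem dite_eq_sum_plift {M : Type*} [AddCommMonoid M] {p : Prop} [Decidable p] (f : p → M) :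
    (if h : p then f h else 0) = ∑ h : PLift p, f h.down := by
  by_cases h : p
  · rw [dif_pos h, Fintype.sum_eq_single (⟨h⟩ : PLift p) fun x hx => (hx rfl).elim]
  · rw [dif_neg h]
    exact (Finset.sum_eq_zero fun x _ => (h x.down).elim).symm

theorem coe_brComp {i j l : Arity} {n₁ n₂ : ℕ} (hi : i.n = n₁ + 1) (hj : j.n = n₂ + 1)
    (hn : l.n = n₁ + n₂) (hg : l.g = i.g + j.g) (S T : Fun P Q)
    (hS : ∀ i : Arity, sgnRaw (S i : TP P Q i.cor) = S i) :
    (brComp hi hj hn hg (S i) (T j) : TP P Q l.cor) = (2 : k) • ∑ C : Decomp n₁ l.n,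
      compRaw (C.glue hi hj hn hg) (S.family (C.fstPt hi)) (T.family (C.sndPt hj hn)) := by
  change (2 : k) • ∑ C : Decomp n₁ l.n, compRaw (C.glue hi hj hn hg)
    (relabel (C.θPt₁ hi) (sgnRaw (S i : TP P Q i.cor)))
    (relabel (C.θPt₂ hj hn) (T j : TP P Q j.cor)) = _
  simp only [hS, ← Fun.family_eq]

/-- The decompositions of `[n]` in the definition of the bracket correspond to the pairs of corollas
whose gluing is `([n], G)`. -/
theorem Fun.coe_bracket (S T : Fun P Q) (hS : ∀ i : Arity, sgnRaw (S i : TP P Q i.cor) = S i)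
    (l : Arity) : (Fun.bracket S T l : TP P Q l.cor) =
      (2 : k) • brFam (l.n + 1) (l.n + 2) S.family T.family l.cor := by
  have e : (Fun.bracket S T l : TP P Q l.cor) = (2 : k) •
      ∑ p : ↥(Finset.HasAntidiagonal.antidiagonal l.n),
        ∑ q : ↥(Finset.HasAntidiagonal.antidiagonal l.g),
          ∑ h : PLift (2 < q.1.1 + (p.1.1 + 1) ∧ 2 < q.1.2 + (p.1.2 + 1)),
            ∑ C : Decomp p.1.1 l.n, compRaw (P := P) (Q := Q)
              (C.glue (i := ⟨p.1.1 + 1, q.1.1, h.down.1⟩) (j := ⟨p.1.2 + 1, q.1.2, h.down.2⟩)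
                rfl rfl (Finset.HasAntidiagonal.mem_antidiagonal.1 p.2).symm
                (Finset.HasAntidiagonal.mem_antidiagonal.1 q.2).symm)
              (S.family (C.fstPt (i := ⟨p.1.1 + 1, q.1.1, h.down.1⟩) rfl))
              (T.family (C.sndPt (j := ⟨p.1.2 + 1, q.1.2, h.down.2⟩) rfl
                (Finset.HasAntidiagonal.mem_antidiagonal.1 p.2).symm)) := by
    simp only [Fun.bracket, dite_eq_sum_plift, AddSubmonoidClass.coe_finsetSum, Finset.smul_sum]
    refine Finset.sum_congr rfl fun p _ => Finset.sum_congr rfl fun q _ =>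
      Finset.sum_congr rfl fun h _ => ?_
    rw [coe_brComp _ _ _ _ S T hS, Finset.smul_sum]
  rw [e, brFam]
  congr 1
  simp only [Finset.univ_sigma_univ, Finset.sum_sigma']
  refine Finset.sum_bij (fun s _ => ⟨(s.2.2.2.fstPt (i := ⟨s.1.1.1 + 1, s.2.1.1.1, s.2.2.1.down.1⟩)
      rfl, s.2.2.2.sndPt (j := ⟨s.1.1.2 + 1, s.2.1.1.2, s.2.2.1.down.2⟩) rfl
        (Finset.HasAntidiagonal.mem_antidiagonal.1 s.1.2).symm), s.2.2.2.glue rfl rfl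
        (Finset.HasAntidiagonal.mem_antidiagonal.1 s.1.2).symm
        (Finset.HasAntidiagonal.mem_antidiagonal.1 s.2.1.2).symm⟩)
    (fun _ _ => Finset.mem_univ _) ?_ ?_ ?_
  · rintro ⟨⟨⟨p, p'⟩, hp⟩, ⟨⟨q, q'⟩, hq⟩, ⟨h⟩, ⟨C, hC⟩⟩ -
      ⟨⟨⟨r, r'⟩, hr⟩, ⟨⟨s, s'⟩, hs⟩, ⟨h'⟩, ⟨C', hC'⟩⟩ - heq
    rw [Subtype.mk.injEq, Prod.mk.injEq] at heq
    have h1 := congrArg Cor.legs heq.1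
    obtain rfl : q = s := congrArg Cor.twoG heq.1
    obtain rfl : q' = s' := congrArg Cor.twoG heq.2
    have n1 : l.n + 1 ∉ C := Decomp.notMem ⟨C, hC⟩ (Nat.lt_succ_self _)
    have n2 : l.n + 1 ∉ C' := Decomp.notMem ⟨C', hC'⟩ (Nat.lt_succ_self _)
    simp only [Decomp.fstPt] at h1
    obtain rfl : C = C' := by
      rw [← Finset.erase_insert n1, h1, Finset.erase_insert n2]
    obtain rfl : p = r :=
      (Finset.mem_powersetCard.1 hC).2.symm.trans (Finset.mem_powersetCard.1 hC').2
    obtain rfl : p' = r' := by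
      rw [Finset.HasAntidiagonal.mem_antidiagonal] at hp hr
      dsimp only at hp hr
      omega
    rfl
  · rintro ⟨⟨x, y⟩, h⟩ -
    have h1 := h.legs_eq; have h2 := h.disj; have h3 := h.left; have h4 := h.right
    have h5 := h.twoG_eq
    dsimp only at h1 h2 h3 h4 h5
    have h6 := Finset.disjoint_left.1 h2
    have c1 : (x.legs.erase (l.n + 1)).card + (y.legs.erase (l.n + 2)).card = l.n := by
      rw [← Finset.card_union_of_disjoint
        (h2.mono (Finset.erase_subset _ _) (Finset.erase_subset _ _)), ← h1]
      simp
    have c2 := Finset.card_erase_add_one h3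
    have c3 := Finset.card_erase_add_one h4
    have s1 := x.stable
    have s2 := y.stable
    refine ⟨⟨⟨(_, _), Finset.HasAntidiagonal.mem_antidiagonal.2 c1⟩,
      ⟨(x.twoG, y.twoG), Finset.HasAntidiagonal.mem_antidiagonal.2 h5.symm⟩,
      ⟨⟨by change 2 < x.twoG + ((x.legs.erase (l.n + 1)).card + 1); omega,
        by change 2 < y.twoG + ((y.legs.erase (l.n + 2)).card + 1); omega⟩⟩,
      ⟨x.legs.erase (l.n + 1), Finset.mem_powersetCard.2 ⟨?_, rfl⟩⟩⟩, Finset.mem_univ _, ?_⟩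
    · rw [h1]; exact Finset.subset_union_left
    · refine Subtype.ext (Prod.ext (Cor.ext ?_ rfl) (Cor.ext ?_ rfl))
      · exact Finset.insert_erase h3
      · simp only [Decomp.sndPt]
        rw [h1, Finset.union_sdiff_cancel_left
          (h2.mono (Finset.erase_subset _ _) (Finset.erase_subset _ _)), Finset.insert_erase h4]
  · intro s _
    rfl

theorem Fun.family_bracket (S T : Fun P Q) (hS : ∀ i : Arity, sgnRaw (S i : TP P Q i.cor) = S i)
    {c : Cor} {a b : ℕ} (hab : a ≠ b) (ha : a ∉ c.legs) (hb : b ∉ c.legs) :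
    (Fun.bracket S T).family c = (2 : k) • brFam a b S.family T.family c := by
  rw [Fun.family, Fun.coe_bracket S T hS, map_smul]
  congr 1
  exact relabel_brFam S.isInvariant_family T.isInvariant_family _ (by omega) (by simp) (by simp)
    hab ha hb

/-- The pairs of arities whose `⋆`-products have arity `l`. -/
abbrev StarPair (l : Arity) :=
  {p : Arity × Arity // l.n = p.1.n + p.2.n ∧ l.g = p.1.g + p.2.g + 2}

theorem Arity.finite_le (n g : ℕ) : {i : Arity | i.n ≤ n ∧ i.g ≤ g}.Finite := by
  refine Set.Finite.of_injOn (f := fun i : Arity => (i.n, i.g))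
    (t := ↑(Finset.range (n + 1) ×ˢ Finset.range (g + 1))) (fun i hi => ?_) (fun i _ j _ h => ?_)
    (Finset.finite_toSet _)
  · simpa [Nat.lt_succ_iff] using hi
  · exact Arity.ext (congrArg Prod.fst h) (congrArg Prod.snd h)

instance StarPair.finite (l : Arity) : Finite (StarPair l) := by
  refine ((Arity.finite_le l.n l.g).prod (Arity.finite_le l.n l.g)).subset fun p hp => ?_
  have h1 := hp.1
  have h2 := hp.2
  exact ⟨⟨by omega, by omega⟩, ⟨by omega, by omega⟩⟩

instance StarPair.fintype (l : Arity) : Fintype (StarPair l) := Fintype.ofFinite _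

theorem coe_starComp {i j l : Arity} (hn : l.n = i.n + j.n) (hg : l.g = i.g + j.g + 2)
    (S T : Fun P Q) :
    (starComp hn hg (S i) (T j) : TP P Q l.cor) = ∑ C : Decomp i.n l.n,
      csumRaw (C.connSum hn hg) (S.family C.fst) (T.family (C.snd hn)) := by
  change ∑ C : Decomp i.n l.n, csumRaw (C.connSum hn hg)
    (relabel C.θ₁ (S i : TP P Q i.cor)) (relabel (C.θ₂ hn) (T j : TP P Q j.cor)) = _
  simp only [← Fun.family_eq]

/-- The components of `⋆` in terms of the componentwise product: decompositions of `[n]` correspond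
to the pairs of corollas with connected sum `([n], G)`. -/
theorem Fun.star_apply (S T : Fun P Q) (l : Arity) :
    star S T l = ∑ p : StarPair l, starComp p.2.1 p.2.2 (S p.1.1) (T p.1.2) := by
  refine Subtype.ext ?_
  change starFam S.family T.family l.cor = _
  simp only [AddSubmonoidClass.coe_finsetSum, coe_starComp, starFam]
  simp only [Finset.univ_sigma_univ, Finset.sum_sigma']
  refine (Finset.sum_bij (fun s _ => ⟨(s.2.fst, s.2.snd s.1.2.1), s.2.connSum s.1.2.1 s.1.2.2⟩)
    (fun _ _ => Finset.mem_univ _) ?_ ?_ ?_).symm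
  · rintro ⟨⟨⟨i, j⟩, hp⟩, ⟨C, hC⟩⟩ - ⟨⟨⟨i', j'⟩, hp'⟩, ⟨C', hC'⟩⟩ - heq
    rw [Subtype.mk.injEq, Prod.mk.injEq] at heq
    obtain rfl : C = C' := congrArg Cor.legs heq.1
    have h1 := (Finset.mem_powersetCard.1 hC).2
    have h2 := (Finset.mem_powersetCard.1 hC').2
    have h3 := hp.1
    have h4 := hp'.1
    dsimp only at h1 h2 h3 h4
    obtain rfl : i = i' := Arity.ext (by omega) (congrArg Cor.twoG heq.1)
    obtain rfl : j = j' := Arity.ext (by omega) (congrArg Cor.twoG heq.2)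
    rfl
  · rintro ⟨⟨x, y⟩, h⟩ -
    have h1 := h.legs_eq; have h2 := h.disj; have h5 := h.twoG_eq
    dsimp only at h1 h2 h5
    refine ⟨⟨⟨(x.arity, y.arity), ?_, h5⟩, ⟨x.legs, Finset.mem_powersetCard.2 ⟨?_, rfl⟩⟩⟩,
      Finset.mem_univ _, Subtype.ext (Prod.ext rfl (Cor.ext ?_ rfl))⟩
    · simp only [Cor.arity]
      rw [← Finset.card_union_of_disjoint h2, ← h1]
      simp
    · rw [h1]; exact Finset.subset_union_left
    · simp only [Decomp.snd]
      rw [h1, Finset.union_sdiff_cancel_left h2]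
  · intro s _
    rfl

/-! ### `Fun(P, Q)` as a Batalin–Vilkovisky algebra up to `♯` -/

/-- Even elements, i.e. those fixed by the parity operator. -/
def Fun.IsEven (S : Fun P Q) : Prop := ∀ i : Arity, sgnRaw (S i : TP P Q i.cor) = S i

theorem Fun.IsDegreeZero.isEven {S : Fun P Q} (hS : S.IsDegreeZero) : S.IsEven :=
  fun i => sgnRaw_of_mem_tensorDeg (hS i)

theorem Fun.IsEven.family {S : Fun P Q} (hS : S.IsEven) (c : Cor) :
    sgnRaw (S.family c) = S.family c := by
  rw [Fun.family, ← relabel_sgnRaw, hS]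

theorem Fun.star_comm [CharZero k] {S : Fun P Q} (hS : S.IsEven) (T : Fun P Q) :
    star S T = star T S := by
  refine Fun.ext_family fun i => ?_
  rw [Fun.family_star, Fun.family_star, starFam_comm hS.family]

theorem Fun.star_assoc (S T U : Fun P Q) : star S (star T U) = star (star S T) U := by
  refine Fun.ext_family fun i => ?_
  simp only [Fun.family_star, starFam_assoc]

theorem Fun.sharp_star (S T : Fun P Q) : sharp (star S T) = star (sharp S) T := by
  refine Fun.ext_family fun i => ?_
  simp only [Fun.family_star, Fun.family_sharp, sharpFam_starFam]

theorem Fun.d_star {S : Fun P Q} (hS : S.IsEven) (T : Fun P Q) :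
    Fun.d (star S T) = star (Fun.d S) T + star S (Fun.d T) := by
  refine Fun.ext_family fun i => ?_
  simp only [Fun.family_add, Fun.family_d, Fun.family_star, dRaw_starFam hS.family]

/-- `Δ` is an operator of second order with respect to `⋆`. The two mixed terms of
`deltaFam_starFam` agree, which accounts for the factor `2` in the bracket. -/
theorem Fun.delta_star [CharZero k] {S : Fun P Q} (hS : S.IsEven) (T : Fun P Q) :
    Fun.delta (star S T) =
      star (Fun.delta S) T + star S (Fun.delta T) + sharp (Fun.bracket S T) := by
  refine Fun.ext_family fun i => ?_
  have hab : i.n + 1 ≠ i.n + 2 := by omega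
  have sub : ∀ {x : Cor}, x.legs ⊆ i.cor.legs → i.n + 1 ∉ x.legs ∧ i.n + 2 ∉ x.legs :=
    fun {x} hx => ⟨fun h => by simpa using hx h, fun h => by simpa using hx h⟩
  have h := sub (Finset.Subset.refl i.cor.legs)
  have hd : ∀ (U : Fun P Q) (x : Cor), x.legs ⊆ i.cor.legs →
      (Fun.delta U).family x = deltaFam (i.n + 1) (i.n + 2) U.family x :=
    fun U x hx => U.family_delta hab (sub hx).1 (sub hx).2
  rw [star_comm hS (Fun.delta T), Fun.family_add, Fun.family_add, Fun.family_star,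
    Fun.family_star, Fun.family_sharp, Fun.family_delta _ hab h.1 h.2, Fun.family_star,
    deltaFam_starFam hS.family _ h.1 h.2]
  refine congrArg₂ _ (congrArg₂ _ ?_ ?_) ?_
  · exact starFam_congr (fun x hx => (hd S x hx).symm) fun _ _ => rfl
  · exact starFam_congr (fun x hx => (hd T x hx).symm) fun _ _ => rfl
  · rw [sharpFam, sharpFam, ← Finset.sum_add_distrib]
    refine Finset.sum_congr rfl fun x _ => ?_
    have hx := sub (x := x.1) x.2.legs_eq.symm.subset
    rw [brFam_symm S.isInvariant_family T.isInvariant_family hx.1 hx.2 hab,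
      Fun.family_bracket S T hS hab hx.1 hx.2, two_smul, map_add]

/-- The bracket is a derivation of `⋆`. -/
theorem Fun.bracket_star [CharZero k] {S : Fun P Q} (hS : S.IsEven) (T : Fun P Q) {U : Fun P Q}
    (hU : U.IsEven) :
    Fun.bracket S (star T U) = star (Fun.bracket S T) U + star (Fun.bracket S U) T := by
  refine Fun.ext_family fun i => ?_
  have hab : i.n + 1 ≠ i.n + 2 := by omega
  have sub : ∀ {x : Cor}, x.legs ⊆ i.cor.legs → i.n + 1 ∉ x.legs ∧ i.n + 2 ∉ x.legs :=
    fun {x} hx => ⟨fun h => by simpa using hx h, fun h => by simpa using hx h⟩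
  have h := sub (Finset.Subset.refl i.cor.legs)
  have hbr : ∀ V W : Fun P Q, starFam (Fun.bracket S V).family W.family i.cor =
      (2 : k) • starFam (brFam (i.n + 1) (i.n + 2) S.family V.family) W.family i.cor := by
    intro V W
    rw [starFam_congr (F' := fun x => (2 : k) • brFam (i.n + 1) (i.n + 2) S.family V.family x)
      (fun x hx => Fun.family_bracket S V hS hab (sub hx).1 (sub hx).2) fun _ _ => rfl]
    simp only [starFam, map_smul, LinearMap.smul_apply, Finset.smul_sum]
  rw [Fun.family_add, Fun.family_star, Fun.family_star, hbr, hbr,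
    Fun.family_bracket S _ hS hab h.1 h.2, Fun.family_star,
    brFam_starFam _ _ hU.family h.1 h.2, smul_add]

/-! ### Powers -/

/-- `A ⋆ S ⋆ … ⋆ S` with `n` factors `S`; the power `S ^ (n + 1)` is `Fun.starPow S S n`. -/
def Fun.starPow (S A : Fun P Q) : ℕ → Fun P Q
  | 0 => A
  | n + 1 => star (starPow S A n) S

theorem Fun.star_starPow (S A : Fun P Q) (n : ℕ) :
    star A (starPow S S n) = starPow S A (n + 1) := by
  induction n with
  | zero => rfl
  | succ n ih => rw [starPow, star_assoc, ih]; rfl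

theorem Fun.starPow_add (S A B : Fun P Q) (n : ℕ) :
    starPow S (A + B) n = starPow S A n + starPow S B n := by
  induction n with
  | zero => rfl
  | succ n ih => rw [starPow, ih, map_add]; rfl

theorem Fun.starPow_smul (S : Fun P Q) (r : k) (A : Fun P Q) (n : ℕ) :
    starPow S (r • A) n = r • starPow S A n := by
  induction n with
  | zero => rfl
  | succ n ih => rw [starPow, ih, map_smul]; rfl

/-- `{S, S ^ (n + 1)} = (n + 1) {S, S} ⋆ S ^ n`. -/
theorem Fun.bracket_starPow [CharZero k] {S : Fun P Q} (hS : S.IsEven) (n : ℕ) :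
    Fun.bracket S (starPow S S n) = ((n : k) + 1) • starPow S (Fun.bracket S S) n := by
  induction n with
  | zero => simp [starPow]
  | succ n ih =>
    rw [starPow, bracket_star hS _ hS, ih, star_starPow, map_smul, LinearMap.smul_apply]
    change ((n : k) + 1) • starPow S (Fun.bracket S S) (n + 1) + _ = _
    push_cast
    module

/-- `(d + Δ) S ^ (n + 2) = (n + 2) (d + Δ) S ⋆ S ^ (n + 1) + C(n + 2, 2) ♯ {S, S} ⋆ S ^ n`. -/
theorem Fun.d_add_delta_starPow [CharZero k] {S : Fun P Q} (hS : S.IsEven) (n : ℕ) :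
    Fun.d (starPow S S (n + 1)) + Fun.delta (starPow S S (n + 1)) =
      ((n : k) + 2) • starPow S (Fun.d S + Fun.delta S) (n + 1) +
        (((n : k) + 2) * ((n : k) + 1) / 2) • sharp (starPow S (Fun.bracket S S) n) := by
  have step : ∀ n, Fun.d (starPow S S (n + 1)) + Fun.delta (starPow S S (n + 1)) =
      starPow S (Fun.d S + Fun.delta S) (n + 1) +
        star (Fun.d (starPow S S n) + Fun.delta (starPow S S n)) S +
        ((n : k) + 1) • sharp (starPow S (Fun.bracket S S) n) := by
    intro n
    rw [← star_starPow S S n, d_star hS, delta_star hS, bracket_starPow hS, map_smul,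
      ← star_starPow, ← star_comm hS, map_add, map_add, LinearMap.add_apply]
    abel
  induction n with
  | zero =>
    rw [step]
    simp only [starPow, Nat.cast_zero, zero_add, one_smul, two_smul, mul_one]
    rw [div_self two_ne_zero, one_smul]
  | succ n ih =>
    rw [step, ih, map_add, LinearMap.add_apply, map_smul, map_smul, LinearMap.smul_apply,
      LinearMap.smul_apply, ← sharp_star]
    change _ + (_ • starPow S _ (n + 1 + 1) + _ • sharp (starPow S _ (n + 1))) + _ = _
    push_cast
    module

end FunOps

section Embed

variable {k : Type u} [Field k] {P : ModularOperadCS.{u, v} k} {Q : OddModularOperadCS.{u, w} k}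

/-! ### The embeddings `S ↦ S ⊗ ϰ^q` -/

/-- The arities `(n, G)` for which `Fun(P, Q)(n, G) ⊗ ϰ^q` has weight `W/2`. -/
abbrev WArity (q W : ℤ) := {i : Arity // (i.n : ℤ) + i.g + 4 * q + 2 = W}

instance WArity.finite (q W : ℤ) : Finite (WArity q W) := by
  refine (Arity.finite_le (W - 4 * q).toNat (W - 4 * q).toNat).subset fun i hi => ?_
  replace hi : (i.n : ℤ) + i.g + 4 * q + 2 = W := hi
  exact ⟨by omega, by omega⟩

instance WArity.fintype (q W : ℤ) : Fintype (WArity q W) := Fintype.ofFinite _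

/-- The index of the summand `Fun(P, Q)(n, G) ⊗ ϰ^q`. -/
abbrev WArity.idx {q W : ℤ} (i : WArity q W) : WIdx W := ⟨i.1, q, i.2⟩

/-- The component of weight `W/2` of `S ⊗ ϰ^q`. -/
def embedW (q W : ℤ) : Fun P Q →ₗ[k] FW P Q W :=
  ∑ i : WArity q W, FW.of i.idx ∘ₗ LinearMap.proj i.1

theorem embedW_apply (q W : ℤ) (S : Fun P Q) :
    embedW q W S = ∑ i : WArity q W, FW.of i.idx (S i.1) := by
  simp [embedW, LinearMap.sum_apply]

theorem embed_apply (q : ℤ) (S : Fun P Q) (W : {W : ℤ // 1 ≤ W}) :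
    embed q S W = embedW q W.1 S := by
  simp only [embedW_apply, embed, dite_eq_sum_plift]
  rw [Finset.sum_sigma']
  refine Finset.sum_bij (fun s _ => ⟨⟨s.1.1, s.1.2, s.2.down.1⟩, s.2.down.2⟩)
    (fun _ _ => Finset.mem_univ _) ?_ ?_ ?_
  · rintro ⟨⟨n, g⟩, ⟨h⟩⟩ - ⟨⟨n', g'⟩, ⟨h'⟩⟩ - heq
    have h1 := congrArg (fun i => i.1.n) heq
    have h2 := congrArg (fun i => i.1.g) heq
    dsimp only at h1 h2
    subst h1 h2
    rfl
  · rintro ⟨⟨n, g, hs⟩, h⟩ -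
    refine ⟨⟨(n, g), ⟨hs, h⟩⟩, ?_, rfl⟩
    dsimp only at h
    simp only [Finset.mem_sigma, Finset.HasAntidiagonal.mem_antidiagonal, Finset.mem_univ,
      and_true]
    omega
  · intro s _
    rfl

theorem dW_embedW (q W : ℤ) (S : Fun P Q) : dW W (embedW q W S) = embedW q W (Fun.d S) := by
  simp only [embedW_apply, map_sum]
  exact Finset.sum_congr rfl fun i _ => dW_of i.idx (S i.1)

theorem deltaW_embedW (q W : ℤ) (S : Fun P Q) :
    deltaW W (embedW q W S) = embedW q W (Fun.delta S) := by
  have e1 : ∀ i : WArity q W, deltaW W (FW.of i.idx (S i.1)) = ∑ h : PLift (2 ≤ i.1.n),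
      FW.of (i.idx.delta h.down)
        (deltaComp (l := (i.idx.delta h.down).arity) (by have := h.down; simp only; omega) rfl
          (S i.1)) := by
    intro i
    by_cases h : 2 ≤ i.1.n
    · rw [deltaW_of i.idx h, Fintype.sum_eq_single (⟨h⟩ : PLift _) fun x hx => (hx rfl).elim]
    · rw [deltaW_of_not i.idx h]
      exact (Finset.sum_eq_zero fun x _ => (h x.down).elim).symm
  simp only [embedW_apply, map_sum, e1, Fun.delta, dite_eq_sum_plift]
  rw [Finset.sum_sigma', Finset.sum_sigma']
  refine Finset.sum_bij (fun s _ =>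
    ⟨⟨(s.1.idx.delta s.2.down).arity, (s.1.idx.delta s.2.down).weight⟩, ⟨by simp⟩⟩)
      (fun _ _ => by simp) ?_ ?_ ?_
  · rintro ⟨⟨⟨n, g, hs⟩, h⟩, ⟨hn⟩⟩ - ⟨⟨⟨n', g', hs'⟩, h'⟩, ⟨hn'⟩⟩ - heq
    have h1 := congrArg (fun s => s.1.1.n) heq
    have h2 := congrArg (fun s => s.1.1.g) heq
    dsimp only at h1 h2 hn hn'
    obtain rfl : n = n' := by omega
    obtain rfl : g = g' := by omega
    rfl
  · rintro ⟨⟨⟨n, g, hs⟩, h⟩, ⟨hg⟩⟩ -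
    obtain ⟨g, rfl⟩ : ∃ m, g = m + 2 := ⟨g - 2, by dsimp only at hg; omega⟩
    refine ⟨⟨⟨⟨n + 2, g, by omega⟩, ?_⟩, ⟨by simp⟩⟩, by simp, rfl⟩
    dsimp only at h ⊢
    push_cast at h ⊢
    omega
  · rintro ⟨⟨⟨n, g, hs⟩, h⟩, ⟨hn⟩⟩ -
    obtain ⟨n, rfl⟩ : ∃ m, n = m + 2 := ⟨n - 2, by dsimp only at hn; omega⟩
    rfl

/-- The arities `(n, G - 2)`, of which there is at most one. -/
abbrev SharpSource (l : Arity) := {i : Arity // l.n = i.n ∧ l.g = i.g + 4}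

instance SharpSource.finite (l : Arity) : Finite (SharpSource l) := by
  refine @Finite.of_subsingleton _ ⟨fun i j => Subtype.ext (Arity.ext ?_ ?_)⟩
  · have := i.2.1; have := j.2.1; omega
  · have := i.2.2; have := j.2.2; omega

instance SharpSource.fintype (l : Arity) : Fintype (SharpSource l) := Fintype.ofFinite _

theorem Fun.sharp_apply (S : Fun P Q) (l : Arity) :
    Fun.sharp S l = ∑ i : SharpSource l, sharpComp i.2.1 i.2.2 (S i.1) := by
  refine Subtype.ext ?_
  change sharpFam S.family l.cor = _
  simp only [AddSubmonoidClass.coe_finsetSum, sharpFam]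
  refine (Finset.sum_bij (fun i _ => (⟨i.1.cor, by simp [i.2.1], i.2.2⟩ : Handle.Source l.cor))
    (fun _ _ => Finset.mem_univ _) ?_ ?_ ?_).symm
  · rintro ⟨i, h⟩ - ⟨i', h'⟩ - _
    refine Subtype.ext (Arity.ext (h.1.symm.trans h'.1) ?_)
    have h1 : l.g = i.g + 4 := h.2
    have h2 : l.g = i'.g + 4 := h'.2
    change i.g = i'.g
    omega
  · rintro ⟨x, h⟩ -
    have h1 := h.legs_eq
    have h2 := h.twoG_eq
    dsimp only at h1 h2
    refine ⟨⟨⟨l.n, x.twoG, ?_⟩, rfl, h2⟩, Finset.mem_univ _, Subtype.ext (Cor.ext h1 rfl)⟩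
    have := x.stable
    rw [← h1] at this
    simpa using this
  · intro i _
    rw [S.family_cor]
    rfl

/-- On `S ⊗ ϰ^q`, the map `♯ - ϰ` is `♯ S ⊗ ϰ^q - S ⊗ ϰ^(q + 1)`. -/
theorem relW_embedW {W W' : ℤ} (hW : W' = W + 4) (q : ℤ) (S : Fun P Q) :
    relW hW (embedW q W S) = embedW q W' (Fun.sharp S) - embedW (q + 1) W' S := by
  have e1 : relW hW (embedW q W S) = ∑ i : WArity q W,
      (FW.of (i.idx.sharp hW) (sharpComp (i := i.1) (l := (i.idx.sharp hW).arity) rfl rfl (S i.1)) -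
        FW.of (i.idx.kappa hW) (S i.1)) := by
    rw [embedW_apply, map_sum]
    exact Finset.sum_congr rfl fun i _ => relW_of hW i.idx (S i.1)
  rw [e1, embedW_apply, embedW_apply, Finset.sum_sub_distrib]
  simp only [Fun.sharp_apply, map_sum]
  congr 1
  · rw [Finset.sum_sigma']
    refine Finset.sum_bij (fun i _ => ⟨⟨(i.idx.sharp hW).arity, (i.idx.sharp hW).weight⟩,
      ⟨i.1, rfl, rfl⟩⟩) (fun _ _ => by simp) ?_ ?_ ?_
    · rintro i - i' - heq
      exact Subtype.ext (congrArg (fun s => (s.2.1 : Arity)) heq)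
    · rintro ⟨⟨⟨n, g, hs⟩, h⟩, ⟨i, hi⟩⟩ -
      obtain ⟨n', g', hs'⟩ := i
      obtain ⟨h1, h2⟩ := hi
      dsimp only at h1 h2 h
      subst h1 h2
      exact ⟨⟨⟨n, g', hs'⟩, by push_cast at h ⊢; omega⟩, Finset.mem_univ _, rfl⟩
    · intro i _
      rfl
  · refine Finset.sum_bij (fun i _ => ⟨i.1, by have := i.2; omega⟩) (fun _ _ => by simp) ?_ ?_ ?_
    · rintro i - i' - heq
      exact Subtype.ext (congrArg (fun s => (s.1 : Arity)) heq)
    · rintro ⟨i, h⟩ -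
      exact ⟨⟨i, by omega⟩, Finset.mem_univ _, rfl⟩
    · intro i _
      rfl

/-- `(S ⊗ ϰ^q₁) ⋆ (T ⊗ ϰ^q₂) = (S ⋆ T) ⊗ ϰ^(q₁ + q₂)`. The hypotheses say that both factors lie in
weights at least `1/2`, as `embed` drops the components of smaller weight. -/
theorem starGe_embed {q₁ q₂ : ℤ} {S T : Fun P Q}
    (hS : ∀ i : Arity, (i.n : ℤ) + i.g + 4 * q₁ + 2 < 1 → S i = 0)
    (hT : ∀ i : Arity, (i.n : ℤ) + i.g + 4 * q₂ + 2 < 1 → T i = 0) :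
    starGe (embed q₁ S) (embed q₂ T) = embed (q₁ + q₂) (Fun.star S T) := by
  funext W
  change ∑ V : ↥(Finset.Icc (1 : ℤ) (W.1 - 1)),
      starW (W₁ := V.1) (W₂ := W.1 - V.1) (by omega) (embed q₁ S ⟨V.1, (Finset.mem_Icc.1 V.2).1⟩)
        (embed q₂ T ⟨W.1 - V.1, by have := (Finset.mem_Icc.1 V.2).2; omega⟩) = _
  have e1 : ∀ {W₁ W₂ : ℤ} (h : W₁ + W₂ = W.1), starW h (embedW q₁ W₁ S) (embedW q₂ W₂ T) =
      ∑ i : WArity q₁ W₁, ∑ j : WArity q₂ W₂, FW.of (WIdx.star h i.idx j.idx)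
        (starComp (i := i.1) (j := j.1) (l := (WIdx.star h i.idx j.idx).arity) rfl rfl
          (S i.1) (T j.1)) := by
    intro W₁ W₂ h
    rw [embedW_apply, map_sum, LinearMap.sum_apply]
    refine Finset.sum_congr rfl fun i _ => ?_
    rw [embedW_apply, map_sum]
    exact Finset.sum_congr rfl fun j _ => starW_of h i.idx j.idx _ _
  simp only [embed_apply, e1]
  simp only [embedW_apply, Fun.star_apply, map_sum]
  simp only [Finset.univ_sigma_univ, Finset.sum_sigma']
  refine Finset.sum_of_injOn (fun s =>
    ⟨⟨(WIdx.star (W := W.1) (by omega) s.2.1.idx s.2.2.idx).arity,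
    (WIdx.star (W := W.1) (by omega) s.2.1.idx s.2.2.idx).weight⟩, ⟨(s.2.1.1, s.2.2.1), rfl, rfl⟩⟩)
    ?_ (fun _ _ => by simp) ?_ ?_
  · rintro ⟨⟨V, hV⟩, ⟨i, hi⟩, ⟨j, hj⟩⟩ - ⟨⟨V', hV'⟩, ⟨i', hi'⟩, ⟨j', hj'⟩⟩ - heq
    have h1 := congrArg (fun s => (s.2.1.1 : Arity)) heq
    have h2 := congrArg (fun s => (s.2.1.2 : Arity)) heq
    dsimp only at h1 h2 hi hi'
    subst h1 h2 hi
    subst hi'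
    rfl
  · rintro ⟨⟨l, hl⟩, ⟨⟨i, j⟩, hij⟩⟩ - hnot
    dsimp only at hl hij ⊢
    by_cases h1 : (i.n : ℤ) + i.g + 4 * q₁ + 2 < 1
    · rw [hS i h1]; simp
    by_cases h2 : (j.n : ℤ) + j.g + 4 * q₂ + 2 < 1
    · rw [hT j h2]; simp
    refine (hnot ?_).elim
    obtain ⟨n, g, hs⟩ := l
    obtain ⟨h3, h4⟩ := hij
    dsimp only at h3 h4 hl
    subst h3 h4
    push_cast at hl
    refine ⟨⟨⟨(i.n : ℤ) + i.g + 4 * q₁ + 2, Finset.mem_Icc.2 ⟨by omega, by omega⟩⟩,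
      ⟨i, rfl⟩, ⟨j, by dsimp only; omega⟩⟩, by simp, rfl⟩
  · intro s _
    rfl

end Embed

section MasterEquation

variable {k : Type u} [Field k] {P : ModularOperadCS.{u, v} k} {Q : OddModularOperadCS.{u, w} k}

/-! ### Weights of powers -/

theorem Fun.star_apply_eq_zero {A : Fun P Q} {M : ℕ} (hA : ∀ i : Arity, i.n + i.g < M → A i = 0)
    (B : Fun P Q) (l : Arity) (hl : l.n + l.g < M + 5) : Fun.star A B l = 0 := by
  rw [Fun.star_apply]
  refine Finset.sum_eq_zero fun p _ => ?_
  have h1 := p.2.1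
  have h2 := p.2.2
  have h3 := p.1.2.stable
  rw [hA p.1.1 (by omega)]
  simp

/-- Multiplication by `S` raises `n + 2 G` by at least `5`: by `3` because of stability, and by `2`
because of the definition of the connected sum. -/
theorem Fun.starPow_apply_eq_zero {A : Fun P Q} {M : ℕ}
    (hA : ∀ i : Arity, i.n + i.g < M → A i = 0) (S : Fun P Q) (n : ℕ) (l : Arity)
    (hl : l.n + l.g < M + 5 * n) : Fun.starPow S A n l = 0 := by
  induction n generalizing l with
  | zero => exact hA l hl
  | succ n ih => exact Fun.star_apply_eq_zero (M := M + 5 * n) ih S l (by omega)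

theorem embedW_eq_zero {q W : ℤ} {A : Fun P Q}
    (hA : ∀ i : Arity, (i.n : ℤ) + i.g + 4 * q + 2 = W → A i = 0) : embedW q W A = 0 := by
  rw [embedW_apply]
  exact Finset.sum_eq_zero fun i _ => by rw [hA i.1 i.2, map_zero]

/-- The weight of `A ⋆ S ^ n ⊗ ϰ^(-(n + 1))` grows with `n`, since `ϰ⁻¹` lowers `W` by only `4`. -/
theorem embedW_starPow_eq_zero {A : Fun P Q} {M : ℕ}
    (hA : ∀ i : Arity, i.n + i.g < M → A i = 0) (S : Fun P Q) {n : ℕ} {W : ℤ}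
    (hW : W + 2 < M + n) : embedW (-(n + 1)) W (Fun.starPow S A n) = 0 :=
  embedW_eq_zero fun i hi => Fun.starPow_apply_eq_zero hA S n i (by omega)

theorem Fun.apply_eq_zero_of_lt_three (A : Fun P Q) (i : Arity) (hi : i.n + i.g < 3) : A i = 0 :=
  absurd i.stable (by omega)

/-- The powers of `S ⊗ ϰ⁻¹` in the completed product. -/
theorem powGe_embed (S : Fun P Q) (n : ℕ) :
    powGe (embed (-1) S) n = embed (-(n + 1)) (Fun.starPow S S n) := by
  induction n with
  | zero => rfl
  | succ n ih =>
    rw [powGe, ih, starGe_embed]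
    · rw [Fun.starPow, Nat.cast_succ, neg_add (n + 1 : ℤ) 1]
    · intro i hi
      exact Fun.starPow_apply_eq_zero S.apply_eq_zero_of_lt_three S n i (by omega)
    · intro i hi
      exact S.apply_eq_zero_of_lt_three i (by omega)

/-! ### Detecting elements modulo `♯ - ϰ` -/

/-- The `m`-fold iterate of `♯`. -/
def sharpPow : ∀ (m : ℕ) {i l : Arity}, l.n = i.n → l.g = i.g + 4 * m →
    (FunComp P Q i →ₗ[k] FunComp P Q l)
  | 0, _, _, hn, hg => (Arity.ext hn hg : _ = _) ▸ LinearMap.id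
  | m + 1, i, _, hn, hg =>
    sharpPow m (i := ⟨i.n, i.g + 4, by have := i.stable; omega⟩) hn (by simp only; omega) ∘ₗ
      sharpComp rfl rfl

theorem sharpPow_injective
    (hsharp : ∀ (i l : Arity) (hn : l.n = i.n) (hg : l.g = i.g + 4),
      Function.Injective (sharpComp (P := P) (Q := Q) hn hg))
    (m : ℕ) {i l : Arity} (hn : l.n = i.n) (hg : l.g = i.g + 4 * m) :
    Function.Injective (sharpPow (P := P) (Q := Q) m hn hg) := by
  induction m generalizing i with
  | zero =>
    obtain rfl : l = i := Arity.ext hn hg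
    exact Function.injective_id
  | succ m ih =>
    rw [sharpPow, LinearMap.coe_comp]
    exact (ih _ _).comp (hsharp _ _ _ _)

/-- The linear map that sends `x ⊗ ϰ^q` to `♯^(N + q) x` if `q ≥ -N` and the arity of `x` has the
same `n` as `l`, and to `0` otherwise. On the summands with `q ≥ -N` it identifies `♯` with `ϰ`. -/
def detect (N : ℕ) {l : Arity} {W : ℤ} (hl : (l.n : ℤ) + l.g - 4 * N + 2 = W) :
    FW P Q W →ₗ[k] FunComp P Q l :=
  FW.lift fun i =>
    if h : l.n = i.arity.n ∧ -(N : ℤ) ≤ i.q then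
      sharpPow (N + i.q).toNat h.1 (by have := i.weight; omega)
    else 0

theorem detect_of (N : ℕ) {l : Arity} {W : ℤ} (hl : (l.n : ℤ) + l.g - 4 * N + 2 = W)
    (i : WIdx W) (h : l.n = i.arity.n ∧ -(N : ℤ) ≤ i.q) {m : ℕ} (hm : (m : ℤ) = N + i.q)
    (hg : l.g = i.arity.g + 4 * m) (x : FunComp P Q i.arity) :
    detect N hl (FW.of i x) = sharpPow m h.1 hg x := by
  obtain rfl : m = (N + i.q).toNat := by omega
  rw [detect, FW.lift_of, dif_pos h]

theorem detect_of_not (N : ℕ) {l : Arity} {W : ℤ} (hl : (l.n : ℤ) + l.g - 4 * N + 2 = W)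
    (i : WIdx W) (h : ¬ (l.n = i.arity.n ∧ -(N : ℤ) ≤ i.q)) (x : FunComp P Q i.arity) :
    detect N hl (FW.of i x) = 0 := by
  rw [detect, FW.lift_of, dif_neg h, LinearMap.zero_apply]

/-- An element `Y` of fixed weight involves finitely many powers of `ϰ`, so that `detect N` kills
`♯ Y - ϰ Y` for all large `N`. -/
theorem exists_detect_relW_eq_zero {W W' : ℤ} (hW : W' = W + 4) (Y : FW P Q W) :
    ∃ N₀ : ℕ, ∀ N, N₀ ≤ N → ∀ {l : Arity} (hl : (l.n : ℤ) + l.g - 4 * N + 2 = W'),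
      detect N hl (relW hW Y) = 0 := by
  induction Y using FW.induction with
  | hz => exact ⟨0, fun N _ l hl => by simp⟩
  | add x y hx hy =>
    obtain ⟨N₁, h₁⟩ := hx
    obtain ⟨N₂, h₂⟩ := hy
    refine ⟨max N₁ N₂, fun N hN l hl => ?_⟩
    rw [map_add, map_add, h₁ N (le_of_max_le_left hN), h₂ N (le_of_max_le_right hN), add_zero]
  | hof i x =>
    refine ⟨(-i.q).toNat, fun N hN l hl => ?_⟩
    rw [relW_of, map_sub]
    have hw := i.weight
    by_cases h : l.n = i.arity.n
    · have hg : l.g = i.arity.g + 4 + 4 * (N + i.q).toNat := by omega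
      rw [detect_of N hl (i.sharp hW) ⟨h, by simp only; omega⟩ (m := (N + i.q).toNat)
          (by simp only; omega) hg,
        detect_of N hl (i.kappa hW) ⟨h, by simp only; omega⟩ (m := (N + i.q).toNat + 1)
          (by simp only; omega) (by simp only; omega)]
      exact sub_self _
    · rw [detect_of_not N hl (i.sharp hW) fun h' => h h'.1,
        detect_of_not N hl (i.kappa hW) fun h' => h h'.1, sub_zero]

/-- If `♯` is injective, then `T ↦ T ⊗ ϰ⁻¹` is injective modulo the relation `♯ = ϰ`. -/
theorem apply_eq_zero_of_embedW_eq_relW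
    (hsharp : ∀ (i l : Arity) (hn : l.n = i.n) (hg : l.g = i.g + 4),
      Function.Injective (sharpComp (P := P) (Q := Q) hn hg))
    {W W' : ℤ} (hW : W' = W + 4) {T : Fun P Q} {Y : FW P Q W}
    (hY : relW hW Y = embedW (-1) W' T) (i : Arity) (hi : (i.n : ℤ) + i.g - 2 = W') : T i = 0 := by
  obtain ⟨N, hN⟩ := exists_detect_relW_eq_zero hW Y
  let l : Arity := ⟨i.n, i.g + 4 * N, by have := i.stable; omega⟩
  have hl : (l.n : ℤ) + l.g - 4 * (N + 1 : ℕ) + 2 = W' := by simp only [l]; push_cast; omega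
  have h := hN (N + 1) (Nat.le_succ N) hl
  let i' : WArity (-1) W' := ⟨i, by omega⟩
  rw [hY, embedW_apply, map_sum, Fintype.sum_eq_single i' fun j hj => ?_,
    detect_of (N + 1) hl i'.idx ⟨rfl, by simp only; omega⟩ (m := N) (by simp) rfl] at h
  · exact sharpPow_injective hsharp N _ _ (h.trans (map_zero _).symm)
  · refine detect_of_not _ hl j.idx (fun h' => hj (Subtype.ext ?_)) _
    have h1 : i.n = j.1.n := h'.1
    have h2 := j.2
    exact Arity.ext h1.symm (by change j.1.g = i.g; omega)

/-! ### The master equation -/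

/-- The right hand side of the theorem, spelled out weight by weight. -/
theorem dDeltaUnital_exp_mk_eq_zero_iff (X : FGe P Q 1) :
    FunExp.dDeltaUnital (FunExp.exp (Submodule.Quotient.mk X : FunExp P Q)) = 0 ↔
      ∀ W : {W : ℤ // 1 ≤ W}, ∃ Y : FW P Q (W.1 - 4),
        relW (Int.sub_add_cancel W.1 4).symm Y = dW W.1 (expGe X W) + deltaW W.1 (expGe X W) := by
  have h : FunExp.dDeltaUnital (FunExp.exp (Submodule.Quotient.mk X : FunExp P Q)) =
      Submodule.Quotient.mk (dDeltaGe (expGe X)) := by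
    simp only [FunExp.dDeltaUnital, FunExp.exp, LinearMap.comp_apply, Unitization.sndHom_apply,
      Unitization.snd_add, Unitization.snd_inl, Unitization.snd_inr, zero_add]
    rfl
  rw [h, Submodule.Quotient.mk_eq_zero, mem_relSub]
  rfl

/-- Modulo the relation `♯ = ϰ`, the component of weight `W/2` of `(d + Δ) e^(S/ϰ)` is that of
`∑ n, ϰ^(-(n + 1)) T ⋆ S ^ n / n!`, where `T = (d + Δ) S + {S, S} / 2`. -/
theorem exists_dDelta_exp_eq [CharZero k] {S : Fun P Q} (hS : S.IsEven)
    (W : {W : ℤ // 1 ≤ W}) : ∃ Z : FW P Q (W.1 - 4),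
      dW W.1 (expGe (embed (-1) S) W) + deltaW W.1 (expGe (embed (-1) S) W) =
        relW (Int.sub_add_cancel W.1 4).symm Z +
          ∑ n ∈ Finset.range (W.1.toNat + 1), ((Nat.factorial n : k)⁻¹) •
            embedW (-(n + 1)) W.1 (Fun.starPow S
              (Fun.d S + Fun.delta S + (1 / 2 : k) • Fun.bracket S S) n) := by
  obtain ⟨W, hW⟩ := W
  set M := W.toNat with hM
  set A := Fun.d S + Fun.delta S with hA
  set B := Fun.bracket S S with hB
  have vanish : ∀ A : Fun P Q, embedW (-(M + 1)) W (Fun.starPow S A M) = 0 := fun A =>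
    embedW_starPow_eq_zero A.apply_eq_zero_of_lt_three S (by omega)
  -- The summand `n = M` vanishes for weight reasons, so that it may be included.
  have e1 : dW W (expGe (embed (-1) S) ⟨W, hW⟩) + deltaW W (expGe (embed (-1) S) ⟨W, hW⟩) =
      ∑ n ∈ Finset.range (M + 1), ((Nat.factorial (n + 1) : k)⁻¹) •
        embedW (-(n + 1)) W (Fun.d (Fun.starPow S S n) + Fun.delta (Fun.starPow S S n)) := by
    have e : expGe (embed (-1) S) ⟨W, hW⟩ = ∑ n ∈ Finset.range (M + 1),
        ((Nat.factorial (n + 1) : k)⁻¹) • embedW (-(n + 1)) W (Fun.starPow S S n) := by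
      rw [Finset.sum_range_succ, vanish, smul_zero, add_zero]
      exact Finset.sum_congr rfl fun n _ => by rw [powGe_embed, embed_apply]
    rw [e, map_sum, map_sum, ← Finset.sum_add_distrib]
    refine Finset.sum_congr rfl fun n _ => ?_
    rw [map_smul, map_smul, dW_embedW, deltaW_embedW, ← smul_add, map_add]
  -- The factor `♯` of the second summand of `(d + Δ) S ^ (m + 2)` is traded for `ϰ`.
  have e2 : ∀ m : ℕ, ((Nat.factorial (m + 1 + 1) : k)⁻¹) • embedW (-((m + 1 : ℕ) + 1)) W
      (Fun.d (Fun.starPow S S (m + 1)) + Fun.delta (Fun.starPow S S (m + 1))) =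
      relW (Int.sub_add_cancel W 4).symm
        (((Nat.factorial m : k)⁻¹ * (1 / 2)) • embedW (-((m + 1 : ℕ) + 1)) (W - 4)
          (Fun.starPow S B m)) +
      ((Nat.factorial (m + 1) : k)⁻¹ • embedW (-((m + 1 : ℕ) + 1)) W (Fun.starPow S A (m + 1)) +
        ((Nat.factorial m : k)⁻¹ * (1 / 2)) • embedW (-(m + 1)) W (Fun.starPow S B m)) := by
    intro m
    have hm : (Nat.factorial m : k) ≠ 0 := Nat.cast_ne_zero.2 (Nat.factorial_ne_zero m)
    have hm1 : (m : k) + 1 ≠ 0 := Nat.cast_add_one_ne_zero m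
    have hm2 : (m : k) + 2 ≠ 0 := by
      have := Nat.cast_add_one_ne_zero (R := k) (m + 1)
      push_cast at this
      rwa [add_assoc, one_add_one_eq_two] at this
    have c1 : (Nat.factorial (m + 1 + 1) : k)⁻¹ * ((m : k) + 2) =
        (Nat.factorial (m + 1) : k)⁻¹ := by
      rw [Nat.factorial_succ (m + 1), Nat.factorial_succ m]
      push_cast
      rw [add_assoc, one_add_one_eq_two]
      field_simp
    have c2 : (Nat.factorial (m + 1 + 1) : k)⁻¹ * (((m : k) + 2) * ((m : k) + 1) / 2) =
        (Nat.factorial m : k)⁻¹ * (1 / 2) := by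
      rw [Nat.factorial_succ (m + 1), Nat.factorial_succ m]
      push_cast
      rw [add_assoc, one_add_one_eq_two]
      field_simp
    have q1 : (-((m + 1 : ℕ) + 1) + 1 : ℤ) = -(m + 1) := by push_cast; ring
    rw [Fun.d_add_delta_starPow hS, map_add, map_smul, map_smul, smul_add, smul_smul, smul_smul,
      c1, c2, map_smul, relW_embedW, q1, smul_sub]
    abel
  refine ⟨∑ m ∈ Finset.range M, ((Nat.factorial m : k)⁻¹ * (1 / 2)) •
    embedW (-((m + 1 : ℕ) + 1)) (W - 4) (Fun.starPow S B m), ?_⟩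
  have e0 : ((Nat.factorial (0 + 1) : k)⁻¹) • embedW (-((0 : ℕ) + 1)) W
      (Fun.d (Fun.starPow S S 0) + Fun.delta (Fun.starPow S S 0)) =
      ((Nat.factorial 0 : k)⁻¹) • embedW (-((0 : ℕ) + 1)) W (Fun.starPow S A 0) := rfl
  rw [e1, Finset.sum_range_succ', e0, Finset.sum_congr rfl fun m _ => e2 m, Finset.sum_add_distrib,
    Finset.sum_add_distrib, ← map_sum]
  simp only [Fun.starPow_add, Fun.starPow_smul, map_add, map_smul, smul_add, smul_smul]
  rw [Finset.sum_add_distrib (f := fun n : ℕ => (Nat.factorial n : k)⁻¹ •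
    embedW (-(n + 1)) W (Fun.starPow S A n)), Finset.sum_range_succ' _ M,
    Finset.sum_range_succ _ M, vanish B, smul_zero, add_zero]
  abel

end MasterEquation

end BDOperad

end

theorem mainTheorem2 {k : Type u} [Field k] [CharZero k]
    (P : BDOperad.ModularOperadCS.{u, v} k) (Q : BDOperad.OddModularOperadCS.{u, w} k)
    (hsharp : ∀ (i l : BDOperad.Arity) (hn : l.n = i.n) (hg : l.g = i.g + 4),
      Function.Injective (BDOperad.sharpComp (P := P) (Q := Q) hn hg))
    (S : BDOperad.Fun P Q) (hS : BDOperad.Fun.IsDegreeZero S) :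
    BDOperad.Fun.d S + BDOperad.Fun.delta S + (1 / 2 : k) • BDOperad.Fun.bracket S S = 0 ↔
      BDOperad.FunExp.dDeltaUnital (BDOperad.FunExp.exp (BDOperad.iotaDivKappa S)) = 0 := by
  open BDOperad in
  refine Iff.trans ?_ (dDeltaUnital_exp_mk_eq_zero_iff _).symm
  set T := Fun.d S + Fun.delta S + (1 / 2 : k) • Fun.bracket S S with hT
  constructor
  · intro h W
    obtain ⟨Z, hZ⟩ := exists_dDelta_exp_eq hS.isEven W
    rw [← hT, h] at hZ
    refine ⟨Z, ?_⟩
    have h0 : ∀ n, Fun.starPow S (0 : Fun P Q) n = 0 := fun n => by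
      simpa using Fun.starPow_smul S (0 : k) 0 n
    simp only [hZ, h0, map_zero, smul_zero, Finset.sum_const_zero, add_zero]
  · intro h
    -- Induction on `M`: the lowest component of `T` is detected in weight `(M - 2)/2`, where the
    -- summands `T ⋆ S ^ n ⊗ ϰ^(-(n + 1))` with `n > 0` do not contribute.
    have key : ∀ M : ℕ, ∀ i : Arity, i.n + i.g < M → T i = 0 := by
      intro M
      induction M with
      | zero => intro i hi; omega
      | succ M ih =>
        intro i hi
        rcases Nat.lt_succ_iff_lt_or_eq.1 hi with hi | hi
        · exact ih i hi
        have hs := i.stable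
        let W : {W : ℤ // 1 ≤ W} := ⟨M - 2, by omega⟩
        obtain ⟨Y, hY⟩ := h W
        obtain ⟨Z, hZ⟩ := exists_dDelta_exp_eq hS.isEven W
        rw [← hT, Finset.sum_range_succ', Finset.sum_eq_zero fun n _ => ?_, zero_add, ← hY] at hZ
        · refine apply_eq_zero_of_embedW_eq_relW hsharp (Int.sub_add_cancel W.1 4).symm
            (Y := Y - Z) ?_ i (by simp only [W]; omega)
          rw [map_sub, hZ, add_sub_cancel_left]
          simp [Fun.starPow]
        · rw [embedW_starPow_eq_zero ih S (by simp only [W]; push_cast; omega), smul_zero]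
    funext i
    exact key (i.n + i.g + 1) i (Nat.lt_succ_self _)
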